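/- **Definitions.** Let $n:\mathbb N\to\mathbb N$. A family $f=\{f_k\}_{k\ge 0}$ of functions $f_k:\{0,1\}^{n(k)}\to\{0,1\}^{n(k)}$ is *regular* if, for each $k$, the number $|\{x': f_k(x')=f_k(x)\}|$ does not depend on $x$. We also write $f(k,x)$ for $f_k(x)$. A *fully black-box construction of a pseudorandom generator from a regular one-way function* with input length $n$ consists of length functions $m,m':\mathbb N\to\mathbb N$ with $m'(\ell)>m(\ell)$ for all $\ell$, and of two (uniform) oracle algorithms $(g,A)$, such that: 1. $g$ is deterministic, and for every regular family $f$ it computes with oracle $f$, on input $(1^\ell,v)$ with $v\in\{0,1\}^{m(\ell)}$, a value $g^{(f)}(\ell,v)\in\{0,1\}^{m'(\ell)}$, in time polynomial in $\ell$. 2. $A$ is a probabilistic oracle algorithm that, for every regular family $f$ and every family $B$ of predicates $B(\ell,\cdot):\{0,1\}^{m'(\ell)}\to\{0,1\}$, runs with oracles $(B,f)$ on input $(k,\epsilon,y)$, $y\in\{0,1\}^{n(k)}$, in time polynomial in $k$ and $1/\epsilon$. ($k$ and the integer $1/\epsilon$ are given in unary.) 3. For every regular family $f$, every $\epsilon(\ell)=1/p(\ell)$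 with $p$ a polynomial with natural number coefficients that is positive on $\mathbb N$, and every $B$: if $$\Pr_{v}[B(\ell,g^{(f)}(\ell,v))=1]-\Pr_{w}[B(\ell,w)=1]\ \ge\ \epsilon(\ell)$$ for infinitely many $\ell$, where $v\in\{0,1\}^{m(\ell)}$ and $w\in\{0,1\}^{m'(\ell)}$ are uniform, then the function $$k\mapsto \Pr_{x,A}\bigl[f_k\bigl(A^{(B,f)}(k,\epsilon(k),f_k(x))\bigr)=f_k(x)\bigr]$$ (with $x\in\{0,1\}^{n(k)}$ uniform) is not negligible in $k$. In 1 and 2 the polynomial that bounds the running time may depend on the oracles. The construction is *security parameter restricted* if, for every $k$ and all such oracles, $g(k,\cdot)$ calls $f$ only as $f(k,\cdot)$, and $A(k,\cdot,\cdot)$ calls its oracles only as $f(k,\cdot)$ and $B(k,\cdot)$. **Theorem 1.** Let $n,r:\mathbb N\to\mathbb N$ be polynomially bounded and computable in time polynomial in $k$ (with $k$ given in unary). Suppose that $n$ is polynomially related to $k$, that is, $k\le n(k)^c+c$ for some constant $c$ and all $k$, and that $$r(k)\in o\!\left(\frac{n(k)}{\log n(k)}\right).$$ Then there is no security parameter restricted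 fully black-box construction of a pseudorandom generator from a regular one-way function with input length $n$ such that $g(k,v)$ makes at most $r(k)$ calls to $f(k,\cdot)$ for every regular $f$, every $k$ and every $v\in\{0,1\}^{m(k)}$. A construction that works for all one-way functions works in particular for all regular ones, so it is excluded as well. -/

import Mathlib

open Filter Asymptotics MeasureTheory

/-! ### Probabilistic oracle machines with a step count -/

/-- Instructions of a machine with control states `σ`, oracles named by `ι`, and stacks of bits
numbered by natural numbers (a Turing machine tape is a pair of stacks):
* `halt`: stop;
* `push i b q`: put the bit `b` on stack `i` and go to state `q`;
* `pop i q`: remove the top bit of stack `i`, if there is one, and branch on what it was;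
* `flip q`: branch on a fresh fair coin;
* `query o i q`: ask oracle `o` the string on stack `i` (top first), replace that string by the
  answer, and go to state `q`. -/
inductive Instr (ι σ : Type) : Type
  | halt : Instr ι σ
  | push (i : ℕ) (b : Bool) (q : σ) : Instr ι σ
  | pop (i : ℕ) (q : Option Bool → σ) : Instr ι σ
  | flip (q : Bool → σ) : Instr ι σ
  | query (o : ι) (i : ℕ) (q : σ) : Instr ι σ

/-- An oracle machine is a finite program: finitely many states, one instruction for each, with
start state `0`. (A finite program uses only finitely many of the stacks.) -/
structure OracleMachine (ι : Type) : Type where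
  states : ℕ
  code : Fin (states + 1) → Instr ι (Fin (states + 1))

namespace OracleMachine

variable {ι : Type} (M : OracleMachine ι)

/-- A configuration: the control state and the contents of the stacks. -/
structure Config : Type where
  state : Fin (M.states + 1)
  stack : ℕ → List Bool

/-- The machine flips no coins. -/
def Deterministic : Prop :=
  ∀ s q, M.code s ≠ Instr.flip q

/-- Start in state `0`, with the `i`-th input string on stack `i` and all other stacks empty. -/
def init (input : List (List Bool)) : M.Config :=
  ⟨0, fun i => input.getD i []⟩

/-- One step, with oracles `O` and fresh coin `b`. A halted machine stays where it is. -/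
def step (O : ι → List Bool → List Bool) (b : Bool) (c : M.Config) : M.Config :=
  match M.code c.state with
  | .halt => c
  | .push i a q => ⟨q, Function.update c.stack i (a :: c.stack i)⟩
  | .pop i q => ⟨q (c.stack i).head?, Function.update c.stack i (c.stack i).tail⟩
  | .flip q => ⟨q b, c.stack⟩
  | .query o i q => ⟨q, Function.update c.stack i (O o (c.stack i))⟩

/-- The configuration after `t` steps, where the coin available at step `t` is `ω t`. -/
def run (O : ι → List Bool → List Bool) (ω : ℕ → Bool) (input : List (List Bool)) :
    ℕ → M.Config
  | 0 => M.init input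
  | t + 1 => M.step O (ω t) (run O ω input t)

/-- The machine has halted after at most `t` steps. -/
def HaltsWithin (O : ι → List Bool → List Bool) (ω : ℕ → Bool) (input : List (List Bool))
    (t : ℕ) : Prop :=
  M.code (M.run O ω input t).state = Instr.halt

/-- The machine has halted after at most `t` steps, with `out` as its output (on stack `0`). -/
def OutputsWithin (O : ι → List Bool → List Bool) (ω : ℕ → Bool) (input : List (List Bool))
    (t : ℕ) (out : List Bool) : Prop :=
  M.HaltsWithin O ω input t ∧ (M.run O ω input t).stack 0 = out

/-- The machine halts with output `out`. -/
def Outputs (O : ι → List Bool → List Bool) (ω : ℕ → Bool) (input : List (List Bool))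
    (out : List Bool) : Prop :=
  ∃ t, M.OutputsWithin O ω input t out

/-- In configuration `c` the machine is about to ask oracle `o` the string `s`. -/
def Asks (c : M.Config) (o : ι) (s : List Bool) : Prop :=
  ∃ i q, M.code c.state = Instr.query o i q ∧ c.stack i = s

end OracleMachine

/-- The unary representation `1 ^ k`. -/
def unary (k : ℕ) : List Bool := List.replicate k true

/-- The coin tape of a machine that flips no coins. -/
def noCoins : ℕ → Bool := fun _ => false

/-- The law of an infinite sequence of independent fair coins. -/
noncomputable def coinMeasure : Measure (ℕ → Bool) :=
  Measure.infinitePi fun _ : ℕ => (PMF.uniformOfFintype Bool).toMeasure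

/-- `h` is bounded by a polynomial. -/
def PolyBounded (h : ℕ → ℕ) : Prop :=
  ∃ c : ℕ, ∀ k, h k ≤ k ^ c + c

/-- `h` can be computed in polynomial time: a deterministic machine without oracles maps `1 ^ k`
to `1 ^ (h k)` in time polynomial in `k`. -/
def PolyTimeComputable (h : ℕ → ℕ) : Prop :=
  ∃ M : OracleMachine Empty, M.Deterministic ∧ ∃ c : ℕ, ∀ k,
    M.OutputsWithin (fun o _ => o.elim) noCoins [unary k] (k ^ c + c) (unary (h k))

/-! ### The oracles -/

/-- Bit strings of length `l`. -/
abbrev Bits (l : ℕ) : Type := List.Vector Bool l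

/-- Splits `1 ^ k 0 x` into `k` and `x`. -/
def splitUnary : List Bool → Option (ℕ × List Bool)
  | [] => none
  | false :: x => some (0, x)
  | true :: s => (splitUnary s).map fun p => (p.1 + 1, p.2)

/-- A query string is the call `(k, x)` if it is `1 ^ k 0 x` where `x` has the length `len k` that
the oracle expects for the security parameter `k`. Other strings are no calls. -/
def decodeCall (len : ℕ → ℕ) (s : List Bool) : Option (Σ k, Bits (len k)) :=
  match splitUnary s with
  | none => none
  | some (k, x) => if h : x.length = len k then some ⟨k, ⟨x, h⟩⟩ else none

/-- A length preserving function family with input length `n k` for security parameter `k`. -/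
abbrev Family (n : ℕ → ℕ) : Type := ∀ k, Bits (n k) → Bits (n k)

/-- For each `k`, the number of preimages of `f k x` does not depend on `x`. -/
def Family.Regular {n : ℕ → ℕ} (f : Family n) : Prop :=
  ∀ k x₁ x₂, Nat.card {x // f k x = f k x₁} = Nat.card {x // f k x = f k x₂}

/-- A breaker for strings of length `m' ℓ`: an arbitrary family of predicates. -/
abbrev Breaker (m' : ℕ → ℕ) : Type := ∀ ℓ, Bits (m' ℓ) → Bool

/-- `f` as an oracle; strings that are no calls get the empty answer. -/
def owfOracle {n : ℕ → ℕ} (f : Family n) (s : List Bool) : List Bool :=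
  match decodeCall n s with
  | none => []
  | some ⟨k, x⟩ => (f k x).toList

/-- A breaker as an oracle; strings that are no calls get the empty answer. -/
def breakerOracle {m' : ℕ → ℕ} (B : Breaker m') (s : List Bool) : List Bool :=
  match decodeCall m' s with
  | none => []
  | some ⟨ℓ, w⟩ => [B ℓ w]

/-- The two oracles of the security reduction. -/
inductive OracleName : Type
  | owf
  | breaker

/-- The pair of oracles `(B, f)`. -/
def bothOracles {n m' : ℕ → ℕ} (f : Family n) (B : Breaker m') : OracleName → List Bool → List Bool
  | .owf => owfOracle f
  | .breaker => breakerOracle B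

/-! ### Black-box constructions of a pseudorandom generator from a regular one-way function -/

/-- The probability that `P` holds for a uniformly random element of a finite type. -/
noncomputable def uniformProb {α : Type} [Fintype α] (P : α → Prop) : ℝ :=
  (Nat.card {a // P a} : ℝ) / Fintype.card α

/-- The data of a construction: seed and output lengths, the construction `g` (with oracle `f`),
and the security reduction `A` (with oracles `f` and the breaker). -/
structure Construction : Type where
  m : ℕ → ℕ
  m' : ℕ → ℕ
  g : OracleMachine Unit
  A : OracleMachine OracleName

namespace Construction

variable (C : Construction) {n : ℕ → ℕ}

/-- The evaluation of `g ^ f (ℓ, v)` after `t` steps. -/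
def gRun (f : Family n) (ℓ : ℕ) (v : Bits (C.m ℓ)) (t : ℕ) : C.g.Config :=
  C.g.run (fun _ => owfOracle f) noCoins [unary ℓ, v.toList] t

/-- `g ^ f (ℓ, v) = w`. -/
def GEval (f : Family n) (ℓ : ℕ) (v : Bits (C.m ℓ)) (w : Bits (C.m' ℓ)) : Prop :=
  C.g.Outputs (fun _ => owfOracle f) noCoins [unary ℓ, v.toList] w.toList

/-- The input `(k, ε, y)` of the reduction, where `ε = 1 / e`. -/
def AInput (k e : ℕ) (y : Bits (n k)) : List (List Bool) :=
  [unary k, unary e, y.toList]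

/-- `Pr_v [B(ℓ, g ^ f (ℓ, v)) = 1] - Pr_w [B(ℓ, w) = 1]`. -/
noncomputable def advantage (f : Family n) (B : Breaker C.m') (ℓ : ℕ) : ℝ :=
  uniformProb (fun v : Bits (C.m ℓ) => ∃ w, C.GEval f ℓ v w ∧ B ℓ w = true)
    - uniformProb (fun w : Bits (C.m' ℓ) => B ℓ w = true)

/-- `Pr_{x, A} [A ^ (B, f) (k, 1 / e, f_k(x)) inverts f_k]`. -/
noncomputable def inversionProb (f : Family n) (B : Breaker C.m') (k e : ℕ) : ℝ :=
  (∑ x : Bits (n k), coinMeasure.real {ω | ∃ x' : Bits (n k),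
      C.A.Outputs (bothOracles f B) ω (AInput k e (f k x)) x'.toList ∧ f k x' = f k x})
    / Fintype.card (Bits (n k))

/-- `C` is a fully black-box construction of a pseudorandom generator from a regular one-way
function with input length `n k`. -/
structure IsFullyBlackBox (C : Construction) (n : ℕ → ℕ) : Prop where
  /-- the generator is a deterministic algorithm -/
  deterministic : C.g.Deterministic
  /-- the generator expands -/
  expanding : ∀ ℓ, C.m ℓ < C.m' ℓ
  /-- for every oracle, `g` computes functions from `m ℓ` bits to `m' ℓ` bits in polynomial time
  (the polynomial may depend on the oracle) -/
  construction : ∀ f : Family n, f.Regular → ∃ c : ℕ, ∀ ℓ (v : Bits (C.m ℓ)),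
    ∃ w : Bits (C.m' ℓ), C.g.OutputsWithin (fun _ => owfOracle f) noCoins
      [unary ℓ, v.toList] (ℓ ^ c + c) w.toList
  /-- for all oracles, `A` runs in time polynomial in `k` and `1 / ε = e`
  (the polynomial may depend on the oracles) -/
  reduction_time : ∀ f : Family n, f.Regular → ∀ B : Breaker C.m', ∃ c : ℕ,
    ∀ k e (y : Bits (n k)) (ω : ℕ → Bool), 0 < e →
      C.A.HaltsWithin (bothOracles f B) ω (AInput k e y) ((k + e) ^ c + c)
  /-- for every inverse polynomial `ε = 1 / p`: if a breaker distinguishes with advantage `ε` for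
  infinitely many security parameters, then `A` inverts with non-negligible probability -/
  reduction : ∀ f : Family n, f.Regular → ∀ p : Polynomial ℕ, (∀ ℓ, 0 < p.eval ℓ) →
    ∀ B : Breaker C.m', (∃ᶠ ℓ in atTop, 1 / ((p.eval ℓ : ℕ) : ℝ) ≤ C.advantage f B ℓ) →
      ¬ SuperpolynomialDecay atTop (fun k : ℕ => (k : ℝ))
        (fun k => C.inversionProb f B k (p.eval k))

/-- `g(k, ·)` calls only `f(k, ·)`, and `A(k, ·)` calls only `f(k, ·)` and `B(k, ·)`. -/
structure SecurityParameterRestricted (C : Construction) (n : ℕ → ℕ) : Prop where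
  construction : ∀ f : Family n, f.Regular → ∀ k (v : Bits (C.m k)) t o s k' x,
    C.g.Asks (C.gRun f k v t) o s → decodeCall n s = some ⟨k', x⟩ → k' = k
  reduction_owf : ∀ f : Family n, f.Regular → ∀ (B : Breaker C.m') k e (y : Bits (n k))
    (ω : ℕ → Bool) t s k' x, 0 < e →
    C.A.Asks (C.A.run (bothOracles f B) ω (AInput k e y) t) .owf s →
      decodeCall n s = some ⟨k', x⟩ → k' = k
  reduction_breaker : ∀ f : Family n, f.Regular → ∀ (B : Breaker C.m') k e (y : Bits (n k))
    (ω : ℕ → Bool) t s k' w, 0 < e →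
    C.A.Asks (C.A.run (bothOracles f B) ω (AInput k e y) t) .breaker s →
      decodeCall C.m' s = some ⟨k', w⟩ → k' = k

/-- `g(k, v)` makes at most `r k` calls to `f(k, ·)`: that many steps are such calls. -/
def CallsAtMost (C : Construction) (n r : ℕ → ℕ) : Prop :=
  ∀ f : Family n, f.Regular → ∀ k (v : Bits (C.m k)),
    {t : ℕ | ∃ o s x, C.g.Asks (C.gRun f k v t) o s ∧
      decodeCall n s = some ⟨k, x⟩}.encard ≤ r k

end Construction

namespace BlackBox
open Finset
open scoped Classical

noncomputable section

/-! ### Counting permutations and functions -/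

section Counting

variable {α : Type} [Fintype α]

/-! Generator and reduction stay within one security parameter `k`. So it suffices to find, for each
large `k`, a regular function `f_k` and a predicate `B_k` such that `B_k` has advantage 1/8 against
the generator while the reduction inverts `f_k` with probability at most poly(k) * 2^(-a), where a
is about n/(1000(r+1)) and hence superlogarithmic. The choices for the different `k` are glued into
one family and one breaker, which contradicts the reduction property with ε = 1/8.

The function is random. The N = 2^n points are cut into M = 2^(n-d) blocks of size K = 2^d; the
blocks get random distinct names, and one further spare name is unused. With r queries and r² far
below M, the generator sees f essentially as a random permutation, whatever d is
(`Frame.card_extends_ge`).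

The breaker works with the paths of an output w: the sets of query-answer pairs of seeds that
produce w with some permutation as oracle. Accepting w whenever one of its paths lies in f catches
all generator outputs, but could help inversion, because renaming a single block might change the
answer. A path is light if, for every partial information T, S about it (some pairs, and some
further labels known to be in the image), only 2^(-Δ) seeds with output w are expected; it is heavy
if for some T, S at least 2^Δ are expected. Light paths inside f are accepted as they are. Heavy
paths are accepted more generously: a pair may also be replaced by a random guess of the block that
belongs to its label, and the number of guesses is itself random below J = 2^a.

Few strings are accepted. Light acceptance needs an actual seed, so it covers at most half of all
strings. Heavy acceptance is rare by a union bound over T, S together with Kraft's inequality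
(`sum_card_heavyAcc_le`). Most generator outputs are accepted. The expectation at least doubles when
d grows by one, so a path is neither light nor heavy for at most 2Δ values of d, and among n/2
values of d some one makes this rare (`exists_few_critical`).

Inversion fails by symmetry. A challenge that names a random block `a` has the same law as the spare
name as challenge with `a` renamed to it. The run is compared with the run before renaming, which
knows nothing of `a`. The two differ only if a point of `a` is asked or a breaker answer changes. An
accepted path meets at most r blocks. A new light path comes from a near path, and a moment bound
shows that there are few of these (`card_nearPaths_ge_le`). For a new heavy path, the renaming acts
like one more guess, which matters with probability at most 1/J because the number of guesses is
random (`sum_newHeavy_le`).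

All of this needs Δ of order r * (log n + a) but below n/64. This is where r = o(n / log n) enters.
-/

theorem exists_perm_extending (U : Finset α) (g : α → α) (hg : Set.InjOn g U) :
    ∃ ρ : Equiv.Perm α, ∀ u ∈ U, ρ u = g u := by
  obtain ⟨h, hh⟩ := Finset.exists_equiv_extend_of_card_eq (t := (univ : Finset α))
    (by simp) (s := U) (f := g) (by simp) hg
  exact ⟨h.trans (Equiv.subtypeUnivEquiv (by simp)), fun u hu => by simpa using hh u hu⟩

/-- Dividing by one permutation that extends `g` on `U` leaves the permutations that fix `U`
pointwise, that is, the permutations of its complement. -/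
theorem card_perm_agree (U : Finset α) (g : α → α) (hg : Set.InjOn g U) :
    (univ.filter fun σ : Equiv.Perm α => ∀ u ∈ U, σ u = g u).card
      = (Fintype.card α - U.card).factorial := by
  obtain ⟨ρ, hρ⟩ := exists_perm_extending U g hg
  have h1 : (univ.filter fun σ : Equiv.Perm α => ∀ u ∈ U, σ u = g u).card
      = Fintype.card {f : Equiv.Perm α // ∀ a, ¬ (a ∉ U) → f a = a} := by
    rw [Fintype.card_subtype]
    refine Finset.card_bij' (fun σ _ => ρ⁻¹ * σ) (fun σ _ => ρ * σ) ?_ ?_ ?_ ?_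
    · intro σ hσ
      simp only [mem_filter, mem_univ, true_and, not_not] at hσ ⊢
      intro u hu
      simp [Equiv.Perm.mul_apply, hσ u hu, ← hρ u hu]
    · intro σ hσ
      simp only [mem_filter, mem_univ, true_and, not_not] at hσ ⊢
      intro u hu
      simp [Equiv.Perm.mul_apply, hσ u hu, hρ u hu]
    · intro σ _; simp
    · intro σ _; simp
  rw [h1, ← Fintype.card_congr (Equiv.Perm.subtypeEquivSubtypePerm fun a => a ∉ U),
    Fintype.card_perm]
  congr 1
  rw [Fintype.card_subtype_compl]
  simp

/-- Sampling without replacement costs at most a factor 2 against sampling with replacement: the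
falling factorial is at least (N - l)^l, and Bernoulli's inequality gives (1 - l/N)^l ≥ 1 - l²/N ≥
1/2. -/
theorem factorial_sub_mul_le {N l : ℕ} (h : 2 * l ^ 2 ≤ N) :
    ((N - l).factorial : ℝ) * (N : ℝ) ^ l ≤ 2 * N.factorial := by
  have hl : l ≤ N := by nlinarith
  rcases Nat.eq_zero_or_pos N with rfl | hN
  · have : l = 0 := by omega
    subst this; simp
  have hN' : (0 : ℝ) < N := by exact_mod_cast hN
  have h1 : ((N + 1 - l) ^ l : ℕ) ≤ N.descFactorial l := Nat.pow_sub_le_descFactorial N l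
  have h2 : (N - l).factorial * N.descFactorial l = N.factorial :=
    Nat.factorial_mul_descFactorial hl
  have h3 : ((N : ℝ) - l) ^ l ≤ N.descFactorial l := by
    have : ((N : ℝ) - l) ^ l ≤ ((N + 1 - l : ℕ) : ℝ) ^ l := by
      apply pow_le_pow_left₀
      · have : (l : ℝ) ≤ N := by exact_mod_cast hl
        linarith
      · rw [Nat.cast_sub (by omega)]; push_cast; linarith
    refine this.trans ?_
    exact_mod_cast h1
  have h4 : (N : ℝ) ^ l ≤ 2 * ((N : ℝ) - l) ^ l := by
    have hb := one_add_mul_le_pow (a := -((l : ℝ) / N)) (by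
      have : (l : ℝ) / N ≤ 1 := by rw [div_le_one hN']; exact_mod_cast hl
      linarith) l
    have h5 : (1 : ℝ) / 2 ≤ 1 + l * -((l : ℝ) / N) := by
      have : (l : ℝ) * (l / N) ≤ 1 / 2 := by
        rw [← mul_div_assoc, div_le_iff₀ hN']
        have : (2 * (l : ℝ) ^ 2) ≤ N := by exact_mod_cast h
        nlinarith
      linarith
    have h6 : ((N : ℝ) - l) ^ l = (N : ℝ) ^ l * (1 + -((l : ℝ) / N)) ^ l := by
      rw [← mul_pow]; congr 1; field_simp; ring
    rw [h6]
    have : (0 : ℝ) < (N : ℝ) ^ l := by positivity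
    nlinarith
  calc ((N - l).factorial : ℝ) * (N : ℝ) ^ l
      ≤ (N - l).factorial * (2 * N.descFactorial l) := by
        gcongr; linarith
    _ = 2 * N.factorial := by rw [← h2]; push_cast; ring

/-- A uniform permutation sends the points of `U` into prescribed sets with at most twice the
probability that independent uniform values would. -/
theorem card_perm_mem_le (U : Finset α) (C : α → Finset α) (hU : 2 * U.card ^ 2 ≤ Fintype.card α) :
    ((univ.filter fun σ : Equiv.Perm α => ∀ u ∈ U, σ u ∈ C u).card : ℝ)
      ≤ 2 * (Fintype.card α).factorial * ∏ u ∈ U, ((C u).card : ℝ) / Fintype.card α := by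
  set N := Fintype.card α with hN
  rcases Nat.eq_zero_or_pos N with h0 | hpos
  · have he : IsEmpty α := Fintype.card_eq_zero_iff.mp h0
    have : U = ∅ := Finset.eq_empty_of_isEmpty U
    subst this
    simp [h0]
  have hN' : (0 : ℝ) < N := by exact_mod_cast hpos
  have h1 : (univ.filter fun σ : Equiv.Perm α => ∀ u ∈ U, σ u ∈ C u)
      ⊆ (U.pi C).biUnion (fun g => univ.filter fun σ : Equiv.Perm α => ∀ u (hu : u ∈ U),
        σ u = g u hu) := by
    intro σ hσ
    simp only [mem_filter, mem_univ, true_and, mem_biUnion, Finset.mem_pi] at hσ ⊢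
    exact ⟨fun u _ => σ u, fun u hu => hσ u hu, fun _ _ => rfl⟩
  have h2 : ∀ g ∈ U.pi C, (univ.filter fun σ : Equiv.Perm α => ∀ u (hu : u ∈ U),
        σ u = g u hu).card ≤ (N - U.card).factorial := by
    intro g _
    by_cases hne : (univ.filter fun σ : Equiv.Perm α => ∀ u (hu : u ∈ U), σ u = g u hu).Nonempty
    · obtain ⟨ρ, hρ⟩ := hne
      simp only [mem_filter, mem_univ, true_and] at hρ
      rw [← card_perm_agree U ρ ρ.injective.injOn]
      apply Finset.card_le_card
      intro σ hσ
      simp only [mem_filter, mem_univ, true_and] at hσ ⊢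
      intro u hu
      rw [hσ u hu, hρ u hu]
    · rw [Finset.not_nonempty_iff_eq_empty] at hne
      simp [hne]
  have h3 := (Finset.card_le_card h1).trans (Finset.card_biUnion_le_card_mul _ _ _ h2)
  rw [Finset.card_pi] at h3
  have h4 := factorial_sub_mul_le hU
  calc ((univ.filter fun σ : Equiv.Perm α => ∀ u ∈ U, σ u ∈ C u).card : ℝ)
      ≤ ((∏ u ∈ U, (C u).card) * (N - U.card).factorial : ℕ) := by exact_mod_cast h3
    _ = (∏ u ∈ U, ((C u).card : ℝ) / N) * ((N - U.card).factorial * (N : ℝ) ^ U.card) := by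
        rw [Finset.prod_div_distrib, Finset.prod_const]
        push_cast
        have hX : (N : ℝ) ^ U.card ≠ 0 := by positivity
        generalize ((N - U.card).factorial : ℝ) = F
        generalize (N : ℝ) ^ U.card = X at hX
        rw [div_mul_eq_mul_div, eq_div_iff hX, mul_assoc]
    _ ≤ (∏ u ∈ U, ((C u).card : ℝ) / N) * (2 * N.factorial) := by
        exact mul_le_mul_of_nonneg_left h4 (Finset.prod_nonneg fun _ _ => by positivity)
    _ = _ := mul_comm _ _

theorem sum_perm_inv {M : Type} [AddCommMonoid M] (F : Equiv.Perm α → M) :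
    ∑ σ : Equiv.Perm α, F σ⁻¹ = ∑ σ, F σ :=
  Fintype.sum_equiv (Equiv.inv _) _ _ fun _ => rfl

theorem card_filter_perm_inv (p : Equiv.Perm α → Prop) :
    (univ.filter fun σ : Equiv.Perm α => p σ⁻¹).card = (univ.filter p).card := by
  rw [Finset.card_filter, Finset.card_filter]
  exact sum_perm_inv fun σ => if p σ then 1 else 0

/-- Prescribing the values of a function on a set `Z`. -/
theorem card_fun_agree {ι β : Type} [Fintype ι] [DecidableEq ι] [Fintype β] (Z : Finset ι) (b : ι → β) :
    ((univ.filter fun c : ι → β => ∀ z ∈ Z, c z = b z).card : ℝ) * (Fintype.card β : ℝ) ^ Z.card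
      = Fintype.card (ι → β) := by
  have h : (univ.filter fun c : ι → β => ∀ z ∈ Z, c z = b z)
      = Fintype.piFinset fun z => if z ∈ Z then {b z} else univ := by
    ext c
    simp only [mem_filter, mem_univ, true_and, Fintype.mem_piFinset]
    refine forall_congr' fun z => ?_
    by_cases hz : z ∈ Z <;> simp [hz]
  rw [h, Fintype.card_piFinset, Fintype.card_fun]
  have h2 : ∀ z, (if z ∈ Z then ({b z} : Finset β) else univ).card
      = if z ∈ Z then 1 else Fintype.card β := by
    intro z; by_cases hz : z ∈ Z <;> simp [hz]
  simp only [h2]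
  rw [Finset.prod_ite]
  simp only [prod_const, one_pow, one_mul]
  have h3 : (univ.filter fun x => x ∉ Z).card + Z.card = Fintype.card ι := by
    have := Finset.card_filter_add_card_filter_not (s := (univ : Finset ι)) (p := fun x => x ∈ Z)
    simp only [Finset.filter_univ_mem] at this
    rw [card_univ] at this
    omega
  rw [← h3, pow_add]
  push_cast
  ring

/-- Exchanging the coordinate `i` with an independent sample is an involution. This is the tool for
resampling one guess, or all the guesses for one output. -/
theorem sum_update_swap {ι β M : Type} [Fintype ι] [DecidableEq ι] [Fintype β] [AddCommMonoid M]
    (i : ι) (F : (ι → β) → β → M) :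
    ∑ c : ι → β, ∑ a, F (Function.update c i a) (c i) = ∑ c : ι → β, ∑ a, F c a := by
  rw [← Fintype.sum_prod_type', ← Fintype.sum_prod_type']
  refine Fintype.sum_equiv (Function.Involutive.toPerm
    (fun p : (ι → β) × β => (Function.update p.1 i p.2, p.1 i)) ?_) _ _ ?_
  · rintro ⟨c, a⟩
    simp
  · rintro ⟨c, a⟩
    rfl

theorem card_powerset_filter_le {β : Type} (Q : Finset β) (r : ℕ) :
    (Q.powerset.filter fun T => T.card ≤ r).card ≤ (Q.card + 1) ^ r := by
  have h1 : Q.powerset.filter (fun T => T.card ≤ r)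
      ⊆ (Finset.range (r + 1)).biUnion fun i => Q.powersetCard i := by
    intro T hT
    simp only [mem_filter, mem_powerset, mem_biUnion, mem_range, mem_powersetCard] at hT ⊢
    exact ⟨T.card, by omega, hT.1, rfl⟩
  refine (Finset.card_le_card h1).trans (Finset.card_biUnion_le.trans ?_)
  rw [add_pow]
  apply Finset.sum_le_sum
  intro i hi
  rw [card_powersetCard]
  have : 1 ≤ r.choose i := Nat.choose_pos (by simp at hi; omega)
  calc Q.card.choose i ≤ Q.card ^ i := Nat.choose_le_pow _ _
    _ ≤ Q.card ^ i * 1 ^ (r - i) * r.choose i := by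
      rw [one_pow, mul_one]; exact Nat.le_mul_of_pos_right _ this

end Counting

/-! ### Query algorithms -/

/-- `f` extends the finite relation `P`. -/
def Extends {X : Type} (P : Finset (X × X)) (f : X → X) : Prop := ∀ p ∈ P, f p.1 = p.2

/-- The second components of a finite relation. -/
def labels {X : Type} (P : Finset (X × X)) : Finset X := P.image Prod.snd

/-- A family, indexed by `V`, of algorithms that query a function `X → X`: with oracle `f` the
algorithm `v` looks at `f` on the set `Q v f` only. -/
structure LocalAlg (V X W : Type) where
  Q : V → (X → X) → Finset X
  out : V → (X → X) → Option W
  congr : ∀ v f f', (∀ x ∈ Q v f, f' x = f x) → Q v f' = Q v f ∧ out v f' = out v f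

variable {V X W : Type}

theorem Extends.injOn_fst {P : Finset (X × X)} {f : X → X} (h : Extends P f) :
    Set.InjOn Prod.fst (P : Set (X × X)) := by
  intro p hp q hq hpq
  refine Prod.ext hpq ?_
  rw [← h p hp, ← h q hq, hpq]

theorem Extends.injOn_snd {P : Finset (X × X)} {f : X → X} (h : Extends P f)
    (hf : Function.Injective f) : Set.InjOn Prod.snd (P : Set (X × X)) := by
  intro p hp q hq hpq
  refine Prod.ext (hf ?_) hpq
  rw [h p hp, h q hq, hpq]

namespace LocalAlg

variable (G : LocalAlg V X W)

/-- The query-answer pairs of `v` with oracle `f`. -/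
def path (v : V) (f : X → X) : Finset (X × X) := (G.Q v f).image fun x => (x, f x)

theorem extends_path (v : V) (f : X → X) : Extends (G.path v f) f := by
  intro p hp
  simp only [path, mem_image] at hp
  obtain ⟨x, _, rfl⟩ := hp
  rfl

theorem card_path (v : V) (f : X → X) : (G.path v f).card = (G.Q v f).card :=
  card_image_of_injective _ fun _ _ h => congrArg Prod.fst h

theorem path_congr {v : V} {f f' : X → X} (h : Extends (G.path v f) f') :
    G.path v f' = G.path v f ∧ G.out v f' = G.out v f := by
  have h1 : ∀ x ∈ G.Q v f, f' x = f x := fun x hx =>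
    h (x, f x) (mem_image_of_mem _ hx)
  obtain ⟨h2, h3⟩ := G.congr v f f' h1
  refine ⟨?_, h3⟩
  unfold path
  rw [h2]
  exact Finset.image_congr fun x hx => by simp [h1 x hx]

variable [Fintype V] [Fintype X]

/-- The paths of the algorithms with output `w`, for permutations as oracles. -/
def paths (w : W) : Finset (V × Finset (X × X)) :=
  univ.filter fun vp => ∃ ϖ : Equiv.Perm X, G.path vp.1 ϖ = vp.2 ∧ G.out vp.1 ϖ = some w

theorem mem_paths {w : W} {vp : V × Finset (X × X)} :
    vp ∈ G.paths w ↔ ∃ ϖ : Equiv.Perm X, G.path vp.1 ϖ = vp.2 ∧ G.out vp.1 ϖ = some w := by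
  simp [paths]

/-- The function `f` need not be a permutation. Thus paths, although defined through permutations,
also describe runs with a regular function, and a seed and an oracle together determine at most one
path and one output. -/
theorem mem_paths_extends {w : W} {vp : V × Finset (X × X)} (h : vp ∈ G.paths w) {f : X → X}
    (hf : Extends vp.2 f) : G.path vp.1 f = vp.2 ∧ G.out vp.1 f = some w := by
  obtain ⟨ϖ, h1, h2⟩ := G.mem_paths.mp h
  rw [← h1] at hf ⊢
  obtain ⟨h3, h4⟩ := G.path_congr hf
  exact ⟨h3, h4.trans h2⟩

theorem paths_injOn_snd {w : W} {vp : V × Finset (X × X)} (h : vp ∈ G.paths w) :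
    Set.InjOn Prod.snd (vp.2 : Set (X × X)) := by
  obtain ⟨ϖ, h1, _⟩ := G.mem_paths.mp h
  exact (h1 ▸ G.extends_path vp.1 ϖ : Extends vp.2 ϖ).injOn_snd ϖ.injective

end LocalAlg

/-- The probability that a uniformly random function extends `P`. -/
def weight [Fintype X] (P : Finset (X × X)) : ℝ := ((Fintype.card X : ℝ)⁻¹) ^ P.card

theorem weight_nonneg [Fintype X] (P : Finset (X × X)) : 0 ≤ weight P := by
  unfold weight; positivity

theorem card_perm_extends [Fintype X] {P : Finset (X × X)} {ϖ : Equiv.Perm X}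
    (h : Extends P ϖ) :
    (univ.filter fun σ : Equiv.Perm X => Extends P σ).card
      = (Fintype.card X - P.card).factorial := by
  have h1 : (P.image Prod.fst).card = P.card := card_image_of_injOn h.injOn_fst
  rw [← h1, ← card_perm_agree (P.image Prod.fst) ϖ ϖ.injective.injOn]
  congr 1
  ext σ
  simp only [mem_filter, mem_univ, true_and]
  constructor
  · intro hσ u hu
    obtain ⟨p, hp, rfl⟩ := mem_image.mp hu
    rw [hσ p hp, h p hp]
  · intro hσ p hp
    rw [hσ p.1 (mem_image_of_mem _ hp), h p hp]

/-- Follows from N! / (N - l)! ≤ N^l: a permutation is at least as likely to extend `P` as a random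
function. -/
theorem weight_le_card_perm [Fintype X] {P : Finset (X × X)} {ϖ : Equiv.Perm X}
    (h : Extends P ϖ) :
    weight P * (Fintype.card X).factorial
      ≤ ((univ.filter fun σ : Equiv.Perm X => Extends P σ).card : ℝ) := by
  rw [card_perm_extends h, weight, inv_pow]
  have h1 : (P.image Prod.fst).card = P.card := card_image_of_injOn h.injOn_fst
  have h2 : P.card ≤ Fintype.card X := h1 ▸ card_le_univ _
  rcases Nat.eq_zero_or_pos (Fintype.card X) with h0 | hpos
  · have : P.card = 0 := by omega
    simp [this]
  · rw [inv_mul_le_iff₀ (by positivity)]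
    have h4 : (Fintype.card X).factorial
        ≤ Fintype.card X ^ P.card * (Fintype.card X - P.card).factorial := by
      rw [← Nat.factorial_mul_descFactorial h2, mul_comm]
      exact Nat.mul_le_mul_right _ (Nat.descFactorial_le_pow _ _)
    exact_mod_cast h4

/-! ### Kraft's inequality; light, heavy and critical paths -/

namespace LocalAlg

variable (G : LocalAlg V X W) [Fintype V] [Fintype X]

/-- For a fixed seed, the events that a permutation extends its different paths are disjoint, since
seed and permutation determine the path and the output. -/
theorem sum_paths_card_perm_le [Fintype W] (p : W → V × Finset (X × X) → Prop) :
    ∑ w, ∑ vp ∈ (G.paths w).filter (p w),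
      (univ.filter fun σ : Equiv.Perm X => Extends vp.2 σ).card
    ≤ (univ.filter fun q : V × Equiv.Perm X =>
        ∃ w, G.out q.1 q.2 = some w ∧ p w (q.1, G.path q.1 q.2)).card := by
  have h1 : ∀ w, ∑ vp ∈ (G.paths w).filter (p w),
      (univ.filter fun σ : Equiv.Perm X => Extends vp.2 σ).card
      = (((G.paths w).filter (p w)).sigma
          fun vp => univ.filter fun σ : Equiv.Perm X => Extends vp.2 σ).card := by
    intro w; rw [card_sigma]
  simp only [h1]
  rw [← card_sigma]
  refine card_le_card_of_injOn (fun q => (q.2.1.1, q.2.2)) ?_ ?_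
  · rintro ⟨w, vp, σ⟩ hq
    simp only [coe_sigma, coe_univ, Set.mem_sigma_iff, Set.mem_univ, true_and,
      coe_filter, Set.mem_ofPred_eq, mem_univ] at hq ⊢
    obtain ⟨⟨h1, h2⟩, h3⟩ := hq
    obtain ⟨h4, h5⟩ := G.mem_paths_extends h1 h3
    exact ⟨w, h5, by rw [h4]; exact h2⟩
  · rintro ⟨w, vp, σ⟩ hq ⟨w', vp', σ'⟩ hq' heq
    simp only [coe_sigma, coe_univ, Set.mem_sigma_iff, Set.mem_univ, true_and,
      coe_filter, Set.mem_ofPred_eq, mem_univ] at hq hq'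
    obtain ⟨⟨h1, h2⟩, h3⟩ := hq
    obtain ⟨⟨h1', h2'⟩, h3'⟩ := hq'
    simp only [Prod.mk.injEq] at heq
    obtain ⟨hv, rfl⟩ := heq
    obtain ⟨h4, h5⟩ := G.mem_paths_extends h1 h3
    obtain ⟨h4', h5'⟩ := G.mem_paths_extends h1' h3'
    rw [hv] at h4 h5
    have hw : w = w' := Option.some_injective _ (h5.symm.trans h5')
    subst hw
    have hvp : vp = vp' := Prod.ext hv (h4.symm.trans h4')
    subst hvp
    rfl

/-- Kraft's inequality for the paths of query algorithms. -/
theorem sum_paths_weight_le [Fintype W] : ∑ w, ∑ vp ∈ G.paths w, weight vp.2 ≤ Fintype.card V := by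
  have hpos : (0 : ℝ) < (Fintype.card X).factorial := by positivity
  have h1 : ∀ w, ∀ vp ∈ G.paths w, weight vp.2 * (Fintype.card X).factorial
      ≤ ((univ.filter fun σ : Equiv.Perm X => Extends vp.2 σ).card : ℝ) := by
    intro w vp hvp
    obtain ⟨ϖ, h1, _⟩ := G.mem_paths.mp hvp
    exact weight_le_card_perm (h1 ▸ G.extends_path vp.1 ϖ : Extends vp.2 ϖ)
  have h2 := G.sum_paths_card_perm_le (fun _ _ => True)
  simp only [Finset.filter_true] at h2
  have h3 := h2.trans (card_le_univ _)
  rw [Fintype.card_prod, Fintype.card_perm] at h3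
  rw [← mul_le_mul_iff_left₀ hpos]
  calc (∑ w, ∑ vp ∈ G.paths w, weight vp.2) * ((Fintype.card X).factorial : ℝ)
      = ∑ w, ∑ vp ∈ G.paths w, weight vp.2 * (Fintype.card X).factorial := by
        simp only [Finset.sum_mul]
    _ ≤ ∑ w, ∑ vp ∈ G.paths w,
        ((univ.filter fun σ : Equiv.Perm X => Extends vp.2 σ).card : ℝ) :=
        Finset.sum_le_sum fun w _ => Finset.sum_le_sum (h1 w)
    _ ≤ _ := by exact_mod_cast h3

/-- The total weight of the paths for `w` that contain the pairs `T` and, outside of `T`, the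
labels `S`. -/
def mass (w : W) (T : Finset (X × X)) (S : Finset X) : ℝ :=
  ∑ vp ∈ (G.paths w).filter (fun vp => T ⊆ vp.2 ∧ S ⊆ labels (vp.2 \ T)), weight vp.2

theorem mass_nonneg (w : W) (T : Finset (X × X)) (S : Finset X) : 0 ≤ G.mass w T S :=
  Finset.sum_nonneg fun _ _ => weight_nonneg _

/-- The expected number of algorithms with output `w` whose path contains the pairs `T` and the
labels `S`, for a function that contains `T` and has `S` in its image of density `2 ^ (-d)`. -/
def nu (d : ℕ) (w : W) (T : Finset (X × X)) (S : Finset X) : ℝ :=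
  2 ^ (d * S.card) * (Fintype.card X : ℝ) ^ T.card * G.mass w T S

/-- For all partial information about `P`, few algorithms with output `w` are expected. -/
def Light (Δ d : ℕ) (w : W) (P : Finset (X × X)) : Prop :=
  ∀ T ⊆ P, ∀ S ⊆ labels (P \ T), S.Nonempty → G.nu d w T S ≤ (2 ^ Δ)⁻¹

/-- For some partial information about `P`, many algorithms with output `w` are expected. -/
def Heavy (Δ d : ℕ) (w : W) (P : Finset (X × X)) : Prop :=
  ∃ T ⊆ P, ∃ S ⊆ labels (P \ T), S.Nonempty ∧ 2 ^ Δ ≤ G.nu d w T S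

/-- Let d₀ be the least d in the range at which the path is not light, with witness T, S. Since S is
nonempty, `nu` grows by 2^(2Δ) or more from d₀ to d₀ + 2Δ, from 2^(-Δ) to 2^Δ. Hence the path is
heavy from there on, with the same witness. -/
theorem card_critical_le (Δ D : ℕ) (w : W) (P : Finset (X × X)) :
    ((Icc 1 D).filter fun d => ¬ G.Light Δ d w P ∧ ¬ G.Heavy Δ d w P).card ≤ 2 * Δ := by
  set s := (Icc 1 D).filter fun d => ¬ G.Light Δ d w P ∧ ¬ G.Heavy Δ d w P with hs
  rcases s.eq_empty_or_nonempty with h0 | hne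
  · simp [h0]
  set d₀ := s.min' hne with hd₀
  have hmem : d₀ ∈ s := s.min'_mem hne
  have hnl := (mem_filter.mp (hs ▸ hmem)).2.1
  unfold Light at hnl
  push Not at hnl
  obtain ⟨T, hT, S, hS, hSn, hnu⟩ := hnl
  have hsub : s ⊆ Ico d₀ (d₀ + 2 * Δ) := by
    intro d hd
    have h1 : d₀ ≤ d := s.min'_le d hd
    rw [mem_Ico]
    refine ⟨h1, ?_⟩
    by_contra hlt
    push Not at hlt
    refine (mem_filter.mp (hs ▸ hd)).2.2 ⟨T, hT, S, hS, hSn, ?_⟩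
    have hcard : 1 ≤ S.card := hSn.card_pos
    have h2 : d₀ * S.card + 2 * Δ ≤ d * S.card := by nlinarith
    have h3 : (2 : ℝ) ^ (2 * Δ) * G.nu d₀ w T S ≤ G.nu d w T S := by
      have h4 : (2 : ℝ) ^ (2 * Δ) * 2 ^ (d₀ * S.card) ≤ 2 ^ (d * S.card) := by
        rw [← pow_add]
        exact pow_le_pow_right₀ (by norm_num) (by omega)
      have h5 : 0 ≤ (Fintype.card X : ℝ) ^ T.card * G.mass w T S :=
        mul_nonneg (by positivity) (G.mass_nonneg w T S)
      unfold nu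
      calc (2 : ℝ) ^ (2 * Δ) * (2 ^ (d₀ * S.card) * (Fintype.card X : ℝ) ^ T.card * G.mass w T S)
          = ((2 : ℝ) ^ (2 * Δ) * 2 ^ (d₀ * S.card))
              * ((Fintype.card X : ℝ) ^ T.card * G.mass w T S) := by ring
        _ ≤ 2 ^ (d * S.card) * ((Fintype.card X : ℝ) ^ T.card * G.mass w T S) := by gcongr
        _ = _ := by ring
    refine le_trans ?_ h3
    calc (2 : ℝ) ^ Δ = 2 ^ (2 * Δ) * (2 ^ Δ)⁻¹ := by
          rw [two_mul, pow_add]; field_simp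
      _ ≤ _ := by gcongr
  calc s.card ≤ (Ico d₀ (d₀ + 2 * Δ)).card := card_le_card hsub
    _ = 2 * Δ := by simp

/-- The path of `v` is neither light nor heavy. -/
def Critical (Δ d : ℕ) (v : V) (f : X → X) : Prop :=
  ∃ w, G.out v f = some w ∧ ¬ G.Light Δ d w (G.path v f) ∧ ¬ G.Heavy Δ d w (G.path v f)

/-- Double counting of the triples of a value of d, a seed and a permutation: each pair of seed and
permutation is critical for at most 2Δ of the `D` values. -/
theorem exists_few_critical (Δ D : ℕ) (hD : 1 ≤ D) :
    ∃ d ∈ Icc 1 D, D * (univ.filter fun q : V × Equiv.Perm X => G.Critical Δ d q.1 q.2).card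
      ≤ 2 * Δ * (Fintype.card V * (Fintype.card X).factorial) := by
  have hsum : ∑ d ∈ Icc 1 D, D * (univ.filter fun q : V × Equiv.Perm X =>
      G.Critical Δ d q.1 q.2).card
      ≤ ∑ d ∈ Icc 1 D, 2 * Δ * (Fintype.card V * (Fintype.card X).factorial) := by
    rw [← Finset.mul_sum, Finset.sum_const, Nat.card_Icc]
    simp only [Nat.add_sub_cancel, smul_eq_mul]
    refine Nat.mul_le_mul_left _ ?_
    simp only [card_filter]
    rw [Finset.sum_comm]
    have : ∀ q ∈ (univ : Finset (V × Equiv.Perm X)),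
        ∑ d ∈ Icc 1 D, (if G.Critical Δ d q.1 q.2 then 1 else 0) ≤ 2 * Δ := by
      intro q _
      rw [← card_filter]
      rcases h : G.out q.1 q.2 with _ | w
      · simp [Critical, h]
      · refine le_trans (card_le_card ?_) (G.card_critical_le Δ D w (G.path q.1 q.2))
        intro d hd
        simp only [mem_filter, Critical, h, Option.some.injEq] at hd ⊢
        obtain ⟨hd1, w', rfl, hd2⟩ := hd
        exact ⟨hd1, hd2⟩
    refine (Finset.sum_le_card_nsmul _ _ _ this).trans ?_
    rw [card_univ, Fintype.card_prod, Fintype.card_perm, smul_eq_mul, mul_comm]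
  obtain ⟨d, hd, h⟩ := Finset.exists_le_of_sum_le (nonempty_Icc.mpr hD) hsum
  exact ⟨d, hd, h⟩

end LocalAlg

theorem card_perm_inv_mem_le {α : Type} [Fintype α] (U : Finset α) (C : α → Finset α)
    (hU : 2 * U.card ^ 2 ≤ Fintype.card α) :
    ((univ.filter fun σ : Equiv.Perm α => ∀ u ∈ U, σ⁻¹ u ∈ C u).card : ℝ)
      ≤ 2 * (Fintype.card α).factorial * ∏ u ∈ U, ((C u).card : ℝ) / Fintype.card α := by
  refine le_trans (le_of_eq ?_) (card_perm_mem_le U C hU)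
  have := card_filter_perm_inv (fun σ : Equiv.Perm α => ∀ u ∈ U, σ u ∈ C u)
  refine congrArg Nat.cast (Eq.trans ?_ (this.trans ?_)) <;> congr

/-! ### Random regular functions -/

/-- A partition of `X` into `M` blocks of size `K`, and names for the blocks and for one more,
empty, block. -/
structure Frame (X : Type) [Fintype X] (M K : ℕ) where
  τ : X → Fin M
  e : Option (Fin M) → X
  e_inj : Function.Injective e
  card_fiber : ∀ b, (univ.filter fun x => τ x = b).card = K
  mul_eq : M * K = Fintype.card X
  M_pos : 0 < M
  K_pos : 0 < K

namespace Frame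

variable {X : Type} [Fintype X] {M K : ℕ} (F : Frame X M K)

/-- The block of a point, for the partition moved by `π`. -/
def block (π : Equiv.Perm X) (x : X) : Fin M := F.τ (π x)

/-- The regular function that maps a block to its name under `σ`. -/
def fn (π σ : Equiv.Perm X) (x : X) : X := σ (F.e (some (F.block π x)))

/-- The name of the empty block. -/
def spare (σ : Equiv.Perm X) : X := σ (F.e none)

theorem card_pos (F : Frame X M K) : 0 < Fintype.card X := by
  rw [← F.mul_eq]; exact Nat.mul_pos F.M_pos F.K_pos

theorem card_eq (F : Frame X M K) : (Fintype.card X : ℝ) = M * K := by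
  rw [← F.mul_eq]; push_cast; rfl

theorem M_pos' (F : Frame X M K) : (0 : ℝ) < M := by exact_mod_cast F.M_pos

theorem K_pos' (F : Frame X M K) : (0 : ℝ) < K := by exact_mod_cast F.K_pos

theorem card_block (π : Equiv.Perm X) (b : Fin M) :
    (univ.filter fun x => F.block π x = b).card = K := by
  refine Eq.trans ?_ (F.card_fiber b)
  refine card_bij' (fun x _ => π x) (fun x _ => π⁻¹ x) (fun x hx => ?_) (fun x hx => ?_)
    (by simp) (by simp)
  · rw [mem_filter] at hx ⊢
    exact ⟨mem_univ _, hx.2⟩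
  · rw [mem_filter] at hx ⊢
    exact ⟨mem_univ _, by simpa [block] using hx.2⟩

theorem fn_eq_iff (π σ : Equiv.Perm X) (x x' : X) :
    F.fn π σ x = F.fn π σ x' ↔ F.block π x = F.block π x' := by
  unfold fn
  rw [σ.injective.eq_iff, F.e_inj.eq_iff, Option.some_inj]

theorem sum_block {R : Type} [AddCommMonoid R] (π : Equiv.Perm X) (g : Fin M → R) :
    ∑ x, g (F.block π x) = K • ∑ b, g b := by
  rw [← Finset.sum_fiberwise (s := univ) (g := F.block π), Finset.smul_sum]
  refine Finset.sum_congr rfl fun b _ => ?_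
  have h : ∑ x with F.block π x = b, g (F.block π x) = ∑ x with F.block π x = b, g b :=
    Finset.sum_congr rfl fun x hx => by rw [(mem_filter.mp hx).2]
  rw [h, Finset.sum_const, F.card_block]

/-- The probability, up to constants, that the random function extends `Q`. -/
def wt (_ : Frame X M K) (Q : Finset (X × X)) : ℝ :=
  ((K : ℝ)⁻¹) ^ (labels Q).card * ((M : ℝ)⁻¹) ^ Q.card

theorem wt_nonneg (Q : Finset (X × X)) : 0 ≤ F.wt Q := by unfold wt; positivity

/-- The name `y` is the spare one with probability 1/N. Each label of `Q` is the name of a block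
with probability M/N = 1/K, and, once the names are fixed, each point lies in the block that it must
with probability K/N = 1/M. Independence holds up to a factor 2 for `σ` and a factor 2 for `π`. -/
theorem card_extends_le (Q : Finset (X × X)) (y : X) (hy : y ∉ labels Q)
    (hQ : 2 * (Q.card + 1) ^ 2 ≤ Fintype.card X) :
    ((univ.filter fun q : Equiv.Perm X × Equiv.Perm X =>
        F.spare q.2 = y ∧ Extends Q (F.fn q.1 q.2)).card : ℝ)
      ≤ 4 * ((Fintype.card X).factorial : ℝ) ^ 2 * (Fintype.card X : ℝ)⁻¹ * F.wt Q := by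
  have hM := F.M_pos'
  have hK := F.K_pos'
  have hN := F.card_eq
  by_cases hf : Set.InjOn Prod.fst (Q : Set (X × X))
  swap
  · have : (univ.filter fun q : Equiv.Perm X × Equiv.Perm X =>
        F.spare q.2 = y ∧ Extends Q (F.fn q.1 q.2)) = ∅ := by
      rw [Finset.filter_eq_empty_iff]
      rintro q - ⟨-, h⟩
      exact hf h.injOn_fst
    rw [this]
    simp only [card_empty, Nat.cast_zero]
    have := F.wt_nonneg Q
    positivity
  set U := Q.image Prod.fst with hU
  have hUc : U.card = Q.card := card_image_of_injOn hf
  set L := labels Q with hL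
  have hLc : L.card ≤ Q.card := card_image_le
  set A : Finset (Equiv.Perm X) := univ.filter fun σ => ∀ u ∈ insert y L,
    σ⁻¹ u ∈ (if u = y then {F.e none} else univ.image fun b => F.e (some b)) with hA
  have hAc : (A.card : ℝ) ≤ 2 * (Fintype.card X).factorial
      * ((Fintype.card X : ℝ)⁻¹ * ((K : ℝ)⁻¹) ^ L.card) := by
    rw [hA]
    refine (card_perm_inv_mem_le (insert y L) _ ?_).trans ?_
    · rw [card_insert_of_notMem hy]
      nlinarith
    · rw [prod_insert hy]
      have h2 : ∀ u ∈ L, (((if u = y then {F.e none} else univ.image fun b => F.e (some b) :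
          Finset X).card : ℝ) / Fintype.card X) = (K : ℝ)⁻¹ := by
        intro u hu
        have : u ≠ y := fun h => hy (h ▸ hu)
        rw [if_neg this, card_image_of_injective _ (fun a b h => by
          simpa using F.e_inj h), card_univ, Fintype.card_fin, hN]
        field_simp
      rw [Finset.prod_congr rfl h2, prod_const]
      simp
  have hsub : (univ.filter fun q : Equiv.Perm X × Equiv.Perm X =>
        F.spare q.2 = y ∧ Extends Q (F.fn q.1 q.2))
      ⊆ A.biUnion fun σ => (univ.filter fun π : Equiv.Perm X => ∀ x ∈ U,
          π x ∈ univ.filter fun z => ∃ p ∈ Q, p.1 = x ∧ σ (F.e (some (F.τ z))) = p.2).image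
            fun π => (π, σ) := by
    rintro ⟨π, σ⟩ hq
    simp only [mem_filter, mem_univ, true_and] at hq
    obtain ⟨h1, h2⟩ := hq
    rw [mem_biUnion]
    refine ⟨σ, ?_, ?_⟩
    · rw [hA, mem_filter]
      refine ⟨mem_univ _, fun u hu => ?_⟩
      rcases mem_insert.mp hu with rfl | hu
      · rw [if_pos rfl, mem_singleton, ← h1]
        simp [spare]
      · have : u ≠ y := fun h => hy (h ▸ hu)
        rw [if_neg this]
        obtain ⟨p, hp, rfl⟩ := mem_image.mp hu
        rw [← h2 p hp, mem_image]
        exact ⟨F.block π p.1, mem_univ _, by simp [fn]⟩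
    · rw [mem_image]
      refine ⟨π, ?_, rfl⟩
      simp only [mem_filter, mem_univ, true_and]
      intro x hx
      obtain ⟨p, hp, rfl⟩ := mem_image.mp hx
      exact ⟨p, hp, rfl, h2 p hp⟩
  have hπ : ∀ σ ∈ A, (((univ.filter fun π : Equiv.Perm X => ∀ x ∈ U,
          π x ∈ univ.filter fun z => ∃ p ∈ Q, p.1 = x ∧ σ (F.e (some (F.τ z))) = p.2).image
            fun π => (π, σ)).card : ℝ)
      ≤ 2 * (Fintype.card X).factorial * ((M : ℝ)⁻¹) ^ Q.card := by
    intro σ _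
    refine le_trans (Nat.cast_le.mpr card_image_le) ?_
    refine (card_perm_mem_le U _ ?_).trans ?_
    · rw [hUc]; nlinarith
    · rw [← hUc, ← prod_const]
      gcongr with x hx
      obtain ⟨p, hp, rfl⟩ := mem_image.mp hx
      have : (univ.filter fun z => ∃ p' ∈ Q, p'.1 = p.1 ∧ σ (F.e (some (F.τ z))) = p'.2).card
          ≤ K := by
        by_cases hne : (univ.filter fun z => ∃ p' ∈ Q, p'.1 = p.1 ∧
            σ (F.e (some (F.τ z))) = p'.2).Nonempty
        · obtain ⟨z, hz⟩ := hne
          refine le_trans (card_le_card ?_) (F.card_fiber (F.τ z)).le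
          intro z' hz'
          simp only [mem_filter, mem_univ, true_and] at hz hz' ⊢
          obtain ⟨p1, hp1, h1, h1'⟩ := hz
          obtain ⟨p2, hp2, h2, h2'⟩ := hz'
          have h12 : p1 = p2 := hf hp1 hp2 (h1.trans h2.symm)
          subst h12
          have := σ.injective (h1'.trans h2'.symm)
          simpa using (F.e_inj this).symm
        · rw [Finset.not_nonempty_iff_eq_empty] at hne
          rw [hne, card_empty]
          exact Nat.zero_le _
      calc ((univ.filter fun z => ∃ p' ∈ Q, p'.1 = p.1 ∧
            σ (F.e (some (F.τ z))) = p'.2).card : ℝ) / Fintype.card X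
          ≤ K / Fintype.card X := by gcongr
        _ = (M : ℝ)⁻¹ := by rw [hN]; field_simp
  calc ((univ.filter fun q : Equiv.Perm X × Equiv.Perm X =>
        F.spare q.2 = y ∧ Extends Q (F.fn q.1 q.2)).card : ℝ)
      ≤ ∑ σ ∈ A, (((univ.filter fun π : Equiv.Perm X => ∀ x ∈ U,
          π x ∈ univ.filter fun z => ∃ p ∈ Q, p.1 = x ∧ σ (F.e (some (F.τ z))) = p.2).image
            fun π => (π, σ)).card : ℝ) := by
        exact_mod_cast (card_le_card hsub).trans card_biUnion_le
    _ ≤ A.card * (2 * (Fintype.card X).factorial * ((M : ℝ)⁻¹) ^ Q.card) := by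
        rw [← nsmul_eq_mul]
        exact Finset.sum_le_card_nsmul _ _ _ hπ
    _ ≤ (2 * (Fintype.card X).factorial
      * ((Fintype.card X : ℝ)⁻¹ * ((K : ℝ)⁻¹) ^ L.card))
          * (2 * (Fintype.card X).factorial * ((M : ℝ)⁻¹) ^ Q.card) := by
        gcongr
    _ = _ := by unfold wt; ring

theorem card_block_eq_le (x x' : X) (hx : x ≠ x') (hN8 : 8 ≤ Fintype.card X) :
    ((univ.filter fun π : Equiv.Perm X => F.block π x = F.block π x').card : ℝ)
      ≤ 2 * (Fintype.card X).factorial * (M : ℝ)⁻¹ := by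
  have hM := F.M_pos'
  have hK := F.K_pos'
  have hsub : (univ.filter fun π : Equiv.Perm X => F.block π x = F.block π x')
      ⊆ (univ : Finset (Fin M)).biUnion fun b => univ.filter fun π : Equiv.Perm X =>
          ∀ z ∈ ({x, x'} : Finset X), π z ∈ univ.filter fun z => F.τ z = b := by
    intro π hπ
    simp only [mem_filter, mem_univ, true_and, mem_biUnion, mem_insert, mem_singleton,
      forall_eq_or_imp, forall_eq] at hπ ⊢
    exact ⟨_, hπ, rfl⟩
  have hb : ∀ b ∈ (univ : Finset (Fin M)), ((univ.filter fun π : Equiv.Perm X =>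
          ∀ z ∈ ({x, x'} : Finset X), π z ∈ univ.filter fun z => F.τ z = b).card : ℝ)
      ≤ 2 * (Fintype.card X).factorial * ((M : ℝ)⁻¹ * (M : ℝ)⁻¹) := by
    intro b _
    refine (card_perm_mem_le _ _ ?_).trans ?_
    · rw [card_pair hx]; omega
    · rw [prod_pair hx, F.card_fiber, F.card_eq]
      apply le_of_eq
      field_simp
  calc ((univ.filter fun π : Equiv.Perm X => F.block π x = F.block π x').card : ℝ)
      ≤ ∑ b : Fin M, ((univ.filter fun π : Equiv.Perm X =>
          ∀ z ∈ ({x, x'} : Finset X), π z ∈ univ.filter fun z => F.τ z = b).card : ℝ) := by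
        exact_mod_cast (card_le_card hsub).trans card_biUnion_le
    _ ≤ (univ : Finset (Fin M)).card *
          (2 * (Fintype.card X).factorial * ((M : ℝ)⁻¹ * (M : ℝ)⁻¹)) := by
        rw [← nsmul_eq_mul]
        exact Finset.sum_le_card_nsmul _ _ _ hb
    _ = _ := by
        rw [card_univ, Fintype.card_fin]
        field_simp

/-- A birthday bound over the ordered pairs of points of `U`. -/
theorem card_block_injOn_ge (U : Finset X) (hN8 : 8 ≤ Fintype.card X) :
    (1 - 2 * (U.card : ℝ) ^ 2 / M) * (Fintype.card X).factorial
      ≤ ((univ.filter fun π : Equiv.Perm X => Set.InjOn (F.block π) U).card : ℝ) := by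
  have hM := F.M_pos'
  have hsub : (univ.filter fun π : Equiv.Perm X => ¬ Set.InjOn (F.block π) U)
      ⊆ U.offDiag.biUnion fun q => univ.filter fun π : Equiv.Perm X =>
        F.block π q.1 = F.block π q.2 := by
    intro π hπ
    have hπ' := (mem_filter.mp hπ).2
    unfold Set.InjOn at hπ'
    push Not at hπ'
    obtain ⟨x, hx, x', hx', h1, h2⟩ := hπ'
    rw [mem_biUnion]
    exact ⟨(x, x'), mem_offDiag.mpr ⟨hx, hx', h2⟩, mem_filter.mpr ⟨mem_univ _, h1⟩⟩
  have h1 : ((univ.filter fun π : Equiv.Perm X => ¬ Set.InjOn (F.block π) U).card : ℝ)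
      ≤ U.card ^ 2 * (2 * (Fintype.card X).factorial * (M : ℝ)⁻¹) := by
    calc ((univ.filter fun π : Equiv.Perm X => ¬ Set.InjOn (F.block π) U).card : ℝ)
        ≤ ∑ q ∈ U.offDiag, ((univ.filter fun π : Equiv.Perm X =>
            F.block π q.1 = F.block π q.2).card : ℝ) := by
          exact_mod_cast (card_le_card hsub).trans card_biUnion_le
      _ ≤ U.offDiag.card * (2 * (Fintype.card X).factorial * (M : ℝ)⁻¹) := by
          rw [← nsmul_eq_mul]
          exact Finset.sum_le_card_nsmul _ _ _ fun q hq =>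
            F.card_block_eq_le q.1 q.2 (mem_offDiag.mp hq).2.2 hN8
      _ ≤ _ := by
          have : U.offDiag.card ≤ U.card ^ 2 := by
            rw [offDiag_card, sq]; omega
          gcongr
          exact_mod_cast this
  have h2 := Finset.card_filter_add_card_filter_not (s := (univ : Finset (Equiv.Perm X)))
    (p := fun π => Set.InjOn (F.block π) U)
  rw [card_univ, Fintype.card_perm] at h2
  have h3 : ((univ.filter fun π : Equiv.Perm X => Set.InjOn (F.block π) U).card : ℝ)
      + ((univ.filter fun π : Equiv.Perm X => ¬ Set.InjOn (F.block π) U).card : ℝ)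
      = (Fintype.card X).factorial := by exact_mod_cast h2
  have h4 : (1 - 2 * (U.card : ℝ) ^ 2 / M) * (Fintype.card X).factorial
      = (Fintype.card X).factorial
        - U.card ^ 2 * (2 * (Fintype.card X).factorial * (M : ℝ)⁻¹) := by
    field_simp
  rw [h4]
  linarith

/-- When `π` puts the queried points into distinct blocks, some permutation ρ sends each queried
point to the index of its block's name, and σ ↦ σρ⁻¹ turns agreement of σ with `P` into agreement of
the regular function with `P`. So only collisions of blocks distinguish the regular function from a
permutation. -/
theorem card_extends_ge {P : Finset (X × X)} {ϖ : Equiv.Perm X} (h : Extends P ϖ)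
    (hN8 : 8 ≤ Fintype.card X) :
    (1 - 2 * (P.card : ℝ) ^ 2 / M) * (Fintype.card X).factorial
        * ((univ.filter fun σ : Equiv.Perm X => Extends P σ).card : ℝ)
      ≤ ((univ.filter fun q : Equiv.Perm X × Equiv.Perm X =>
          Extends P (F.fn q.1 q.2)).card : ℝ) := by
  set U := P.image Prod.fst with hU
  have hUc : U.card = P.card := card_image_of_injOn h.injOn_fst
  set A := univ.filter fun π : Equiv.Perm X => Set.InjOn (F.block π) U with hA
  have h1 : ∀ π ∈ A, (univ.filter fun σ : Equiv.Perm X => Extends P σ).card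
      ≤ (univ.filter fun σ : Equiv.Perm X => Extends P (F.fn π σ)).card := by
    intro π hπ
    have hinj := (mem_filter.mp hπ).2
    obtain ⟨ρ, hρ⟩ := exists_perm_extending U (fun x => F.e (some (F.block π x))) (by
      intro x hx x' hx' hxx
      exact hinj hx hx' (by simpa using F.e_inj hxx))
    refine card_le_card_of_injOn (fun σ => σ * ρ⁻¹) ?_ ?_
    · intro σ hσ
      simp only [coe_filter, mem_univ, true_and, Set.mem_ofPred_eq] at hσ ⊢
      intro p hp
      have := hρ p.1 (mem_image_of_mem _ hp)
      rw [fn, ← this]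
      simpa using hσ p hp
    · intro σ _ σ' _ hs
      simpa using hs
  have h2 : A.card * (univ.filter fun σ : Equiv.Perm X => Extends P σ).card
      ≤ (univ.filter fun q : Equiv.Perm X × Equiv.Perm X => Extends P (F.fn q.1 q.2)).card := by
    calc A.card * (univ.filter fun σ : Equiv.Perm X => Extends P σ).card
        ≤ ∑ π ∈ A, (univ.filter fun σ : Equiv.Perm X => Extends P (F.fn π σ)).card := by
          rw [← smul_eq_mul]
          exact Finset.card_nsmul_le_sum _ _ _ h1
      _ = (A.sigma fun π => univ.filter fun σ : Equiv.Perm X => Extends P (F.fn π σ)).card := by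
          rw [card_sigma]
      _ ≤ _ := by
          refine card_le_card_of_injOn (fun q => (q.1, q.2)) ?_ ?_
          · rintro ⟨π, σ⟩ hq
            simp only [coe_sigma, Set.mem_sigma_iff, coe_filter, mem_univ, true_and,
              Set.mem_ofPred_eq] at hq ⊢
            exact hq.2
          · rintro ⟨π, σ⟩ _ ⟨π', σ'⟩ _ heq
            simp only [Prod.mk.injEq] at heq
            obtain ⟨rfl, rfl⟩ := heq
            rfl
  have h3 := F.card_block_injOn_ge U hN8
  rw [hUc] at h3
  calc _ ≤ (A.card : ℝ) * ((univ.filter fun σ : Equiv.Perm X => Extends P σ).card : ℝ) := by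
        gcongr
    _ ≤ _ := by exact_mod_cast h2

end Frame

/-! ### Acceptance of heavy outputs -/

theorem exists_fst_of_injOn_snd {X : Type} [Nonempty X] {P : Finset (X × X)}
    (h : Set.InjOn Prod.snd (P : Set (X × X))) : ∃ g : X → X, ∀ p ∈ P, g p.2 = p.1 := by
  refine ⟨fun u => if hu : ∃ p ∈ P, p.2 = u then hu.choose.1 else Classical.arbitrary X, ?_⟩
  intro p hp
  have hu : ∃ q ∈ P, q.2 = p.2 := ⟨p, hp, rfl⟩
  simp only [dif_pos hu]
  exact congrArg Prod.fst (h hu.choose_spec.1 hp hu.choose_spec.2)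

theorem card_labels_of_injOn {X : Type} {P : Finset (X × X)}
    (h : Set.InjOn Prod.snd (P : Set (X × X))) : (labels P).card = P.card :=
  card_image_of_injOn h

/-- Union bound over the choice, for each label, of the index of the correct guess. -/
theorem card_exists_index_le {X : Type} [Fintype X] {J M : ℕ} (hM : 0 < M) (U : Finset X)
    (g : X → Fin M) :
    ((univ.filter fun c : Fin J × X → Fin M => ∀ u ∈ U, ∃ i, c (i, u) = g u).card : ℝ)
      ≤ Fintype.card (Fin J × X → Fin M) * ((J : ℝ) ^ U.card * ((M : ℝ)⁻¹) ^ U.card) := by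
  have hM' : (0 : ℝ) < M := by exact_mod_cast hM
  have hsub : (univ.filter fun c : Fin J × X → Fin M => ∀ u ∈ U, ∃ i, c (i, u) = g u)
      ⊆ (univ : Finset (U → Fin J)).biUnion fun a =>
          univ.filter fun c : Fin J × X → Fin M =>
            ∀ z ∈ (univ : Finset U).image fun u => (a u, u.1), c z = g z.2 := by
    intro c hc
    have h := (mem_filter.mp hc).2
    choose a ha using h
    rw [mem_biUnion]
    refine ⟨fun u => a u.1 u.2, mem_univ _, ?_⟩
    rw [mem_filter]
    refine ⟨mem_univ _, fun z hz => ?_⟩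
    obtain ⟨u, _, rfl⟩ := mem_image.mp hz
    exact ha u.1 u.2
  have hb : ∀ a ∈ (univ : Finset (U → Fin J)), ((univ.filter fun c : Fin J × X → Fin M =>
            ∀ z ∈ (univ : Finset U).image fun u => (a u, u.1), c z = g z.2).card : ℝ)
      ≤ Fintype.card (Fin J × X → Fin M) * ((M : ℝ)⁻¹) ^ U.card := by
    intro a _
    have h1 := card_fun_agree ((univ : Finset U).image fun u => (a u, u.1))
      (fun z : Fin J × X => g z.2)
    have h2 : ((univ : Finset U).image fun u => (a u, u.1)).card = U.card := by
      rw [card_image_of_injective _ (fun u u' h => Subtype.ext (congrArg Prod.snd h))]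
      simp
    rw [h2, Fintype.card_fin] at h1
    have h3 : ((univ.filter fun c : Fin J × X → Fin M =>
            ∀ z ∈ (univ : Finset U).image fun u => (a u, u.1), c z = g z.2).card : ℝ)
              * (M : ℝ) ^ U.card = Fintype.card (Fin J × X → Fin M) := by
      convert h1
    rw [← h3, inv_pow, mul_assoc, mul_inv_cancel₀ (by positivity), mul_one]
  calc ((univ.filter fun c : Fin J × X → Fin M => ∀ u ∈ U, ∃ i, c (i, u) = g u).card : ℝ)
      ≤ ∑ a : U → Fin J, ((univ.filter fun c : Fin J × X → Fin M =>
            ∀ z ∈ (univ : Finset U).image fun u => (a u, u.1), c z = g z.2).card : ℝ) := by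
        exact_mod_cast (card_le_card hsub).trans card_biUnion_le
    _ ≤ (univ : Finset (U → Fin J)).card *
          (Fintype.card (Fin J × X → Fin M) * ((M : ℝ)⁻¹) ^ U.card) := by
        rw [← nsmul_eq_mul]
        exact Finset.sum_le_card_nsmul _ _ _ hb
    _ = _ := by
        rw [card_univ, Fintype.card_fun, Fintype.card_fin, Fintype.card_coe]
        push_cast
        ring

namespace Frame

variable {X : Type} [Fintype X] {M K : ℕ} (F : Frame X M K)

theorem card_range_e : ((univ.image F.e).card : ℝ) ≤ 2 * M := by
  have h := F.M_pos
  have h1 : (univ.image F.e).card = M + 1 := by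
    rw [card_image_of_injective _ F.e_inj, card_univ]; simp
  rw [h1]
  have : (1 : ℝ) ≤ M := by exact_mod_cast h
  push_cast
  linarith

/-- Every label in `U` is the name of the prescribed block, or it is the name of some block and
the prescribed block is guessed by `c`; every label in `S` is the name of a block. -/
def PartialMatch {J : ℕ} (U S : Finset X) (g : X → Fin M)
    (q : Equiv.Perm X × (Fin J × X → Fin M)) : Prop :=
  (∀ u ∈ U, q.1⁻¹ u = F.e (some (g u)) ∨
      (q.1⁻¹ u ∈ univ.image F.e ∧ ∃ i, q.2 (i, u) = g u)) ∧
    ∀ u ∈ S, q.1⁻¹ u ∈ univ.image F.e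

/-- Union bound over the set `Uf` of labels in `U` that name exactly the prescribed block. Such a
label costs 1/N. Any other label of `U` must be some name, at cost 2/K, and be guessed correctly, at
cost J/M. The product is 2J/N, so guessing is cheaper only by a factor 2J per label. -/
theorem card_partialMatch_le {J : ℕ} (hJ : 1 ≤ J) (U S : Finset X) (hd : Disjoint U S)
    (g : X → Fin M) (hN : 2 * (U.card + S.card) ^ 2 ≤ Fintype.card X) :
    ((univ.filter fun q : Equiv.Perm X × (Fin J × X → Fin M) => F.PartialMatch U S g q).card : ℝ)
      ≤ 2 * (Fintype.card X).factorial * Fintype.card (Fin J × X → Fin M)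
        * ((4 * J : ℝ) ^ (U.card + S.card)
          * (((Fintype.card X : ℝ)⁻¹) ^ U.card * ((K : ℝ)⁻¹) ^ S.card)) := by
  have hM := F.M_pos'
  have hK := F.K_pos'
  have hNe := F.card_eq
  have hJ' : (1 : ℝ) ≤ J := by exact_mod_cast hJ
  set A : Finset X → Finset (Equiv.Perm X) := fun Uf => univ.filter fun σ => ∀ u ∈ U ∪ S,
    σ⁻¹ u ∈ (if u ∈ Uf then {F.e (some (g u))} else univ.image F.e) with hA
  set B : Finset X → Finset (Fin J × X → Fin M) := fun Ug =>
    univ.filter fun c => ∀ u ∈ Ug, ∃ i, c (i, u) = g u with hB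
  have hsub : (univ.filter fun q : Equiv.Perm X × (Fin J × X → Fin M) => F.PartialMatch U S g q)
      ⊆ U.powerset.biUnion fun Uf => A Uf ×ˢ B (U \ Uf) := by
    rintro ⟨σ, c⟩ hq
    obtain ⟨h1, h2⟩ := (mem_filter.mp hq).2
    rw [mem_biUnion]
    refine ⟨U.filter fun u => σ⁻¹ u = F.e (some (g u)), mem_powerset.mpr (filter_subset _ _), ?_⟩
    rw [mem_product]
    constructor
    · rw [hA, mem_filter]
      refine ⟨mem_univ _, fun u hu => ?_⟩
      split_ifs with h
      · rw [mem_singleton]; exact (mem_filter.mp h).2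
      · rcases mem_union.mp hu with hu | hu
        · rcases h1 u hu with h3 | h3
          · exact absurd (mem_filter.mpr ⟨hu, h3⟩) h
          · exact h3.1
        · exact h2 u hu
    · rw [hB, mem_filter]
      refine ⟨mem_univ _, fun u hu => ?_⟩
      rw [Finset.mem_sdiff] at hu
      rcases h1 u hu.1 with h3 | h3
      · exact absurd (mem_filter.mpr ⟨hu.1, h3⟩) hu.2
      · exact h3.2
  generalize hL : (Fintype.card X).factorial = L at *
  generalize hCC : Fintype.card (Fin J × X → Fin M) = CC at *
  have hUS : (U ∪ S).card = U.card + S.card := card_union_of_disjoint hd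
  have hterm : ∀ Uf ∈ U.powerset, ((A Uf ×ˢ B (U \ Uf)).card : ℝ)
      ≤ 2 * L * CC * ((2 * J : ℝ) ^ (U.card + S.card)
          * (((Fintype.card X : ℝ)⁻¹) ^ U.card * ((K : ℝ)⁻¹) ^ S.card)) := by
    intro Uf hUf
    rw [mem_powerset] at hUf
    have hAc : ((A Uf).card : ℝ) ≤ 2 * L * (((Fintype.card X : ℝ)⁻¹) ^ Uf.card
        * (2 * (K : ℝ)⁻¹) ^ ((U \ Uf).card + S.card)) := by
      refine (card_perm_inv_mem_le (U ∪ S) _ (by rw [hUS]; exact hN)).trans ?_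
      rw [hL]
      gcongr
      have hsplit : U ∪ S = Uf ∪ ((U \ Uf) ∪ S) := by
        rw [← union_assoc, union_sdiff_of_subset hUf]
      have hd1 : Disjoint Uf ((U \ Uf) ∪ S) := by
        rw [disjoint_union_right]
        exact ⟨disjoint_sdiff, hd.mono_left hUf⟩
      have hd2 : Disjoint (U \ Uf) S := hd.mono_left sdiff_subset
      rw [hsplit, prod_union hd1, ← card_union_of_disjoint hd2, ← prod_const, ← prod_const]
      refine mul_le_mul (le_of_eq (Finset.prod_congr rfl fun u hu => ?_))
        (Finset.prod_le_prod (fun u _ => by positivity) fun u hu => ?_)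
        (Finset.prod_nonneg fun u _ => by positivity)
        (Finset.prod_nonneg fun u _ => by positivity)
      · rw [if_pos hu]; simp
      · rw [if_neg (fun h => (disjoint_left.mp hd1) h hu)]
        calc ((univ.image F.e).card : ℝ) / Fintype.card X ≤ 2 * M / Fintype.card X := by
              gcongr; exact F.card_range_e
          _ = 2 * (K : ℝ)⁻¹ := by rw [hNe]; field_simp
    have hBc : ((B (U \ Uf)).card : ℝ)
        ≤ CC * ((J : ℝ) ^ (U \ Uf).card * ((M : ℝ)⁻¹) ^ (U \ Uf).card) := by
      rw [← hCC]
      exact card_exists_index_le F.M_pos _ g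
    rw [card_product]
    push_cast
    have hab : Uf.card + (U \ Uf).card = U.card := by
      rw [add_comm]; exact card_sdiff_add_card_eq_card hUf
    have hNinv : (Fintype.card X : ℝ)⁻¹ = (M : ℝ)⁻¹ * (K : ℝ)⁻¹ := by rw [hNe, mul_inv]
    calc ((A Uf).card : ℝ) * ((B (U \ Uf)).card : ℝ)
        ≤ (2 * L * (((Fintype.card X : ℝ)⁻¹) ^ Uf.card
            * (2 * (K : ℝ)⁻¹) ^ ((U \ Uf).card + S.card)))
          * (CC * ((J : ℝ) ^ (U \ Uf).card * ((M : ℝ)⁻¹) ^ (U \ Uf).card)) := by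
          gcongr
      _ = 2 * L * CC * ((2 ^ ((U \ Uf).card + S.card) * (J : ℝ) ^ (U \ Uf).card)
          * (((Fintype.card X : ℝ)⁻¹) ^ U.card * ((K : ℝ)⁻¹) ^ S.card)) := by
          rw [← hab, hNinv]
          simp only [pow_add, mul_pow]
          ring
      _ ≤ _ := by
          gcongr
          rw [mul_pow]
          have h1 : (U \ Uf).card + S.card ≤ U.card + S.card := by omega
          have h2 : (U \ Uf).card ≤ U.card + S.card := by omega
          exact mul_le_mul (pow_le_pow_right₀ (by norm_num) h1) (pow_le_pow_right₀ hJ' h2)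
            (by positivity) (by positivity)
  calc ((univ.filter fun q : Equiv.Perm X × (Fin J × X → Fin M) =>
        F.PartialMatch U S g q).card : ℝ)
      ≤ ∑ Uf ∈ U.powerset, ((A Uf ×ˢ B (U \ Uf)).card : ℝ) := by
        exact_mod_cast (card_le_card hsub).trans card_biUnion_le
    _ ≤ U.powerset.card * (2 * L * CC * ((2 * J : ℝ) ^ (U.card + S.card)
          * (((Fintype.card X : ℝ)⁻¹) ^ U.card * ((K : ℝ)⁻¹) ^ S.card))) := by
        rw [← nsmul_eq_mul]
        exact Finset.sum_le_card_nsmul _ _ _ hterm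
    _ ≤ (2 : ℝ) ^ (U.card + S.card) * (2 * L * CC * ((2 * J : ℝ) ^ (U.card + S.card)
          * (((Fintype.card X : ℝ)⁻¹) ^ U.card * ((K : ℝ)⁻¹) ^ S.card))) := by
        gcongr
        rw [card_powerset]
        push_cast
        exact pow_le_pow_right₀ (by norm_num) (by omega)
    _ = _ := by
        have : (4 * J : ℝ) = 2 * (2 * J) := by ring
        rw [this, mul_pow 2 (2 * J : ℝ)]
        ring

/-- The pair `p` is one of the random guesses: its label is the name of a block and one of the
first `N'` guesses for this label is the block of `p.1`. -/
def Guessed {J : ℕ} (π σ : Equiv.Perm X) (ξ : (Fin J × X → Fin M) × Fin J) (p : X × X) : Prop :=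
  (∃ o, p.2 = σ (F.e o)) ∧ ∃ i, i < ξ.2 ∧ ξ.1 (i, p.2) = F.block π p.1

end Frame

namespace LocalAlg

variable {V X W : Type} (G : LocalAlg V X W) [Fintype V] [Fintype X] {M K : ℕ}

/-- Some heavy path for `w` consists of pairs of `f` and of guessed pairs. -/
def HeavyAcc (F : Frame X M K) (Δ d : ℕ) {J : ℕ} (w : W) (π σ : Equiv.Perm X)
    (ξ : (Fin J × X → Fin M) × Fin J) : Prop :=
  ∃ vp ∈ G.paths w, G.Heavy Δ d w vp.2 ∧
    ∀ p ∈ vp.2, F.fn π σ p.1 = p.2 ∨ F.Guessed π σ ξ p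

/-- Some light path for `w` is contained in `f`. -/
def LightAcc (Δ d : ℕ) (w : W) (f : X → X) : Prop :=
  ∃ vp ∈ G.paths w, G.Light Δ d w vp.2 ∧ Extends vp.2 f

/-- A union bound over the paths would be too weak, since heavy outputs have many of them. Instead
it runs over the witnesses (T, S) of heaviness. Acceptance forces T to be matched and S to consist
of names, with probability at most about (4J)^r N^(-|T|) K^(-|S|), and heaviness bounds this by
(4J)^r 2^(-Δ) times the mass of the paths compatible with (T, S). -/
theorem card_heavyAcc_le (F : Frame X M K) {Δ d J r : ℕ} (hd : K = 2 ^ d) (hJ : 1 ≤ J) (w : W)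
    (hr : ∀ vp ∈ G.paths w, vp.2.card ≤ r) (hN : 2 * r ^ 2 ≤ Fintype.card X)
    (π : Equiv.Perm X) :
    ((univ.filter fun q : Equiv.Perm X × (Fin J × X → Fin M) =>
        ∃ N' : Fin J, G.HeavyAcc F Δ d w π q.1 (q.2, N')).card : ℝ)
      ≤ 2 * (Fintype.card X).factorial * Fintype.card (Fin J × X → Fin M)
        * ((16 * J : ℝ) ^ r * (2 ^ Δ)⁻¹ * ∑ vp ∈ G.paths w, weight vp.2) := by
  have hNpos := F.card_pos
  have hne : Nonempty X := Fintype.card_pos_iff.mp hNpos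
  have hJ' : (1 : ℝ) ≤ J := by exact_mod_cast hJ
  have hKpos := F.K_pos'
  have hNpos' : (0 : ℝ) < Fintype.card X := by exact_mod_cast hNpos
  set I : Finset (Finset (X × X) × Finset X) := univ.filter fun z =>
    (∃ vp ∈ G.paths w, z.1 ⊆ vp.2 ∧ z.2 ⊆ labels (vp.2 \ z.1)) ∧ 2 ^ Δ ≤ G.nu d w z.1 z.2 with hI
  set E : Finset (X × X) × Finset X → Finset (Equiv.Perm X × (Fin J × X → Fin M)) := fun z =>
    univ.filter fun q => (∀ p ∈ z.1, F.fn π q.1 p.1 = p.2 ∨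
      (q.1⁻¹ p.2 ∈ univ.image F.e ∧ ∃ i, q.2 (i, p.2) = F.block π p.1)) ∧
        ∀ u ∈ z.2, q.1⁻¹ u ∈ univ.image F.e with hE
  have hsub : (univ.filter fun q : Equiv.Perm X × (Fin J × X → Fin M) =>
        ∃ N' : Fin J, G.HeavyAcc F Δ d w π q.1 (q.2, N')) ⊆ I.biUnion E := by
    rintro ⟨σ, c⟩ hq
    obtain ⟨N', vp, hvp, ⟨T, hT, S, hS, -, hnu⟩, hacc⟩ := (mem_filter.mp hq).2
    have himg : ∀ p ∈ vp.2, σ⁻¹ p.2 ∈ univ.image F.e := by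
      intro p hp
      rw [mem_image]
      rcases hacc p hp with h | ⟨⟨o, ho⟩, -⟩
      · exact ⟨some (F.block π p.1), mem_univ _, by rw [← h, Frame.fn]; simp⟩
      · exact ⟨o, mem_univ _, by rw [ho]; simp⟩
    rw [mem_biUnion]
    refine ⟨(T, S), ?_, ?_⟩
    · rw [hI, mem_filter]
      exact ⟨mem_univ _, ⟨vp, hvp, hT, hS⟩, hnu⟩
    · rw [hE, mem_filter]
      refine ⟨mem_univ _, fun p hp => ?_, fun u hu => ?_⟩
      · rcases hacc p (hT hp) with h | ⟨-, i, -, hi⟩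
        · exact Or.inl h
        · exact Or.inr ⟨himg p (hT hp), i, hi⟩
      · obtain ⟨p, hp, rfl⟩ := mem_image.mp (hS hu)
        exact himg p (sdiff_subset hp)
  generalize hL : (Fintype.card X).factorial = L at *
  generalize hCC : Fintype.card (Fin J × X → Fin M) = CC at *
  have hterm : ∀ z ∈ I, ((E z).card : ℝ)
      ≤ 2 * L * CC * ((4 * J : ℝ) ^ r * (2 ^ Δ)⁻¹ * G.mass w z.1 z.2) := by
    rintro ⟨T, S⟩ hz
    obtain ⟨⟨vp, hvp, hT, hS⟩, hnu⟩ := (mem_filter.mp hz).2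
    simp only at hT hS hnu ⊢
    have hinj := G.paths_injOn_snd hvp
    have hinjT : Set.InjOn Prod.snd (T : Set (X × X)) := hinj.mono (by exact_mod_cast hT)
    obtain ⟨h, hh⟩ := exists_fst_of_injOn_snd hinjT
    have hdisj : Disjoint (labels T) S := by
      rw [disjoint_left]
      intro u hu hu'
      obtain ⟨p, hp, rfl⟩ := mem_image.mp hu
      obtain ⟨p', hp', hpp⟩ := mem_image.mp (hS hu')
      rw [Finset.mem_sdiff] at hp'
      exact hp'.2 (hinj hp'.1 (hT hp) hpp ▸ hp)
    have hTc := card_labels_of_injOn hinjT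
    have hcard : (labels T).card + S.card ≤ r := by
      have h1 : S.card ≤ (vp.2 \ T).card := (card_le_card hS).trans card_image_le
      have h2 := card_sdiff_add_card_eq_card hT
      have h3 := hr vp hvp
      omega
    have hEsub : E (T, S) ⊆ univ.filter fun q : Equiv.Perm X × (Fin J × X → Fin M) =>
        F.PartialMatch (labels T) S (fun u => F.block π (h u)) q := by
      rintro ⟨σ, c⟩ hq
      obtain ⟨h1, h2⟩ := (mem_filter.mp hq).2
      rw [mem_filter]
      refine ⟨mem_univ _, fun u hu => ?_, h2⟩
      obtain ⟨p, hp, rfl⟩ := mem_image.mp hu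
      simp only [hh p hp]
      rcases h1 p hp with h3 | h3
      · left
        rw [← h3, Frame.fn]; simp
      · exact Or.inr h3
    refine le_trans (Nat.cast_le.mpr (card_le_card hEsub)) ?_
    refine (F.card_partialMatch_le hJ _ _ hdisj _ (by nlinarith)).trans ?_
    rw [hL, hCC, hTc]
    rw [mul_assoc ((4 * J : ℝ) ^ r)]
    gcongr 2 * L * CC * ?_
    have h4 : (1 : ℝ) ≤ 4 * J := by linarith
    have hmass := G.mass_nonneg w T S
    refine mul_le_mul (pow_le_pow_right₀ h4 (hTc ▸ hcard)) ?_ (by positivity) (by positivity)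
    have hnu' : (2 : ℝ) ^ Δ ≤ (K : ℝ) ^ S.card * (Fintype.card X : ℝ) ^ T.card * G.mass w T S := by
      have : (K : ℝ) = 2 ^ d := by rw [hd]; push_cast; rfl
      rw [this, ← pow_mul]
      exact hnu
    rw [inv_pow, inv_pow, ← mul_inv, inv_le_iff_one_le_mul₀ (by positivity)]
    calc (1 : ℝ) = (2 ^ Δ)⁻¹ * 2 ^ Δ := by field_simp
      _ ≤ (2 ^ Δ)⁻¹ * ((K : ℝ) ^ S.card * (Fintype.card X : ℝ) ^ T.card * G.mass w T S) := by
          gcongr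
      _ = _ := by ring
  -- A path with at most r pairs is compatible with at most 2^r sets T and 2^r sets S.
  have hswap : ∑ z ∈ I, G.mass w z.1 z.2 ≤ 4 ^ r * ∑ vp ∈ G.paths w, weight vp.2 := by
    unfold mass
    simp only [sum_filter]
    rw [Finset.sum_comm, Finset.mul_sum]
    refine Finset.sum_le_sum fun vp hvp => ?_
    rw [← sum_filter, sum_const, nsmul_eq_mul]
    refine mul_le_mul_of_nonneg_right ?_ (weight_nonneg _)
    have h1 : (I.filter fun z => z.1 ⊆ vp.2 ∧ z.2 ⊆ labels (vp.2 \ z.1)).card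
        ≤ (vp.2.powerset ×ˢ (labels vp.2).powerset).card := by
      refine card_le_card fun z hz => ?_
      obtain ⟨h1, h2⟩ := (mem_filter.mp hz).2
      rw [mem_product, mem_powerset, mem_powerset]
      exact ⟨h1, h2.trans (image_subset_image sdiff_subset)⟩
    rw [card_product, card_powerset, card_powerset] at h1
    have h2 : (labels vp.2).card ≤ vp.2.card := card_image_le
    have h3 := hr vp hvp
    have h5 : 2 ^ vp.2.card * 2 ^ (labels vp.2).card ≤ 4 ^ r := by
      rw [show (4 : ℕ) = 2 * 2 by norm_num, mul_pow]
      exact Nat.mul_le_mul (Nat.pow_le_pow_right (by norm_num) h3)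
        (Nat.pow_le_pow_right (by norm_num) (h2.trans h3))
    exact_mod_cast h1.trans h5
  calc ((univ.filter fun q : Equiv.Perm X × (Fin J × X → Fin M) =>
        ∃ N' : Fin J, G.HeavyAcc F Δ d w π q.1 (q.2, N')).card : ℝ)
      ≤ ∑ z ∈ I, ((E z).card : ℝ) := by
        exact_mod_cast (card_le_card hsub).trans card_biUnion_le
    _ ≤ ∑ z ∈ I, 2 * L * CC * ((4 * J : ℝ) ^ r * (2 ^ Δ)⁻¹ * G.mass w z.1 z.2) :=
        Finset.sum_le_sum hterm
    _ = 2 * L * CC * ((4 * J : ℝ) ^ r * (2 ^ Δ)⁻¹ * ∑ z ∈ I, G.mass w z.1 z.2) := by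
        rw [← Finset.mul_sum, ← Finset.mul_sum]
    _ ≤ 2 * L * CC * ((4 * J : ℝ) ^ r * (2 ^ Δ)⁻¹ * (4 ^ r * ∑ vp ∈ G.paths w, weight vp.2)) := by
        gcongr
    _ = _ := by
        have : (16 * J : ℝ) = 4 * (4 * J) := by ring
        rw [this, mul_pow 4 (4 * J : ℝ)]
        ring

end LocalAlg

namespace LocalAlg

variable {V X W : Type} (G : LocalAlg V X W) [Fintype V] [Fintype X] {M K : ℕ}

/-! ### Light paths that become accepting when one block is renamed -/

/-- The light paths for `w` that contain the unused name as a label and otherwise agree with the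
function. -/
def nearPaths (F : Frame X M K) (Δ d : ℕ) (w : W) (π σ : Equiv.Perm X) :
    Finset (V × Finset (X × X)) :=
  (G.paths w).filter fun vp => G.Light Δ d w vp.2 ∧ F.spare σ ∈ labels vp.2 ∧
    Extends (vp.2.filter fun p => p.2 ≠ F.spare σ) (F.fn π σ)

/-- Bookkeeping with D the part of the path outside `Q`. All pairs of D but the one with label `y`
are new, which gives the exponent |D| - 1 of 1/M; their labels cost 1/K unless they already occur in
`Q`. Measured against the weight N^(-|P|) of the path P, this saves N for each pair in `Q`, K for
each old label or `y`, and one further M for the pair with label `y`. -/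
theorem wt_union_eq (F : Frame X M K) {w : W} {vp : V × Finset (X × X)} (hvp : vp ∈ G.paths w)
    (Q : Finset (X × X)) {y : X} (hy : y ∉ labels Q) (hyP : y ∈ labels vp.2) :
    F.wt (Q ∪ vp.2.filter fun p => p.2 ≠ y)
      = F.wt Q * (M * ((K : ℝ) ^ (labels (vp.2 \ Q) ∩ insert y (labels Q)).card
          * (Fintype.card X : ℝ) ^ (vp.2 ∩ Q).card * weight vp.2)) := by
  obtain ⟨v, P⟩ := vp
  simp only at hyP ⊢
  have hM := F.M_pos'
  have hK := F.K_pos'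
  have hinj := G.paths_injOn_snd hvp
  simp only at hinj
  set D := P \ Q with hD
  have hinjD : Set.InjOn Prod.snd (D : Set (X × X)) :=
    hinj.mono (by exact_mod_cast Finset.sdiff_subset)
  have hDc : (labels D).card = D.card := card_labels_of_injOn hinjD
  have hyD : y ∈ labels D := by
    obtain ⟨p, hp, rfl⟩ := mem_image.mp hyP
    exact mem_image_of_mem _ (Finset.mem_sdiff.mpr ⟨hp, fun h => hy (mem_image_of_mem _ h)⟩)
  have hPc : D.card + (P ∩ Q).card = P.card := card_sdiff_add_card_inter P Q
  have hlab : labels (D.filter fun p => p.2 ≠ y) = (labels D).erase y := by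
    ext u
    simp only [labels, mem_image, mem_filter, mem_erase]
    constructor
    · rintro ⟨p, ⟨h1, h2⟩, rfl⟩; exact ⟨h2, p, h1, rfl⟩
    · rintro ⟨h2, p, h1, rfl⟩; exact ⟨p, ⟨h1, h2⟩, rfl⟩
  have hDy : (D.filter fun p => p.2 ≠ y).card + 1 = D.card := by
    have h1 : (labels (D.filter fun p => p.2 ≠ y)).card = (D.filter fun p => p.2 ≠ y).card :=
      card_labels_of_injOn (hinjD.mono (by exact_mod_cast filter_subset _ _))
    rw [← h1, hlab, card_erase_add_one hyD, hDc]
  have hun : Q ∪ P.filter (fun p => p.2 ≠ y) = Q ∪ D.filter fun p => p.2 ≠ y := by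
    ext p
    simp only [mem_union, mem_filter, hD, Finset.mem_sdiff]
    tauto
  have hdisj : Disjoint Q (D.filter fun p => p.2 ≠ y) := by
    rw [disjoint_left]
    intro p hp hp'
    exact (Finset.mem_sdiff.mp (mem_filter.mp hp').1).2 hp
  have hc1 : (Q ∪ P.filter fun p => p.2 ≠ y).card + 1 = Q.card + D.card := by
    rw [hun, card_union_of_disjoint hdisj]; omega
  have hc2 : (labels (Q ∪ P.filter fun p => p.2 ≠ y)).card
      + (labels D ∩ insert y (labels Q)).card = (labels Q).card + D.card := by
    have h1 : labels (Q ∪ P.filter fun p => p.2 ≠ y)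
        = labels Q ∪ (labels D \ insert y (labels Q)) := by
      rw [hun, labels, image_union]
      change labels Q ∪ labels _ = _
      rw [hlab]
      ext u
      simp only [mem_union, mem_erase, Finset.mem_sdiff, mem_insert]
      tauto
    have h2 : Disjoint (labels Q) (labels D \ insert y (labels Q)) := by
      rw [disjoint_left]
      intro u hu hu'
      exact (Finset.mem_sdiff.mp hu').2 (mem_insert_of_mem hu)
    have h3 := card_sdiff_add_card_inter (labels D) (insert y (labels Q))
    rw [h1, card_union_of_disjoint h2]
    omega
  generalize (Q ∪ P.filter fun p => p.2 ≠ y) = R at *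
  unfold Frame.wt weight
  rw [← hPc, F.card_eq]
  generalize (labels D ∩ insert y (labels Q)).card = s at *
  generalize (labels R).card = lr at *
  generalize (labels Q).card = lq at *
  generalize R.card = cr at *
  generalize D.card = cd at *
  generalize (P ∩ Q).card = t at *
  have e1 : ((K : ℝ)⁻¹) ^ lr = ((K : ℝ)⁻¹) ^ lq * ((K : ℝ)⁻¹) ^ cd * (K : ℝ) ^ s := by
    rw [← pow_add, ← hc2, pow_add, mul_assoc, ← mul_pow, inv_mul_cancel₀ hK.ne', one_pow, mul_one]
  have e2 : ((M : ℝ)⁻¹) ^ cr = ((M : ℝ)⁻¹) ^ Q.card * ((M : ℝ)⁻¹) ^ cd * M := by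
    rw [← pow_add, ← hc1, pow_succ, mul_assoc, inv_mul_cancel₀ hM.ne', mul_one]
  have e3 : ((M * K : ℝ)) ^ t * (((M * K : ℝ))⁻¹) ^ (cd + t)
      = ((M : ℝ)⁻¹) ^ cd * ((K : ℝ)⁻¹) ^ cd := by
    have hMK : (M * K : ℝ) ≠ 0 := by positivity
    rw [pow_add, mul_comm _ (((M * K : ℝ))⁻¹ ^ t), ← mul_assoc, ← mul_pow, mul_inv_cancel₀ hMK,
      one_pow, one_mul, mul_inv, mul_pow]
  rw [e1, e2, mul_assoc ((K : ℝ) ^ s), e3]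
  ring

/-- Group the paths by their pairs T in `Q` and by those labels S of the other pairs that are `y` or
occur in `Q`. Up to the factor `F.wt Q * M`, each group contributes at most a value of `nu`, which
lightness bounds by 2^(-Δ); the power counts the possible (T, S). -/
theorem sum_wt_union_le (F : Frame X M K) {Δ d r : ℕ} (hd : K = 2 ^ d) (w : W)
    (hr : ∀ vp ∈ G.paths w, vp.2.card ≤ r) (Q : Finset (X × X)) {y : X} (hy : y ∉ labels Q) :
    ∑ vp ∈ (G.paths w).filter (fun vp => G.Light Δ d w vp.2 ∧ y ∈ labels vp.2),
        F.wt (Q ∪ vp.2.filter fun p => p.2 ≠ y)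
      ≤ F.wt Q * (M * ((Q.card + 2 : ℝ) ^ (2 * r) * (2 ^ Δ)⁻¹)) := by
  have hM := F.M_pos'
  have hK := F.K_pos'
  set A := (G.paths w).filter (fun vp => G.Light Δ d w vp.2 ∧ y ∈ labels vp.2) with hA
  have hKd : (K : ℝ) = 2 ^ d := by rw [hd]; push_cast; rfl
  have h1 : ∀ vp ∈ A, F.wt (Q ∪ vp.2.filter fun p => p.2 ≠ y)
      = F.wt Q * (M * ((K : ℝ) ^ (labels (vp.2 \ Q) ∩ insert y (labels Q)).card
          * (Fintype.card X : ℝ) ^ (vp.2 ∩ Q).card * weight vp.2)) := by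
    intro vp hvp
    obtain ⟨h1, -, h2⟩ := mem_filter.mp hvp
    exact G.wt_union_eq F h1 Q hy h2
  rw [Finset.sum_congr rfl h1, ← Finset.mul_sum, ← Finset.mul_sum]
  refine mul_le_mul_of_nonneg_left (mul_le_mul_of_nonneg_left ?_ hM.le) (F.wt_nonneg Q)
  set I : Finset (Finset (X × X) × Finset X) :=
    (Q.powerset.filter fun T => T.card ≤ r) ×ˢ
      ((insert y (labels Q)).powerset.filter fun S => S.card ≤ r) with hI
  have hmaps : ∀ vp ∈ A, (vp.2 ∩ Q, labels (vp.2 \ Q) ∩ insert y (labels Q)) ∈ I := by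
    intro vp hvp
    have hc := hr vp (mem_filter.mp hvp).1
    rw [hI, mem_product, mem_filter, mem_filter, mem_powerset, mem_powerset]
    refine ⟨⟨inter_subset_right, (card_le_card inter_subset_left).trans hc⟩,
      inter_subset_right, ?_⟩
    exact (card_le_card inter_subset_left).trans (card_image_le.trans
      ((card_le_card Finset.sdiff_subset).trans hc))
  rw [← Finset.sum_fiberwise_of_maps_to hmaps]
  have hterm : ∀ z ∈ I, ∑ vp ∈ A with
      (vp.2 ∩ Q, labels (vp.2 \ Q) ∩ insert y (labels Q)) = z,
      (K : ℝ) ^ (labels (vp.2 \ Q) ∩ insert y (labels Q)).card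
          * (Fintype.card X : ℝ) ^ (vp.2 ∩ Q).card * weight vp.2 ≤ (2 ^ Δ)⁻¹ := by
    rintro ⟨T, S⟩ _
    set A' := A.filter fun vp => (vp.2 ∩ Q, labels (vp.2 \ Q) ∩ insert y (labels Q)) = (T, S)
      with hA'
    have hin : ∀ vp ∈ A', T ⊆ vp.2 ∧ S ⊆ labels (vp.2 \ T) := by
      intro vp hvp
      obtain ⟨-, h2⟩ := mem_filter.mp hvp
      simp only [Prod.mk.injEq] at h2
      obtain ⟨rfl, rfl⟩ := h2
      refine ⟨inter_subset_left, inter_subset_left.trans (image_subset_image ?_)⟩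
      intro p hp
      rw [Finset.mem_sdiff] at hp ⊢
      exact ⟨hp.1, fun h => hp.2 (mem_inter.mp h).2⟩
    rcases A'.eq_empty_or_nonempty with h0 | ⟨vp₀, hvp₀⟩
    · rw [h0, sum_empty]; positivity
    · have hS : S.Nonempty := by
        obtain ⟨h1, h2⟩ := mem_filter.mp hvp₀
        simp only [Prod.mk.injEq] at h2
        obtain ⟨-, rfl⟩ := h2
        refine ⟨y, mem_inter.mpr ⟨?_, mem_insert_self _ _⟩⟩
        obtain ⟨p, hp, hpy⟩ := mem_image.mp (mem_filter.mp h1).2.2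
        refine mem_image.mpr ⟨p, Finset.mem_sdiff.mpr ⟨hp, fun h => hy ?_⟩, hpy⟩
        exact hpy ▸ mem_image_of_mem _ h
      have hl := (mem_filter.mp (mem_filter.mp hvp₀).1).2.1
      obtain ⟨h3, h4⟩ := hin vp₀ hvp₀
      refine le_trans ?_ (hl T h3 S h4 hS)
      unfold nu mass
      rw [pow_mul, ← hKd, Finset.mul_sum]
      refine le_trans (Finset.sum_le_sum (g := fun vp => (K : ℝ) ^ S.card
        * (Fintype.card X : ℝ) ^ T.card * weight vp.2) fun vp hvp => ?_) ?_
      · obtain ⟨-, h2⟩ := mem_filter.mp hvp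
        simp only [Prod.mk.injEq] at h2
        rw [h2.1, h2.2]
      · refine Finset.sum_le_sum_of_subset_of_nonneg ?_ ?_
        · intro vp hvp
          rw [mem_filter]
          exact ⟨(mem_filter.mp (mem_filter.mp hvp).1).1, hin vp hvp⟩
        · intro vp _ _
          exact mul_nonneg (by positivity) (weight_nonneg _)
  refine (Finset.sum_le_card_nsmul _ _ _ hterm).trans ?_
  rw [nsmul_eq_mul]
  refine mul_le_mul_of_nonneg_right ?_ (by positivity)
  have h2 : I.card ≤ (Q.card + 1) ^ r * (Q.card + 2) ^ r := by
    rw [hI, card_product]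
    refine Nat.mul_le_mul (card_powerset_filter_le Q r) ((card_powerset_filter_le _ r).trans ?_)
    refine Nat.pow_le_pow_left ?_ r
    have := card_insert_le y (labels Q)
    have h3 : (labels Q).card ≤ Q.card := card_image_le
    omega
  have h3 : I.card ≤ (Q.card + 2) ^ (2 * r) := by
    rw [two_mul, pow_add]
    exact h2.trans (Nat.mul_le_mul_right _ (Nat.pow_le_pow_left (by omega) r))
  exact_mod_cast h3

/-- The power counts tuples of near paths. They are exposed one at a time, each adding its pairs
with labels other than `y` to the known part `Q`. As lightness holds conditionally on all partial
information, every exposure costs the same factor. `R` bounds the number of pairs ever collected. -/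
theorem sum_card_nearPaths_pow_le (F : Frame X M K) {Δ d r R : ℕ} (hd : K = 2 ^ d) (w : W)
    (hr : ∀ vp ∈ G.paths w, vp.2.card ≤ r) (hN : 2 * (R + 1) ^ 2 ≤ Fintype.card X) (y : X)
    (j : ℕ) (Q : Finset (X × X)) (hy : y ∉ labels Q) (hQ : Q.card + r * j ≤ R) :
    ∑ q ∈ univ.filter (fun q : Equiv.Perm X × Equiv.Perm X =>
        F.spare q.2 = y ∧ Extends Q (F.fn q.1 q.2)),
        ((G.nearPaths F Δ d w q.1 q.2).card : ℝ) ^ j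
      ≤ 4 * ((Fintype.card X).factorial : ℝ) ^ 2 * (Fintype.card X : ℝ)⁻¹ * F.wt Q
        * (M * ((R + 2 : ℝ) ^ (2 * r) * (2 ^ Δ)⁻¹)) ^ j := by
  have hM := F.M_pos'
  induction j generalizing Q with
  | zero =>
    simp only [pow_zero, sum_const, nsmul_eq_mul, mul_one]
    refine F.card_extends_le Q y hy (le_trans ?_ hN)
    gcongr
    omega
  | succ j ih =>
    set Bd : ℝ := M * ((R + 2 : ℝ) ^ (2 * r) * (2 ^ Δ)⁻¹) with hBd
    have hBd0 : 0 ≤ Bd := by positivity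
    set A := (G.paths w).filter (fun vp => G.Light Δ d w vp.2 ∧ y ∈ labels vp.2) with hA
    have hstep : ∀ q ∈ univ.filter (fun q : Equiv.Perm X × Equiv.Perm X =>
        F.spare q.2 = y ∧ Extends Q (F.fn q.1 q.2)),
        ((G.nearPaths F Δ d w q.1 q.2).card : ℝ) ^ (j + 1)
          = ∑ vp ∈ A, if Extends (vp.2.filter fun p => p.2 ≠ y) (F.fn q.1 q.2) then
              ((G.nearPaths F Δ d w q.1 q.2).card : ℝ) ^ j else 0 := by
      intro q hq
      have hsp := (mem_filter.mp hq).2.1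
      rw [← sum_filter, sum_const, nsmul_eq_mul, pow_succ', hA, filter_filter]
      congr 3
      unfold nearPaths
      rw [hsp]
      ext vp
      simp only [mem_filter]
      tauto
    rw [Finset.sum_congr rfl hstep, Finset.sum_comm]
    have hin : ∀ vp ∈ A, (∑ q ∈ univ.filter (fun q : Equiv.Perm X × Equiv.Perm X =>
        F.spare q.2 = y ∧ Extends Q (F.fn q.1 q.2)),
          if Extends (vp.2.filter fun p => p.2 ≠ y) (F.fn q.1 q.2) then
              ((G.nearPaths F Δ d w q.1 q.2).card : ℝ) ^ j else 0)
        ≤ 4 * ((Fintype.card X).factorial : ℝ) ^ 2 * (Fintype.card X : ℝ)⁻¹ * Bd ^ j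
          * F.wt (Q ∪ vp.2.filter fun p => p.2 ≠ y) := by
      intro vp hvp
      rw [← sum_filter, filter_filter]
      have h1 : y ∉ labels (Q ∪ vp.2.filter fun p => p.2 ≠ y) := by
        intro h
        obtain ⟨p, hp, hpy⟩ := mem_image.mp h
        rcases mem_union.mp hp with h | h
        · exact hy (hpy ▸ mem_image_of_mem _ h)
        · exact (mem_filter.mp h).2 hpy
      have h2 : (Q ∪ vp.2.filter fun p => p.2 ≠ y).card + r * j ≤ R := by
        have h3 := card_union_le Q (vp.2.filter fun p => p.2 ≠ y)
        have h4 : (vp.2.filter fun p => p.2 ≠ y).card ≤ vp.2.card := card_filter_le _ _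
        have h5 := hr vp (mem_filter.mp hvp).1
        rw [mul_add] at hQ
        omega
      refine le_trans (le_of_eq ?_) ((ih _ h1 h2).trans (le_of_eq (by ring)))
      refine Finset.sum_congr ?_ fun _ _ => rfl
      ext q
      simp only [mem_filter, mem_univ, true_and, Extends, mem_union]
      constructor
      · rintro ⟨⟨h1, h2⟩, h3⟩
        exact ⟨h1, fun p hp => hp.elim (h2 p) (h3 p)⟩
      · rintro ⟨h1, h2⟩
        exact ⟨⟨h1, fun p hp => h2 p (Or.inl hp)⟩, fun p hp => h2 p (Or.inr hp)⟩
    refine (Finset.sum_le_sum hin).trans ?_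
    rw [← Finset.mul_sum]
    have hsum := G.sum_wt_union_le F (Δ := Δ) hd w hr Q hy
    have hQR : Q.card ≤ R := by omega
    have hwt := F.wt_nonneg Q
    have h6 : F.wt Q * (M * ((Q.card + 2 : ℝ) ^ (2 * r) * (2 ^ Δ)⁻¹)) ≤ F.wt Q * Bd := by
      rw [hBd]
      gcongr
    calc _ ≤ 4 * ((Fintype.card X).factorial : ℝ) ^ 2 * (Fintype.card X : ℝ)⁻¹ * Bd ^ j
          * (F.wt Q * Bd) := by
          refine mul_le_mul_of_nonneg_left (hsum.trans h6) (by positivity)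
      _ = _ := by rw [pow_succ]; ring

/-- Markov's inequality for the s-th moment, at twice the bound from `sum_card_nearPaths_pow_le`,
gives 2^(-s) for each output. With s larger than the output length, the union bound over all outputs
still leaves a small probability. -/
theorem card_nearPaths_ge_le [Fintype W] (F : Frame X M K) {Δ d r s : ℕ} (hd : K = 2 ^ d)
    (hr : ∀ w, ∀ vp ∈ G.paths w, vp.2.card ≤ r)
    (hN : 2 * (r * s + 1) ^ 2 ≤ Fintype.card X) :
    ((univ.filter fun q : Equiv.Perm X × Equiv.Perm X => ∃ w,
        2 * (M * ((r * s + 2 : ℝ) ^ (2 * r) * (2 ^ Δ)⁻¹))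
          ≤ ((G.nearPaths F Δ d w q.1 q.2).card : ℝ)).card : ℝ)
      ≤ 4 * Fintype.card W * (2 ^ s)⁻¹ * ((Fintype.card X).factorial : ℝ) ^ 2 := by
  have hM := F.M_pos'
  have hNpos : (0 : ℝ) < Fintype.card X := by exact_mod_cast F.card_pos
  set Bd : ℝ := M * ((r * s + 2 : ℝ) ^ (2 * r) * (2 ^ Δ)⁻¹) with hBd
  have hBd0 : 0 < Bd := by positivity
  have hw : ∀ w ∈ (univ : Finset W), ((univ.filter fun q : Equiv.Perm X × Equiv.Perm X =>
      2 * Bd ≤ ((G.nearPaths F Δ d w q.1 q.2).card : ℝ)).card : ℝ)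
      ≤ 4 * (2 ^ s)⁻¹ * ((Fintype.card X).factorial : ℝ) ^ 2 := by
    intro w _
    have hsum : ∑ q : Equiv.Perm X × Equiv.Perm X,
        ((G.nearPaths F Δ d w q.1 q.2).card : ℝ) ^ s
        ≤ 4 * ((Fintype.card X).factorial : ℝ) ^ 2 * Bd ^ s := by
      rw [← Finset.sum_fiberwise (s := univ) (g := fun q : Equiv.Perm X × Equiv.Perm X =>
        F.spare q.2)]
      have hy : ∀ y ∈ (univ : Finset X), ∑ q : Equiv.Perm X × Equiv.Perm X with F.spare q.2 = y,
          ((G.nearPaths F Δ d w q.1 q.2).card : ℝ) ^ s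
          ≤ 4 * ((Fintype.card X).factorial : ℝ) ^ 2 * (Fintype.card X : ℝ)⁻¹ * Bd ^ s := by
        intro y _
        have h := G.sum_card_nearPaths_pow_le F (Δ := Δ) (R := r * s) hd w (hr w) hN y s ∅
          (by simp [labels]) (by simp)
        have hwt : F.wt ∅ = 1 := by simp [Frame.wt, labels]
        rw [hwt, mul_one] at h
        push_cast at h
        refine le_trans (le_of_eq (Finset.sum_congr ?_ fun _ _ => rfl)) h
        ext q
        simp [Extends]
      refine (Finset.sum_le_card_nsmul _ _ _ hy).trans (le_of_eq ?_)
      rw [card_univ, nsmul_eq_mul]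
      generalize ((Fintype.card X).factorial : ℝ) = L
      field_simp
    have hlow : ((univ.filter fun q : Equiv.Perm X × Equiv.Perm X =>
        2 * Bd ≤ ((G.nearPaths F Δ d w q.1 q.2).card : ℝ)).card : ℝ) * (2 * Bd) ^ s
        ≤ ∑ q : Equiv.Perm X × Equiv.Perm X,
          ((G.nearPaths F Δ d w q.1 q.2).card : ℝ) ^ s := by
      rw [← nsmul_eq_mul]
      refine (Finset.card_nsmul_le_sum _ (fun q : Equiv.Perm X × Equiv.Perm X =>
        ((G.nearPaths F Δ d w q.1 q.2).card : ℝ) ^ s) _ ?_).trans ?_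
      · intro q hq
        exact pow_le_pow_left₀ (by positivity) (mem_filter.mp hq).2 s
      · exact Finset.sum_le_univ_sum_of_nonneg fun q => by positivity
    have h := hlow.trans hsum
    rw [mul_pow, ← mul_assoc] at h
    have h' := le_of_mul_le_mul_right h (by positivity)
    rw [show (4 : ℝ) * (2 ^ s)⁻¹ * ((Fintype.card X).factorial : ℝ) ^ 2
      = 4 * ((Fintype.card X).factorial : ℝ) ^ 2 * (2 ^ s)⁻¹ by ring,
      ← div_eq_mul_inv, le_div_iff₀ (by positivity)]
    exact h'
  have hsub : (univ.filter fun q : Equiv.Perm X × Equiv.Perm X => ∃ w,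
        2 * Bd ≤ ((G.nearPaths F Δ d w q.1 q.2).card : ℝ))
      ⊆ (univ : Finset W).biUnion fun w => univ.filter fun q : Equiv.Perm X × Equiv.Perm X =>
        2 * Bd ≤ ((G.nearPaths F Δ d w q.1 q.2).card : ℝ) := by
    intro q hq
    obtain ⟨w, h⟩ := (mem_filter.mp hq).2
    exact mem_biUnion.mpr ⟨w, mem_univ _, mem_filter.mpr ⟨mem_univ _, h⟩⟩
  calc _ ≤ ∑ w : W, ((univ.filter fun q : Equiv.Perm X × Equiv.Perm X =>
        2 * Bd ≤ ((G.nearPaths F Δ d w q.1 q.2).card : ℝ)).card : ℝ) := by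
        exact_mod_cast (card_le_card hsub).trans card_biUnion_le
    _ ≤ (univ : Finset W).card * (4 * (2 ^ s)⁻¹ * ((Fintype.card X).factorial : ℝ) ^ 2) := by
        rw [← nsmul_eq_mul]
        exact Finset.sum_le_card_nsmul _ _ _ hw
    _ = _ := by rw [card_univ]; ring

end LocalAlg

/-! ### The advantage of the breaker -/

theorem sum_fun_apply {ι β : Type} [Fintype ι] [Fintype β] (i : ι) (h : β → ℝ) :
    (Fintype.card β : ℝ) * ∑ ξ : ι → β, h (ξ i) = Fintype.card (ι → β) * ∑ z, h z := by
  have h1 := sum_update_swap i (fun (c : ι → β) (_ : β) => h (c i))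
  simp only [Function.update_self, sum_const, card_univ, nsmul_eq_mul] at h1
  rw [← Finset.mul_sum] at h1
  exact h1.symm

/-- The random choices of the breaker for one output. -/
abbrev Guess (X : Type) (J M : ℕ) : Type := (Fin J × X → Fin M) × Fin J

namespace LocalAlg

variable {V X W : Type} (G : LocalAlg V X W) [Fintype V] [Fintype X] {M K : ℕ}

/-- The breaker: it accepts the outputs with a light path in `f`, and those with a heavy path all
of whose pairs are in `f` or guessed. -/
def breaker (F : Frame X M K) (Δ d : ℕ) {J : ℕ} (π σ : Equiv.Perm X) (ξ : W → Guess X J M)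
    (w : W) : Bool :=
  decide (G.LightAcc Δ d w (F.fn π σ) ∨ G.HeavyAcc F Δ d w π σ (ξ w))

/-- A light path inside `f` is the run of a seed, so `w` is one of the outputs of the generator with
oracle `f`. -/
theorem card_lightAcc_le [Fintype W] (Δ d : ℕ) (f : X → X) :
    (univ.filter fun w => G.LightAcc Δ d w f).card ≤ Fintype.card V := by
  have h : ∀ w ∈ univ.filter (fun w => G.LightAcc Δ d w f), ∃ v, G.out v f = some w := by
    intro w hw
    obtain ⟨vp, h1, -, h2⟩ := (mem_filter.mp hw).2
    exact ⟨vp.1, (G.mem_paths_extends h1 h2).2⟩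
  have h2 : ((univ.filter fun w => G.LightAcc Δ d w f).image some).card
      ≤ (univ.image fun v => G.out v f).card := by
    refine card_le_card fun o ho => ?_
    obtain ⟨w, hw, rfl⟩ := mem_image.mp ho
    obtain ⟨v, hv⟩ := h w hw
    exact mem_image.mpr ⟨v, mem_univ _, hv⟩
  rw [card_image_of_injective _ (Option.some_injective W)] at h2
  exact h2.trans (card_image_le.trans (card_univ (α := V)).le)

/-- A pair of seed and permutation is either critical or counted at its own path. -/
theorem card_perm_le_sum_paths [Fintype W] (Δ d : ℕ)
    (hout : ∀ v (ϖ : Equiv.Perm X), ∃ w, G.out v ϖ = some w) :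
    Fintype.card V * (Fintype.card X).factorial
      ≤ (∑ w, ∑ vp ∈ (G.paths w).filter (fun vp => G.Light Δ d w vp.2 ∨ G.Heavy Δ d w vp.2),
          (univ.filter fun σ : Equiv.Perm X => Extends vp.2 σ).card)
        + (univ.filter fun q : V × Equiv.Perm X => G.Critical Δ d q.1 q.2).card := by
  have h1 : ∀ w, ∑ vp ∈ (G.paths w).filter (fun vp => G.Light Δ d w vp.2 ∨ G.Heavy Δ d w vp.2),
      (univ.filter fun σ : Equiv.Perm X => Extends vp.2 σ).card
      = (((G.paths w).filter (fun vp => G.Light Δ d w vp.2 ∨ G.Heavy Δ d w vp.2)).sigma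
          fun vp => univ.filter fun σ : Equiv.Perm X => Extends vp.2 σ).card := by
    intro w; rw [card_sigma]
  simp only [h1]
  rw [← card_sigma]
  have h2 := Finset.card_filter_add_card_filter_not (s := (univ : Finset (V × Equiv.Perm X)))
    (p := fun q => ¬ G.Critical Δ d q.1 q.2)
  simp only [not_not] at h2
  rw [card_univ, Fintype.card_prod, Fintype.card_perm] at h2
  rw [← h2]
  refine Nat.add_le_add_right ?_ _
  choose o ho using hout
  refine card_le_card_of_injOn (fun q => ⟨o q.1 q.2, (q.1, G.path q.1 q.2), q.2⟩) ?_ ?_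
  · rintro ⟨v, ϖ⟩ hq
    have hq' := (mem_filter.mp (mem_coe.mp hq)).2
    rw [mem_coe, mem_sigma, mem_sigma, mem_filter, mem_filter]
    refine ⟨mem_univ _, ⟨G.mem_paths.mpr ⟨ϖ, rfl, ho v ϖ⟩, ?_⟩, mem_univ _, G.extends_path v ϖ⟩
    by_contra hcon
    rw [not_or] at hcon
    exact hq' ⟨o v ϖ, ho v ϖ, hcon⟩
  · rintro ⟨v, ϖ⟩ _ ⟨v', ϖ'⟩ _ heq
    simp only [Sigma.mk.injEq] at heq
    obtain ⟨h1, h2⟩ := heq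
    have h3 := eq_of_heq h2
    simp only [Sigma.mk.injEq, Prod.mk.injEq] at h3
    obtain ⟨⟨rfl, h4⟩, h5⟩ := h3
    rw [eq_of_heq h5]

/-- Non-critical runs are abundant for permutations, by `hcrit`, and each of their paths is almost
as likely under the regular function. Different paths of the same seed exclude each other, so the
probabilities add up. -/
theorem card_accepted_ge [Fintype W] (F : Frame X M K) {Δ d r D : ℕ} (hD : 0 < D)
    (hout : ∀ v (ϖ : Equiv.Perm X), ∃ w, G.out v ϖ = some w)
    (hr : ∀ w, ∀ vp ∈ G.paths w, vp.2.card ≤ r) (hN8 : 8 ≤ Fintype.card X)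
    (hM : 2 * (r : ℝ) ^ 2 ≤ M)
    (hcrit : D * (univ.filter fun q : V × Equiv.Perm X => G.Critical Δ d q.1 q.2).card
      ≤ 2 * Δ * (Fintype.card V * (Fintype.card X).factorial)) :
    (1 - 2 * (r : ℝ) ^ 2 / M) * (1 - 2 * Δ / D) * Fintype.card V
        * ((Fintype.card X).factorial : ℝ) ^ 2
      ≤ ∑ q : Equiv.Perm X × Equiv.Perm X, ((univ.filter fun v => ∃ w,
          G.out v (F.fn q.1 q.2) = some w ∧ ∃ vp ∈ G.paths w,
            (G.Light Δ d w vp.2 ∨ G.Heavy Δ d w vp.2) ∧ Extends vp.2 (F.fn q.1 q.2)).card : ℝ) := by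
  have hMp := F.M_pos'
  have hDp : (0 : ℝ) < D := by exact_mod_cast hD
  set PP : W → Finset (V × Finset (X × X)) := fun w =>
    (G.paths w).filter (fun vp => G.Light Δ d w vp.2 ∨ G.Heavy Δ d w vp.2) with hPP
  have hlow : ∑ w, ∑ vp ∈ PP w, (univ.filter fun q : Equiv.Perm X × Equiv.Perm X =>
        Extends vp.2 (F.fn q.1 q.2)).card
      ≤ ∑ q : Equiv.Perm X × Equiv.Perm X, (univ.filter fun v => ∃ w,
          G.out v (F.fn q.1 q.2) = some w ∧ ∃ vp ∈ G.paths w,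
            (G.Light Δ d w vp.2 ∨ G.Heavy Δ d w vp.2) ∧ Extends vp.2 (F.fn q.1 q.2)).card := by
    rw [← card_sigma]
    have h1 : ∀ w, ∑ vp ∈ PP w, (univ.filter fun q : Equiv.Perm X × Equiv.Perm X =>
        Extends vp.2 (F.fn q.1 q.2)).card = ((PP w).sigma fun vp =>
          univ.filter fun q : Equiv.Perm X × Equiv.Perm X => Extends vp.2 (F.fn q.1 q.2)).card := by
      intro w; rw [card_sigma]
    simp only [h1]
    rw [← card_sigma]
    refine card_le_card_of_injOn (fun q => ⟨q.2.2, q.2.1.1⟩) ?_ ?_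
    · rintro ⟨w, vp, q⟩ hq
      simp only [coe_sigma, coe_univ, Set.mem_sigma_iff, Set.mem_univ, true_and, hPP,
        coe_filter, Set.mem_ofPred_eq, mem_univ] at hq ⊢
      obtain ⟨⟨h1, h2⟩, h3⟩ := hq
      exact ⟨w, (G.mem_paths_extends h1 h3).2, vp, h1, h2, h3⟩
    · rintro ⟨w, vp, q⟩ hq ⟨w', vp', q'⟩ hq' heq
      simp only [coe_sigma, coe_univ, Set.mem_sigma_iff, Set.mem_univ, true_and, hPP,
        coe_filter, Set.mem_ofPred_eq, mem_univ] at hq hq'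
      obtain ⟨⟨h1, h2⟩, h3⟩ := hq
      obtain ⟨⟨h1', h2'⟩, h3'⟩ := hq'
      simp only [Sigma.mk.injEq] at heq
      obtain ⟨rfl, hv⟩ := heq
      have hv := eq_of_heq hv
      obtain ⟨h4, h5⟩ := G.mem_paths_extends h1 h3
      obtain ⟨h4', h5'⟩ := G.mem_paths_extends h1' h3'
      rw [hv] at h4 h5
      have hw : w = w' := Option.some_injective _ (h5.symm.trans h5')
      subst hw
      have hvp : vp = vp' := Prod.ext hv (h4.symm.trans h4')
      subst hvp
      rfl
  have hfac := G.card_perm_le_sum_paths Δ d hout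
  have hterm : ∀ w, ∀ vp ∈ PP w, (1 - 2 * (r : ℝ) ^ 2 / M) * (Fintype.card X).factorial
      * ((univ.filter fun σ : Equiv.Perm X => Extends vp.2 σ).card : ℝ)
      ≤ ((univ.filter fun q : Equiv.Perm X × Equiv.Perm X =>
          Extends vp.2 (F.fn q.1 q.2)).card : ℝ) := by
    intro w vp hvp
    have hmem := (mem_filter.mp hvp).1
    obtain ⟨ϖ, h1, -⟩ := G.mem_paths.mp hmem
    have hext : Extends vp.2 ϖ := h1 ▸ G.extends_path vp.1 ϖ
    refine le_trans ?_ (F.card_extends_ge hext hN8)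
    have hc : (vp.2.card : ℝ) ≤ r := by exact_mod_cast hr w vp hmem
    gcongr
  have hsum : (1 - 2 * (r : ℝ) ^ 2 / M) * (Fintype.card X).factorial
      * ((∑ w, ∑ vp ∈ PP w, (univ.filter fun σ : Equiv.Perm X => Extends vp.2 σ).card : ℕ) : ℝ)
      ≤ ((∑ w, ∑ vp ∈ PP w, (univ.filter fun q : Equiv.Perm X × Equiv.Perm X =>
          Extends vp.2 (F.fn q.1 q.2)).card : ℕ) : ℝ) := by
    push_cast
    simp only [Finset.mul_sum]
    exact Finset.sum_le_sum fun w _ => Finset.sum_le_sum (hterm w)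
  clear hterm
  have hlow' : ((∑ w, ∑ vp ∈ PP w, (univ.filter fun q : Equiv.Perm X × Equiv.Perm X =>
        Extends vp.2 (F.fn q.1 q.2)).card : ℕ) : ℝ)
      ≤ ∑ q : Equiv.Perm X × Equiv.Perm X, ((univ.filter fun v => ∃ w,
          G.out v (F.fn q.1 q.2) = some w ∧ ∃ vp ∈ G.paths w,
            (G.Light Δ d w vp.2 ∨ G.Heavy Δ d w vp.2) ∧
              Extends vp.2 (F.fn q.1 q.2)).card : ℝ) := by
    exact_mod_cast hlow
  refine le_trans (le_trans ?_ hsum) hlow'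
  clear hlow hlow' hsum
  generalize (∑ w, ∑ vp ∈ PP w, (univ.filter fun σ : Equiv.Perm X => Extends vp.2 σ).card) = S
    at *
  generalize (univ.filter fun q : V × Equiv.Perm X => G.Critical Δ d q.1 q.2).card = cr at *
  generalize (Fintype.card X).factorial = L at *
  have hfac' : (Fintype.card V * L : ℝ) ≤ S + cr := by exact_mod_cast hfac
  have hcrit' : (D * cr : ℝ) ≤ 2 * Δ * (Fintype.card V * L) := by exact_mod_cast hcrit
  have hA : 0 ≤ 1 - 2 * (r : ℝ) ^ 2 / M := by
    rw [sub_nonneg, div_le_one hMp]; exact hM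
  have hcr : (cr : ℝ) ≤ 2 * Δ / D * (Fintype.card V * L) := by
    rw [div_mul_eq_mul_div, le_div_iff₀ hDp]; linarith
  calc (1 - 2 * (r : ℝ) ^ 2 / M) * (1 - 2 * Δ / D) * Fintype.card V * (L : ℝ) ^ 2
      = (1 - 2 * (r : ℝ) ^ 2 / M) * L
          * (Fintype.card V * L - 2 * Δ / D * (Fintype.card V * L)) := by ring
    _ ≤ (1 - 2 * (r : ℝ) ^ 2 / M) * L * S := by
        gcongr
        linarith

/-- `card_heavyAcc_le` summed over all outputs, where Kraft's inequality bounds the total weight of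
the paths by the number of seeds. -/
theorem sum_card_heavyAcc_le [Fintype W] (F : Frame X M K) {Δ d J r : ℕ} (hd : K = 2 ^ d)
    (hJ : 1 ≤ J) (hr : ∀ w, ∀ vp ∈ G.paths w, vp.2.card ≤ r)
    (hN : 2 * r ^ 2 ≤ Fintype.card X) :
    ∑ q : Equiv.Perm X × Equiv.Perm X, ∑ ξ : W → Guess X J M,
        ((univ.filter fun w => G.HeavyAcc F Δ d w q.1 q.2 (ξ w)).card : ℝ)
      ≤ 2 * ((Fintype.card X).factorial : ℝ) ^ 2 * Fintype.card (W → Guess X J M)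
        * ((16 * J : ℝ) ^ r * (2 ^ Δ)⁻¹ * Fintype.card V) := by
  have hJ' : (0 : ℝ) < J := by exact_mod_cast hJ
  have hC : (0 : ℝ) < Fintype.card (Fin J × X → Fin M) := by
    have : Nonempty (Fin M) := ⟨⟨0, F.M_pos⟩⟩
    exact_mod_cast Fintype.card_pos
  have hZ : (Fintype.card (Guess X J M) : ℝ) = Fintype.card (Fin J × X → Fin M) * J := by
    rw [Fintype.card_prod, Fintype.card_fin]; push_cast; rfl
  have key : ∀ w (π : Equiv.Perm X), ∑ σ : Equiv.Perm X, ∑ ξ : W → Guess X J M,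
      (if G.HeavyAcc F Δ d w π σ (ξ w) then (1 : ℝ) else 0)
      ≤ Fintype.card (W → Guess X J M) * (2 * (Fintype.card X).factorial
        * ((16 * J : ℝ) ^ r * (2 ^ Δ)⁻¹ * ∑ vp ∈ G.paths w, weight vp.2)) := by
    intro w π
    have h1 : ∀ σ : Equiv.Perm X, ∑ ξ : W → Guess X J M,
        (if G.HeavyAcc F Δ d w π σ (ξ w) then (1 : ℝ) else 0)
        = Fintype.card (W → Guess X J M) / Fintype.card (Guess X J M)
          * ∑ z : Guess X J M, (if G.HeavyAcc F Δ d w π σ z then (1 : ℝ) else 0) := by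
      intro σ
      have h2 := sum_fun_apply w (fun z : Guess X J M =>
        if G.HeavyAcc F Δ d w π σ z then (1 : ℝ) else 0)
      rw [div_mul_eq_mul_div, eq_div_iff (by rw [hZ]; positivity), ← h2, mul_comm]
    simp only [h1, ← Finset.mul_sum]
    have h2 : ∑ σ : Equiv.Perm X, ∑ z : Guess X J M,
        (if G.HeavyAcc F Δ d w π σ z then (1 : ℝ) else 0)
        ≤ J * ((univ.filter fun q : Equiv.Perm X × (Fin J × X → Fin M) =>
          ∃ N' : Fin J, G.HeavyAcc F Δ d w π q.1 (q.2, N')).card : ℝ) := by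
      rw [← Fintype.sum_prod_type', card_filter]
      push_cast
      rw [Fintype.sum_prod_type, Fintype.sum_prod_type]
      simp only [Finset.mul_sum, Fintype.sum_prod_type]
      refine Finset.sum_le_sum fun σ _ => Finset.sum_le_sum fun c _ => ?_
      split_ifs with h
      · calc _ ≤ ∑ _ : Fin J, (1 : ℝ) := Finset.sum_le_sum fun _ _ => by split_ifs <;> norm_num
          _ = _ := by simp
      · rw [Finset.sum_eq_zero fun N' _ => if_neg fun h' => h ⟨N', h'⟩]; simp
    have h3 := G.card_heavyAcc_le F (Δ := Δ) hd hJ w (hr w) hN π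
    rw [hZ]
    have hw0 : 0 ≤ ∑ vp ∈ G.paths w, weight vp.2 := Finset.sum_nonneg fun _ _ => weight_nonneg _
    generalize (Fintype.card X).factorial = L at *
    generalize (Fintype.card (W → Guess X J M)) = CW at *
    generalize (Fintype.card (Fin J × X → Fin M)) = CC at *
    calc _ ≤ (CW : ℝ) / (CC * J) * (J * (2 * L * CC
            * ((16 * J : ℝ) ^ r * (2 ^ Δ)⁻¹ * ∑ vp ∈ G.paths w, weight vp.2))) := by
          refine mul_le_mul_of_nonneg_left (h2.trans ?_) (by positivity)
          exact mul_le_mul_of_nonneg_left h3 hJ'.le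
      _ = _ := by
          field_simp
  have hkraft := G.sum_paths_weight_le
  have e : ∑ q : Equiv.Perm X × Equiv.Perm X, ∑ ξ : W → Guess X J M,
        ((univ.filter fun w => G.HeavyAcc F Δ d w q.1 q.2 (ξ w)).card : ℝ)
      = ∑ w, ∑ π : Equiv.Perm X, ∑ σ : Equiv.Perm X, ∑ ξ : W → Guess X J M,
          (if G.HeavyAcc F Δ d w π σ (ξ w) then (1 : ℝ) else 0) := by
    simp only [card_filter]
    push_cast
    rw [Fintype.sum_prod_type]
    rw [Finset.sum_comm (s := (univ : Finset W))]
    refine Finset.sum_congr rfl fun π _ => ?_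
    rw [Finset.sum_comm (s := (univ : Finset W))]
    refine Finset.sum_congr rfl fun σ _ => ?_
    rw [Finset.sum_comm]
  rw [e]
  calc _ ≤ ∑ w, ∑ π : Equiv.Perm X, (Fintype.card (W → Guess X J M) : ℝ)
        * (2 * (Fintype.card X).factorial
        * ((16 * J : ℝ) ^ r * (2 ^ Δ)⁻¹ * ∑ vp ∈ G.paths w, weight vp.2)) :=
        Finset.sum_le_sum fun w _ => Finset.sum_le_sum fun π _ => key w π
    _ = 2 * ((Fintype.card X).factorial : ℝ) ^ 2 * Fintype.card (W → Guess X J M)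
        * ((16 * J : ℝ) ^ r * (2 ^ Δ)⁻¹ * ∑ w, ∑ vp ∈ G.paths w, weight vp.2) := by
        simp only [sum_const, card_univ, Fintype.card_perm, nsmul_eq_mul]
        generalize (Fintype.card X).factorial = L
        rw [Finset.mul_sum, Finset.mul_sum]
        exact Finset.sum_congr rfl fun w _ => by ring
    _ ≤ _ := by
        gcongr

/-- The number of seeds whose output is accepted. -/
def seedCount (f : X → X) (B : W → Bool) : ℕ :=
  (univ.filter fun v => ∃ w, G.out v f = some w ∧ B w = true).card

/-- The breaker accepts every run with a light or heavy path, since a heavy path inside f needs no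
guesses. On uniform strings the light part has density at most 1/2, as there are at most half as
many seeds as strings, and the heavy part has small average density. -/
theorem sum_advantage_ge [Fintype W] (F : Frame X M K) {Δ d J r D : ℕ} (hd : K = 2 ^ d)
    (hJ : 1 ≤ J) (hD : 0 < D)
    (hout : ∀ v (ϖ : Equiv.Perm X), ∃ w, G.out v ϖ = some w)
    (hr : ∀ w, ∀ vp ∈ G.paths w, vp.2.card ≤ r) (hN8 : 8 ≤ Fintype.card X)
    (hN : 2 * r ^ 2 ≤ Fintype.card X) (hM : 2 * (r : ℝ) ^ 2 ≤ M)
    (hcrit : D * (univ.filter fun q : V × Equiv.Perm X => G.Critical Δ d q.1 q.2).card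
      ≤ 2 * Δ * (Fintype.card V * (Fintype.card X).factorial))
    (hV : 0 < Fintype.card V) (hVW : 2 * Fintype.card V ≤ Fintype.card W) :
    ((1 - 2 * (r : ℝ) ^ 2 / M) * (1 - 2 * Δ / D) - 1 / 2 - (16 * J : ℝ) ^ r * (2 ^ Δ)⁻¹)
        * (((Fintype.card X).factorial : ℝ) ^ 2 * Fintype.card (W → Guess X J M))
      ≤ ∑ q : Equiv.Perm X × Equiv.Perm X, ∑ ξ : W → Guess X J M,
        ((G.seedCount (F.fn q.1 q.2) (G.breaker F Δ d q.1 q.2 ξ) : ℝ) / Fintype.card V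
          - ((univ.filter fun w => G.breaker F Δ d q.1 q.2 ξ w = true).card : ℝ)
            / Fintype.card W) := by
  have hV' : (0 : ℝ) < Fintype.card V := by exact_mod_cast hV
  have hVW' : 2 * (Fintype.card V : ℝ) ≤ Fintype.card W := by exact_mod_cast hVW
  have hW' : (0 : ℝ) < Fintype.card W := by linarith
  have h1 := G.card_accepted_ge F hD hout hr hN8 hM hcrit
  have h2 := G.sum_card_heavyAcc_le F (Δ := Δ) hd hJ hr hN
  set gd : Equiv.Perm X × Equiv.Perm X → ℝ := fun q => ((univ.filter fun v => ∃ w,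
          G.out v (F.fn q.1 q.2) = some w ∧ ∃ vp ∈ G.paths w,
            (G.Light Δ d w vp.2 ∨ G.Heavy Δ d w vp.2) ∧
              Extends vp.2 (F.fn q.1 q.2)).card : ℝ) with hgd
  have hseed : ∀ (q : Equiv.Perm X × Equiv.Perm X) (ξ : W → Guess X J M),
      gd q ≤ (G.seedCount (F.fn q.1 q.2) (G.breaker F Δ d q.1 q.2 ξ) : ℝ) := by
    intro q ξ
    refine Nat.cast_le.mpr (card_le_card fun v hv => ?_)
    obtain ⟨w, hw, vp, hvp, hlh, hext⟩ := (mem_filter.mp hv).2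
    refine mem_filter.mpr ⟨mem_univ _, w, hw, decide_eq_true ?_⟩
    rcases hlh with h | h
    · exact Or.inl ⟨vp, hvp, h, hext⟩
    · exact Or.inr ⟨vp, hvp, h, fun p hp => Or.inl (hext p hp)⟩
  have hacc : ∀ (q : Equiv.Perm X × Equiv.Perm X) (ξ : W → Guess X J M),
      ((univ.filter fun w => G.breaker F Δ d q.1 q.2 ξ w = true).card : ℝ)
      ≤ Fintype.card V
        + ((univ.filter fun w => G.HeavyAcc F Δ d w q.1 q.2 (ξ w)).card : ℝ) := by
    intro q ξ
    have h3 : (univ.filter fun w => G.breaker F Δ d q.1 q.2 ξ w = true)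
        ⊆ (univ.filter fun w => G.LightAcc Δ d w (F.fn q.1 q.2))
          ∪ (univ.filter fun w => G.HeavyAcc F Δ d w q.1 q.2 (ξ w)) := by
      intro w hw
      rcases of_decide_eq_true (mem_filter.mp hw).2 with h | h
      · exact mem_union_left _ (mem_filter.mpr ⟨mem_univ _, h⟩)
      · exact mem_union_right _ (mem_filter.mpr ⟨mem_univ _, h⟩)
    have h4 := (card_le_card h3).trans (card_union_le _ _)
    have h5 := G.card_lightAcc_le Δ d (F.fn q.1 q.2)
    exact_mod_cast h4.trans (Nat.add_le_add_right h5 _)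
  have hlow : ∑ q : Equiv.Perm X × Equiv.Perm X, ∑ ξ : W → Guess X J M,
        (gd q / Fintype.card V - (Fintype.card V
          + ((univ.filter fun w => G.HeavyAcc F Δ d w q.1 q.2 (ξ w)).card : ℝ)) / Fintype.card W)
      ≤ ∑ q : Equiv.Perm X × Equiv.Perm X, ∑ ξ : W → Guess X J M,
        ((G.seedCount (F.fn q.1 q.2) (G.breaker F Δ d q.1 q.2 ξ) : ℝ) / Fintype.card V
          - ((univ.filter fun w => G.breaker F Δ d q.1 q.2 ξ w = true).card : ℝ)
            / Fintype.card W) := by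
    refine Finset.sum_le_sum fun q _ => Finset.sum_le_sum fun ξ _ => ?_
    have h3 := hseed q ξ
    have h4 := hacc q ξ
    gcongr
  refine le_trans ?_ hlow
  simp only [Finset.sum_sub_distrib, ← Finset.sum_div, Finset.sum_add_distrib, sum_const,
    card_univ, nsmul_eq_mul, ← Finset.mul_sum, Fintype.card_prod, Fintype.card_perm]
  clear hlow hseed hacc
  clear_value gd
  generalize ∑ q : Equiv.Perm X × Equiv.Perm X, ∑ ξ : W → Guess X J M,
        ((univ.filter fun w => G.HeavyAcc F Δ d w q.1 q.2 (ξ w)).card : ℝ) = HS at *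
  generalize (∑ i, gd i) = GS at *
  generalize hL : (Fintype.card X).factorial = L at *
  generalize (Fintype.card (W → Guess X J M)) = CW at *
  push_cast
  set A := (1 - 2 * (r : ℝ) ^ 2 / M) * (1 - 2 * Δ / D)
  set E := (16 * J : ℝ) ^ r * (2 ^ Δ)⁻¹ with hE
  have hE0 : 0 ≤ E := by positivity
  have e1 : A * (L ^ 2 * CW) ≤ CW * GS / Fintype.card V := by
    rw [le_div_iff₀ hV']
    calc A * (L ^ 2 * CW) * Fintype.card V = CW * (A * Fintype.card V * L ^ 2) := by ring
      _ ≤ _ := by gcongr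
  have e2 : (L * L * (CW * Fintype.card V) + HS) / Fintype.card W
      ≤ (1 / 2 + E) * (L ^ 2 * CW) := by
    rw [div_le_iff₀ hW']
    have h5 : 2 * (L : ℝ) ^ 2 * CW * (E * Fintype.card V) ≤ L ^ 2 * CW * E * Fintype.card W := by
      calc 2 * (L : ℝ) ^ 2 * CW * (E * Fintype.card V)
          = L ^ 2 * CW * E * (2 * Fintype.card V) := by ring
        _ ≤ _ := by gcongr
    have h6 : (L : ℝ) ^ 2 * CW * (2 * Fintype.card V) ≤ L ^ 2 * CW * Fintype.card W := by gcongr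
    nlinarith
  linarith

end LocalAlg

/-! ### Renaming a block -/

namespace Frame

variable {X : Type} [Fintype X] {M K : ℕ} (F : Frame X M K)

/-- Exchange the name of the block `a` with the unused name. -/
def rename (σ : Equiv.Perm X) (a : Fin M) : Equiv.Perm X :=
  σ * Equiv.swap (F.e none) (F.e (some a))

theorem sum_rename {R : Type} [AddCommMonoid R] (a : Fin M) (g : Equiv.Perm X → R) :
    ∑ σ, g (F.rename σ a) = ∑ σ, g σ :=
  Fintype.sum_equiv (Equiv.mulRight (Equiv.swap (F.e none) (F.e (some a)))) _ _ fun _ => rfl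

theorem rename_apply_some_self (σ : Equiv.Perm X) (a : Fin M) :
    F.rename σ a (F.e (some a)) = F.spare σ := by
  simp [rename, spare]

theorem rename_apply_some_of_ne (σ : Equiv.Perm X) {a b : Fin M} (h : b ≠ a) :
    F.rename σ a (F.e (some b)) = σ (F.e (some b)) := by
  rw [rename, Equiv.Perm.mul_apply, Equiv.swap_apply_of_ne_of_ne]
  · exact fun h' => by simpa using F.e_inj h'
  · exact fun h' => h (by simpa using F.e_inj h')

theorem fn_rename_of_eq (π σ : Equiv.Perm X) {a : Fin M} {x : X} (h : F.block π x = a) :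
    F.fn π (F.rename σ a) x = F.spare σ := by
  rw [fn, h, rename_apply_some_self]

theorem fn_rename_of_ne (π σ : Equiv.Perm X) {a : Fin M} {x : X} (h : F.block π x ≠ a) :
    F.fn π (F.rename σ a) x = F.fn π σ x := by
  rw [fn, rename_apply_some_of_ne F σ h, fn]

theorem exists_rename_iff (σ : Equiv.Perm X) (a : Fin M) (u : X) :
    (∃ o, u = F.rename σ a (F.e o)) ↔ ∃ o, u = σ (F.e o) := by
  have key : ∀ o, ∃ o', Equiv.swap (F.e none) (F.e (some a)) (F.e o) = F.e o' := by
    intro o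
    rw [Equiv.swap_apply_def]
    split_ifs
    exacts [⟨_, rfl⟩, ⟨_, rfl⟩, ⟨_, rfl⟩]
  constructor
  · rintro ⟨o, rfl⟩
    obtain ⟨o', ho'⟩ := key o
    exact ⟨o', by rw [rename, Equiv.Perm.mul_apply, ho']⟩
  · rintro ⟨o, rfl⟩
    obtain ⟨o', ho'⟩ := key o
    refine ⟨o', ?_⟩
    rw [rename, Equiv.Perm.mul_apply, ← ho', Equiv.swap_apply_self]

theorem guessed_rename_iff {J : ℕ} (π σ : Equiv.Perm X) (a : Fin M) (ξ : Guess X J M)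
    (p : X × X) : F.Guessed π (F.rename σ a) ξ p ↔ F.Guessed π σ ξ p := by
  unfold Guessed
  rw [F.exists_rename_iff]

end Frame

namespace LocalAlg

variable {V X W : Type} (G : LocalAlg V X W) [Fintype V] [Fintype X] {M K : ℕ}

/-- Renaming the block `a` creates a heavy path. -/
def NewHeavy (F : Frame X M K) (Δ d : ℕ) {J : ℕ} (w : W) (π σ : Equiv.Perm X) (z : Guess X J M)
    (a : Fin M) : Prop :=
  G.HeavyAcc F Δ d w π (F.rename σ a) z ∧ ¬ G.HeavyAcc F Δ d w π σ z

/-- As `HeavyAcc`, with the first `N` guesses. -/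
def HeavyAccBelow (F : Frame X M K) (Δ d : ℕ) {J : ℕ} (w : W) (π σ : Equiv.Perm X)
    (c : Fin J × X → Fin M) (N : ℕ) : Prop :=
  ∃ vp ∈ G.paths w, G.Heavy Δ d w vp.2 ∧ ∀ p ∈ vp.2, F.fn π σ p.1 = p.2 ∨
    ((∃ o, p.2 = σ (F.e o)) ∧ ∃ i : Fin J, (i : ℕ) < N ∧ c (i, p.2) = F.block π p.1)

theorem heavyAccBelow_mono (F : Frame X M K) {Δ d J : ℕ} {w : W} {π σ : Equiv.Perm X}
    {c : Fin J × X → Fin M} {N N' : ℕ} (h : N ≤ N') (hN : G.HeavyAccBelow F Δ d w π σ c N) :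
    G.HeavyAccBelow F Δ d w π σ c N' := by
  obtain ⟨vp, h1, h2, h3⟩ := hN
  refine ⟨vp, h1, h2, fun p hp => ?_⟩
  rcases h3 p hp with h4 | ⟨h4, i, h5, h6⟩
  · exact Or.inl h4
  · exact Or.inr ⟨h4, i, lt_of_lt_of_le h5 h, h6⟩

theorem heavyAccBelow_congr (F : Frame X M K) {Δ d J : ℕ} {w : W} {π σ : Equiv.Perm X}
    {c c' : Fin J × X → Fin M} {N : ℕ} (h : ∀ (i : Fin J) u, (i : ℕ) < N → c' (i, u) = c (i, u)) :
    G.HeavyAccBelow F Δ d w π σ c' N ↔ G.HeavyAccBelow F Δ d w π σ c N := by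
  unfold HeavyAccBelow
  refine exists_congr fun vp => and_congr_right fun _ => and_congr_right fun _ =>
    forall_congr' fun p => forall_congr' fun _ => or_congr_right (and_congr_right fun _ =>
      exists_congr fun i => and_congr_right fun hi => ?_)
  rw [h i _ hi]

/-- A block that is renamed to the unused name acts like one more guess for this name. -/
theorem heavyAccBelow_update (F : Frame X M K) {Δ d J : ℕ} {w : W} {π σ : Equiv.Perm X}
    {c : Fin J × X → Fin M} {N' : Fin J} {a : Fin M}
    (h : G.HeavyAcc F Δ d w π (F.rename σ a) (c, N')) :
    G.HeavyAccBelow F Δ d w π σ (Function.update c (N', F.spare σ) a) (N' + 1) := by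
  obtain ⟨vp, h1, h2, h3⟩ := h
  refine ⟨vp, h1, h2, fun p hp => ?_⟩
  rcases h3 p hp with h4 | h4
  · by_cases hb : F.block π p.1 = a
    · rw [F.fn_rename_of_eq π σ hb] at h4
      refine Or.inr ⟨⟨none, h4.symm⟩, N', Nat.lt_succ_self _, ?_⟩
      rw [← h4, Function.update_self, hb]
    · rw [F.fn_rename_of_ne π σ hb] at h4
      exact Or.inl h4
  · rw [F.guessed_rename_iff] at h4
    obtain ⟨h5, i, hi, h6⟩ := h4
    have hi' : (i : ℕ) < N' := hi
    refine Or.inr ⟨h5, i, Nat.lt_succ_of_lt hi', ?_⟩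
    rw [Function.update_of_ne]
    · exact h6
    intro heq
    rw [(Prod.mk.inj heq).1] at hi'
    exact lt_irrefl _ hi'

/-- If renaming creates a heavy path at threshold N', one more guess for the spare name also creates
it, with the block `a` in the role of that guess. The chance of becoming accepted by guess number N'
telescopes over N' to at most 1, so on average over the J thresholds a block matters with
probability at most 1/J. -/
theorem sum_newHeavy_le (F : Frame X M K) (Δ d J : ℕ) (w : W) (π σ : Equiv.Perm X) :
    ∑ z : Guess X J M, ((univ.filter fun a => G.NewHeavy F Δ d w π σ z a).card : ℝ)
      ≤ M * Fintype.card (Fin J × X → Fin M) := by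
  set I : (Fin J × X → Fin M) → ℕ → ℝ := fun c N =>
    if G.HeavyAccBelow F Δ d w π σ c N then 1 else 0 with hI
  have hstep : ∀ N' : Fin J, ∑ c : Fin J × X → Fin M,
      ((univ.filter fun a => G.NewHeavy F Δ d w π σ (c, N') a).card : ℝ)
      ≤ M * ∑ c : Fin J × X → Fin M, (I c (N' + 1) - I c N') := by
    intro N'
    -- A uniform block `a` put in the place of guess number N' for the spare name has the same law
    -- as that guess.
    have h1 := sum_update_swap (N', F.spare σ)
      (fun (c : Fin J × X → Fin M) (_ : Fin M) => I c (N' + 1) - I c N')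
    simp only [sum_const, card_univ, Fintype.card_fin, nsmul_eq_mul] at h1
    rw [Finset.mul_sum]
    refine le_trans ?_ h1.le
    refine Finset.sum_le_sum fun c _ => ?_
    rw [card_filter]
    push_cast
    refine Finset.sum_le_sum fun a _ => ?_
    -- The threshold is strict: guess number N' is not among the first N' guesses, so overwriting it
    -- is invisible here.
    have h2 : I (Function.update c (N', F.spare σ) a) N' = I c N' := by
      simp only [hI]
      congr 1
      rw [G.heavyAccBelow_congr F]
      intro i u hi
      rw [Function.update_of_ne]
      intro heq
      rw [(Prod.mk.inj heq).1] at hi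
      exact lt_irrefl _ hi
    by_cases hH : G.NewHeavy F Δ d w π σ (c, N') a
    · have h3 : I (Function.update c (N', F.spare σ) a) (N' + 1) = 1 :=
        if_pos (G.heavyAccBelow_update F hH.1)
      have h4 : I c N' = 0 := if_neg hH.2
      rw [if_pos hH, h2, h3, h4]
      norm_num
    · rw [if_neg hH, sub_nonneg]
      simp only [hI]
      split_ifs with h5 h6
      · exact le_refl _
      · exact absurd (G.heavyAccBelow_mono F (Nat.le_succ _) h5) h6
      · norm_num
      · exact le_refl _
  have htel : ∀ c : Fin J × X → Fin M, ∑ N' : Fin J, (I c (N' + 1) - I c N') ≤ 1 := by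
    intro c
    rw [Fin.sum_univ_eq_sum_range (fun N => I c (N + 1) - I c N), Finset.sum_range_sub]
    simp only [hI]
    split_ifs <;> norm_num
  calc _ = ∑ N' : Fin J, ∑ c : Fin J × X → Fin M,
      ((univ.filter fun a => G.NewHeavy F Δ d w π σ (c, N') a).card : ℝ) := by
        rw [Fintype.sum_prod_type, Finset.sum_comm]
    _ ≤ ∑ N' : Fin J, M * ∑ c : Fin J × X → Fin M, (I c (N' + 1) - I c N') :=
        Finset.sum_le_sum fun N' _ => hstep N'
    _ = M * ∑ c : Fin J × X → Fin M, ∑ N' : Fin J, (I c (N' + 1) - I c N') := by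
        rw [← Finset.mul_sum, Finset.sum_comm]
    _ ≤ M * ∑ _ : Fin J × X → Fin M, (1 : ℝ) := by
        gcongr with c
        exact htel c
    _ = _ := by simp

/-- If `w` was accepted, fix one accepting path: only the renaming of one of its at most r blocks
can spoil it. If `w` was rejected and a light path appears, this is a near path, and its unique pair
with the spare label determines the renamed block. -/
theorem card_breaker_rename_ne_le (F : Frame X M K) {Δ d J r : ℕ} (π σ : Equiv.Perm X)
    (ξ : W → Guess X J M) (w : W) (hr : ∀ vp ∈ G.paths w, vp.2.card ≤ r) :
    (univ.filter fun a => G.breaker F Δ d π (F.rename σ a) ξ w ≠ G.breaker F Δ d π σ ξ w ∧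
        ¬ G.NewHeavy F Δ d w π σ (ξ w) a).card
      ≤ r + (G.nearPaths F Δ d w π σ).card := by
  by_cases hB : G.LightAcc Δ d w (F.fn π σ) ∨ G.HeavyAcc F Δ d w π σ (ξ w)
  · have hB' : G.breaker F Δ d π σ ξ w = true := decide_eq_true hB
    have key : ∃ vp ∈ G.paths w, ∀ a, (∀ p ∈ vp.2, F.block π p.1 ≠ a) →
        G.LightAcc Δ d w (F.fn π (F.rename σ a)) ∨
          G.HeavyAcc F Δ d w π (F.rename σ a) (ξ w) := by
      rcases hB with ⟨vp, h1, h2, h3⟩ | ⟨vp, h1, h2, h3⟩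
      · refine ⟨vp, h1, fun a ha => Or.inl ⟨vp, h1, h2, fun p hp => ?_⟩⟩
        rw [F.fn_rename_of_ne π σ (ha p hp)]
        exact h3 p hp
      · refine ⟨vp, h1, fun a ha => Or.inr ⟨vp, h1, h2, fun p hp => ?_⟩⟩
        rw [F.fn_rename_of_ne π σ (ha p hp), F.guessed_rename_iff]
        exact h3 p hp
    obtain ⟨vp, h1, h2⟩ := key
    refine le_trans (card_le_card (t := vp.2.image fun p => F.block π p.1) ?_)
      (card_image_le.trans ((hr vp h1).trans (Nat.le_add_right _ _)))
    intro a ha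
    obtain ⟨h3, -⟩ := (mem_filter.mp ha).2
    by_contra hcon
    apply h3
    rw [hB']
    refine decide_eq_true (h2 a fun p hp heq => hcon (mem_image.mpr ⟨p, hp, heq⟩))
  · have hB' : G.breaker F Δ d π σ ξ w = false := decide_eq_false hB
    rw [not_or] at hB
    refine le_trans (card_le_card (t := (G.nearPaths F Δ d w π σ).biUnion fun vp =>
      (vp.2.filter fun p => p.2 = F.spare σ).image fun p => F.block π p.1) ?_) ?_
    · intro a ha
      obtain ⟨h3, h4⟩ := (mem_filter.mp ha).2
      rw [hB', ne_eq, Bool.not_eq_false] at h3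
      rcases of_decide_eq_true h3 with h5 | h5
      swap
      · exact absurd ⟨h5, hB.2⟩ h4
      obtain ⟨vp, hvp, hl, hext⟩ := h5
      have hex : ∃ p ∈ vp.2, F.block π p.1 = a := by
        by_contra hcon
        push Not at hcon
        refine hB.1 ⟨vp, hvp, hl, fun p hp => ?_⟩
        rw [← F.fn_rename_of_ne π σ (hcon p hp)]
        exact hext p hp
      obtain ⟨p, hp, hpa⟩ := hex
      have hps : p.2 = F.spare σ := by
        rw [← hext p hp, F.fn_rename_of_eq π σ hpa]
      rw [mem_biUnion]
      refine ⟨vp, mem_filter.mpr ⟨hvp, hl, hps ▸ mem_image_of_mem _ hp, ?_⟩,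
        mem_image.mpr ⟨p, mem_filter.mpr ⟨hp, hps⟩, hpa⟩⟩
      intro p' hp'
      obtain ⟨h6, h7⟩ := mem_filter.mp hp'
      have h8 := hext p' h6
      by_cases hb : F.block π p'.1 = a
      · rw [F.fn_rename_of_eq π σ hb] at h8
        exact absurd h8.symm h7
      · rwa [F.fn_rename_of_ne π σ hb] at h8
    · refine le_trans (card_biUnion_le_card_mul _ _ 1 fun vp hvp => ?_) (by omega)
      refine card_image_le.trans (card_le_one.mpr fun p hp p' hp' => ?_)
      obtain ⟨h1, h2⟩ := mem_filter.mp hp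
      obtain ⟨h1', h2'⟩ := mem_filter.mp hp'
      exact G.paths_injOn_snd (mem_filter.mp hvp).1 h1 h1' (h2.trans h2'.symm)

end LocalAlg

/-! ### Inverters -/

/-- An algorithm with oracles `X → X` and `W → Bool` that asks at most one question of each kind
in each step. -/
structure OracleAlg (X W Γ : Type) where
  start : X → Γ
  step : ℕ → (X → X) → (W → Bool) → Γ → Γ
  askF : Γ → Option X
  askB : Γ → Option W
  out : Γ → Option X
  congr : ∀ t f f' B B' γ, (∀ x, askF γ = some x → f' x = f x) →
    (∀ w, askB γ = some w → B' w = B w) → step t f' B' γ = step t f B γ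

namespace OracleAlg

variable {X W Γ : Type} (A : OracleAlg X W Γ)

/-- The state after `t` steps. -/
def run (f : X → X) (B : W → Bool) (y : X) : ℕ → Γ
  | 0 => A.start y
  | t + 1 => A.step t f B (run f B y t)

theorem run_congr {f f' : X → X} {B B' : W → Bool} {y : X} {q : ℕ}
    (hf : ∀ t < q, ∀ x, A.askF (A.run f B y t) = some x → f' x = f x)
    (hB : ∀ t < q, ∀ w, A.askB (A.run f B y t) = some w → B' w = B w) :
    ∀ t ≤ q, A.run f' B' y t = A.run f B y t := by
  intro t
  induction t with
  | zero => intro _; rfl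
  | succ t ih =>
    intro ht
    rw [run, run, ih (by omega)]
    exact A.congr t f f' B B' _ (hf t (by omega)) (hB t (by omega))

/-- At time `t` the algorithm asks its second oracle `w` for the first time. -/
def Fresh (f : X → X) (B : W → Bool) (y : X) (t : ℕ) (w : W) : Prop :=
  A.askB (A.run f B y t) = some w ∧ ∀ s < t, A.askB (A.run f B y s) ≠ some w

/-- Until its first query to `w` the algorithm has learned nothing about the answer at `w`. Hence
the guesses for `w` can be resampled at that time. -/
theorem fresh_congr {f : X → X} {B B' : W → Bool} {y : X} {t : ℕ} {w : W}
    (h : ∀ w', w' ≠ w → B' w' = B w') (hB : A.Fresh f B y t w) : A.Fresh f B' y t w := by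
  have h1 := A.run_congr (f := f) (f' := f) (B := B) (B' := B') (y := y) (q := t)
    (fun _ _ _ _ => rfl) (fun s hs w' hw' => h w' fun heq => hB.2 s hs (heq ▸ hw'))
  refine ⟨(h1 t le_rfl).symm ▸ hB.1, fun s hs => ?_⟩
  rw [h1 s hs.le]
  exact hB.2 s hs

end OracleAlg

namespace LocalAlg

variable {V X W Γ : Type} (G : LocalAlg V X W) [Fintype V] [Fintype X] {M K : ℕ}

theorem breaker_update_of_ne (F : Frame X M K) (Δ d : ℕ) {J : ℕ} (π σ : Equiv.Perm X)
    (ξ : W → Guess X J M) {w w' : W} (z : Guess X J M) (h : w' ≠ w) :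
    G.breaker F Δ d π σ (Function.update ξ w z) w' = G.breaker F Δ d π σ ξ w' := by
  unfold breaker
  rw [Function.update_of_ne h]

/-- After `q` steps, `A` has found a point of the block `a` from the name of `a`. -/
def Inverts (A : OracleAlg X W Γ) (F : Frame X M K) (Δ d : ℕ) {J : ℕ} (q : ℕ)
    (π σ : Equiv.Perm X) (ξ : W → Guess X J M) (a : Fin M) : Prop :=
  ∃ x', A.out (A.run (F.fn π σ) (G.breaker F Δ d π σ ξ) (σ (F.e (some a))) q) = some x' ∧
    F.block π x' = a

/-- Hybrid argument: the run on the challenge `F.spare σ` before renaming does not depend on `a`. It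
agrees with the run after renaming `a` unless a queried point lies in `a` or a breaker answer
changes. If the runs agree, the output hits at most one block. -/
theorem card_inverts_rename_le [Fintype W] (A : OracleAlg X W Γ) (F : Frame X M K)
    {Δ d J r μ : ℕ} (q : ℕ) (π σ : Equiv.Perm X) (ξ : W → Guess X J M)
    (hr : ∀ w, ∀ vp ∈ G.paths w, vp.2.card ≤ r)
    (hμ : ∀ w, (G.nearPaths F Δ d w π σ).card ≤ μ) :
    (univ.filter fun a => G.Inverts A F Δ d q π (F.rename σ a) ξ a).card
      ≤ q * (1 + r + μ) + 1 + ∑ t ∈ range q, ∑ w,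
        if A.Fresh (F.fn π σ) (G.breaker F Δ d π σ ξ) (F.spare σ) t w then
          (univ.filter fun a => G.NewHeavy F Δ d w π σ (ξ w) a).card else 0 := by
  set γ := A.run (F.fn π σ) (G.breaker F Δ d π σ ξ) (F.spare σ) with hγ
  set E₁ : ℕ → Finset (Fin M) := fun t =>
    univ.filter fun a => ∃ z, A.askF (γ t) = some z ∧ F.block π z = a with hE₁
  set E₂ : ℕ → Finset (Fin M) := fun t =>
    univ.filter fun a => ∃ w, A.askB (γ t) = some w ∧
      G.breaker F Δ d π (F.rename σ a) ξ w ≠ G.breaker F Δ d π σ ξ w ∧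
        ¬ G.NewHeavy F Δ d w π σ (ξ w) a with hE₂
  set E₃ : Finset (Fin M) := univ.filter fun a => ∃ z, A.out (γ q) = some z ∧ F.block π z = a
    with hE₃
  set E₄ : ℕ → Finset (Fin M) := fun t => (univ : Finset W).biUnion fun w =>
    if A.Fresh (F.fn π σ) (G.breaker F Δ d π σ ξ) (F.spare σ) t w then
      univ.filter fun a => G.NewHeavy F Δ d w π σ (ξ w) a else ∅ with hE₄
  have hsub : (univ.filter fun a => G.Inverts A F Δ d q π (F.rename σ a) ξ a)
      ⊆ ((range q).biUnion E₁ ∪ (range q).biUnion E₂) ∪ E₃ ∪ (range q).biUnion E₄ := by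
    intro a ha
    obtain ⟨x', h1, h2⟩ := (mem_filter.mp ha).2
    by_contra hcon
    simp only [mem_union, not_or] at hcon
    obtain ⟨⟨⟨hc1, hc2⟩, hc3⟩, hc4⟩ := hcon
    rw [F.rename_apply_some_self] at h1
    have hrun := A.run_congr (f := F.fn π σ) (f' := F.fn π (F.rename σ a))
      (B := G.breaker F Δ d π σ ξ) (B' := G.breaker F Δ d π (F.rename σ a) ξ)
      (y := F.spare σ) (q := q) ?_ ?_ q le_rfl
    · rw [hrun] at h1
      exact hc3 (mem_filter.mpr ⟨mem_univ _, x', h1, h2⟩)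
    · intro t ht x hx
      refine F.fn_rename_of_ne π σ fun hb => hc1 ?_
      exact mem_biUnion.mpr ⟨t, mem_range.mpr ht, mem_filter.mpr ⟨mem_univ _, x, hx, hb⟩⟩
    · intro t ht w hw
      by_contra hne
      by_cases hH : G.NewHeavy F Δ d w π σ (ξ w) a
      · have hex : ∃ s, A.askB (γ s) = some w := ⟨t, hw⟩
        have hle : Nat.find hex ≤ t := Nat.find_min' hex hw
        refine hc4 (mem_biUnion.mpr ⟨Nat.find hex, mem_range.mpr (by omega),
          mem_biUnion.mpr ⟨w, mem_univ _, ?_⟩⟩)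
        rw [if_pos ⟨Nat.find_spec hex, fun s hs => Nat.find_min hex hs⟩]
        exact mem_filter.mpr ⟨mem_univ _, hH⟩
      · exact hc2 (mem_biUnion.mpr ⟨t, mem_range.mpr ht,
          mem_filter.mpr ⟨mem_univ _, w, hw, hne, hH⟩⟩)
  have h1 : ((range q).biUnion E₁).card ≤ q * 1 := by
    refine (card_biUnion_le_card_mul _ _ 1 fun t _ => card_le_one.mpr fun a ha b hb => ?_).trans
      (by rw [card_range])
    obtain ⟨z, hz, rfl⟩ := (mem_filter.mp ha).2
    obtain ⟨z', hz', rfl⟩ := (mem_filter.mp hb).2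
    rw [Option.some_injective _ (hz.symm.trans hz')]
  have h2 : ((range q).biUnion E₂).card ≤ q * (r + μ) := by
    refine (card_biUnion_le_card_mul _ _ (r + μ) fun t _ => ?_).trans (by rw [card_range])
    rcases hask : A.askB (γ t) with _ | w
    · have : E₂ t = ∅ := by
        rw [hE₂]; simp [hask]
      rw [this]; simp
    · refine le_trans (card_le_card ?_) ((G.card_breaker_rename_ne_le F π σ ξ w (hr w)).trans
        (Nat.add_le_add_left (hμ w) r))
      intro a ha
      obtain ⟨w', hw', h3⟩ := (mem_filter.mp ha).2
      obtain rfl : w = w' := Option.some_injective _ (hask.symm.trans hw')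
      exact mem_filter.mpr ⟨mem_univ _, h3⟩
  have h3 : E₃.card ≤ 1 := by
    refine card_le_one.mpr fun a ha b hb => ?_
    obtain ⟨z, hz, rfl⟩ := (mem_filter.mp ha).2
    obtain ⟨z', hz', rfl⟩ := (mem_filter.mp hb).2
    rw [Option.some_injective _ (hz.symm.trans hz')]
  have h4 : ((range q).biUnion E₄).card ≤ ∑ t ∈ range q, ∑ w,
        if A.Fresh (F.fn π σ) (G.breaker F Δ d π σ ξ) (F.spare σ) t w then
          (univ.filter fun a => G.NewHeavy F Δ d w π σ (ξ w) a).card else 0 := by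
    refine card_biUnion_le.trans (Finset.sum_le_sum fun t _ => card_biUnion_le.trans
      (Finset.sum_le_sum fun w _ => ?_))
    split_ifs <;> simp
  refine (card_le_card hsub).trans ?_
  have h5 := card_union_le (((range q).biUnion E₁ ∪ (range q).biUnion E₂) ∪ E₃)
    ((range q).biUnion E₄)
  have h6 := card_union_le ((range q).biUnion E₁ ∪ (range q).biUnion E₂) E₃
  have h7 := card_union_le ((range q).biUnion E₁) ((range q).biUnion E₂)
  have h8 : q * (1 + r + μ) = q * 1 + q * (r + μ) := by ring
  omega

/-- Whether the query at time t is the first query to `w` does not depend on `ξ w`, so `ξ w` can be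
averaged separately with `sum_newHeavy_le`. At most one `w` is asked at time t. -/
theorem sum_fresh_newHeavy_le [Fintype W] (A : OracleAlg X W Γ) (F : Frame X M K)
    (Δ d : ℕ) {J : ℕ} (hJ : 1 ≤ J) (π σ : Equiv.Perm X) (t : ℕ) :
    ∑ ξ : W → Guess X J M, ∑ w,
        (if A.Fresh (F.fn π σ) (G.breaker F Δ d π σ ξ) (F.spare σ) t w then
          ((univ.filter fun a => G.NewHeavy F Δ d w π σ (ξ w) a).card : ℝ) else 0)
      ≤ M / J * Fintype.card (W → Guess X J M) := by
  have hJ' : (0 : ℝ) < J := by exact_mod_cast hJ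
  have hC : (0 : ℝ) < Fintype.card (Fin J × X → Fin M) := by
    have : Nonempty (Fin M) := ⟨⟨0, F.M_pos⟩⟩
    exact_mod_cast Fintype.card_pos
  have hZ : (Fintype.card (Guess X J M) : ℝ) = Fintype.card (Fin J × X → Fin M) * J := by
    rw [Fintype.card_prod, Fintype.card_fin]; push_cast; rfl
  set Fr : (W → Guess X J M) → W → Prop := fun ξ w =>
    A.Fresh (F.fn π σ) (G.breaker F Δ d π σ ξ) (F.spare σ) t w with hFr
  set h : W → Guess X J M → ℝ := fun w z =>
    ((univ.filter fun a => G.NewHeavy F Δ d w π σ z a).card : ℝ) with hh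
  have hinv : ∀ ξ w z, Fr (Function.update ξ w z) w ↔ Fr ξ w := by
    intro ξ w z
    constructor
    · exact A.fresh_congr fun w' hw' => (G.breaker_update_of_ne F Δ d π σ ξ z hw').symm
    · exact A.fresh_congr fun w' hw' => G.breaker_update_of_ne F Δ d π σ ξ z hw'
  have key : ∀ w, ∑ ξ : W → Guess X J M, (if Fr ξ w then h w (ξ w) else 0)
      ≤ M / J * ∑ ξ : W → Guess X J M, (if Fr ξ w then (1 : ℝ) else 0) := by
    intro w
    have h1 := sum_update_swap w
      (fun (ξ : W → Guess X J M) (_ : Guess X J M) => if Fr ξ w then h w (ξ w) else 0)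
    simp only [hinv, Function.update_self, sum_const, card_univ, nsmul_eq_mul] at h1
    rw [← Finset.mul_sum, hZ] at h1
    have h2 : ∑ ξ : W → Guess X J M, ∑ z, (if Fr ξ w then h w z else 0)
        ≤ ∑ ξ : W → Guess X J M, (M * Fintype.card (Fin J × X → Fin M) : ℝ)
          * (if Fr ξ w then (1 : ℝ) else 0) := by
      refine Finset.sum_le_sum fun ξ _ => ?_
      split_ifs
      · rw [mul_one]; exact G.sum_newHeavy_le F Δ d J w π σ
      · simp
    rw [h1, ← Finset.mul_sum] at h2
    rw [div_mul_eq_mul_div, le_div_iff₀ hJ']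
    refine le_of_mul_le_mul_left (le_trans (le_of_eq ?_) (h2.trans (le_of_eq ?_))) hC
    · ring
    · ring
  rw [Finset.sum_comm]
  refine (Finset.sum_le_sum fun w _ => key w).trans ?_
  rw [← Finset.mul_sum, Finset.sum_comm]
  refine mul_le_mul_of_nonneg_left ?_ (by positivity)
  have hone : ∀ ξ ∈ (univ : Finset (W → Guess X J M)),
      ∑ w, (if Fr ξ w then (1 : ℝ) else 0) ≤ 1 := by
    intro ξ _
    rw [sum_boole]
    have : (univ.filter fun w => Fr ξ w).card ≤ 1 := card_le_one.mpr fun w hw w' hw' =>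
      Option.some_injective _ ((mem_filter.mp hw).2.1.symm.trans (mem_filter.mp hw').2.1)
    exact_mod_cast this
  refine (Finset.sum_le_card_nsmul _ _ _ hone).trans ?_
  rw [card_univ, nsmul_eq_mul, mul_one]

end LocalAlg

/-! ### The average inversion probability -/

namespace LocalAlg

variable {V X W Γ : Type} (G : LocalAlg V X W) [Fintype V] [Fintype X] {M K : ℕ}

/-- For each block `a`, renaming permutes the choices of `σ`, so the challenge may be taken to be
the spare name. The four summands stand for direct hits and destroyed paths, new light paths, new
heavy paths, and choices with too many near paths. -/
theorem sum_inverts_le [Fintype W] (A : OracleAlg X W Γ) (F : Frame X M K)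
    {Δ d J r s : ℕ} (q : ℕ) (hd : K = 2 ^ d) (hJ : 1 ≤ J)
    (hr : ∀ w, ∀ vp ∈ G.paths w, vp.2.card ≤ r)
    (hN : 2 * (r * s + 1) ^ 2 ≤ Fintype.card X) :
    ∑ p : Equiv.Perm X × Equiv.Perm X, ∑ ξ : W → Guess X J M,
        ((univ.filter fun a => G.Inverts A F Δ d q p.1 p.2 ξ a).card : ℝ)
      ≤ M * ((q * (1 + r) + 1) / M + 2 * q * ((r * s + 2 : ℝ) ^ (2 * r) * (2 ^ Δ)⁻¹) + q / J
          + 4 * Fintype.card W * (2 ^ s)⁻¹)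
        * (((Fintype.card X).factorial : ℝ) ^ 2 * Fintype.card (W → Guess X J M)) := by
  have hM := F.M_pos'
  have hJ' : (0 : ℝ) < J := by exact_mod_cast hJ
  set Bd : ℝ := M * ((r * s + 2 : ℝ) ^ (2 * r) * (2 ^ Δ)⁻¹) with hBd
  have hBd0 : 0 ≤ Bd := by positivity
  set Bad : Equiv.Perm X × Equiv.Perm X → Prop := fun p => ∃ w,
    2 * Bd ≤ ((G.nearPaths F Δ d w p.1 p.2).card : ℝ) with hBad
  have hbadcard := G.card_nearPaths_ge_le F (Δ := Δ) hd hr hN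
  rw [← hBd] at hbadcard
  have hren : ∑ p : Equiv.Perm X × Equiv.Perm X, ∑ ξ : W → Guess X J M,
        ((univ.filter fun a => G.Inverts A F Δ d q p.1 p.2 ξ a).card : ℝ)
      = ∑ p : Equiv.Perm X × Equiv.Perm X, ∑ ξ : W → Guess X J M,
        ((univ.filter fun a => G.Inverts A F Δ d q p.1 (F.rename p.2 a) ξ a).card : ℝ) := by
    simp only [card_filter]
    push_cast
    rw [Fintype.sum_prod_type, Fintype.sum_prod_type]
    refine Finset.sum_congr rfl fun π _ => ?_
    rw [Finset.sum_comm]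
    rw [Finset.sum_comm (s := (univ : Finset (Equiv.Perm X)))]
    refine Finset.sum_congr rfl fun ξ _ => ?_
    rw [Finset.sum_comm, Finset.sum_comm (s := (univ : Finset (Equiv.Perm X)))]
    refine Finset.sum_congr rfl fun a _ => ?_
    exact (F.sum_rename a fun σ => if G.Inverts A F Δ d q π σ ξ a then (1 : ℝ) else 0).symm
  have hterm : ∀ p : Equiv.Perm X × Equiv.Perm X, ∑ ξ : W → Guess X J M,
        ((univ.filter fun a => G.Inverts A F Δ d q p.1 (F.rename p.2 a) ξ a).card : ℝ)
      ≤ (q * (1 + r + 2 * Bd) + 1 + q * (M / J)) * Fintype.card (W → Guess X J M)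
        + (if Bad p then M * (Fintype.card (W → Guess X J M) : ℝ) else 0) := by
    rintro ⟨π, σ⟩
    -- With too many near paths nothing is claimed: all `M` blocks are counted as inverted.
    by_cases hb : Bad (π, σ)
    · rw [if_pos hb]
      refine le_trans ?_ (le_add_of_nonneg_left (by positivity))
      have h1 : ∀ ξ ∈ (univ : Finset (W → Guess X J M)),
          ((univ.filter fun a => G.Inverts A F Δ d q π (F.rename σ a) ξ a).card : ℝ) ≤ M := by
        intro ξ _
        exact_mod_cast (card_le_univ _).trans (Fintype.card_fin M).le
      refine (Finset.sum_le_card_nsmul _ _ _ h1).trans ?_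
      rw [card_univ, nsmul_eq_mul, mul_comm]
    · rw [if_neg hb, add_zero]
      have hμ : ∀ w, (G.nearPaths F Δ d w π σ).card ≤ ⌊2 * Bd⌋₊ := by
        intro w
        refine Nat.le_floor ?_
        by_contra hcon
        exact hb ⟨w, (not_le.mp hcon).le⟩
      have h1 : ∀ ξ : W → Guess X J M,
          ((univ.filter fun a => G.Inverts A F Δ d q π (F.rename σ a) ξ a).card : ℝ)
          ≤ (q * (1 + r + 2 * Bd) + 1) + ∑ t ∈ range q, ∑ w,
            (if A.Fresh (F.fn π σ) (G.breaker F Δ d π σ ξ) (F.spare σ) t w then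
              ((univ.filter fun a => G.NewHeavy F Δ d w π σ (ξ w) a).card : ℝ) else 0) := by
        intro ξ
        have h2 := G.card_inverts_rename_le A F (Δ := Δ) (d := d) q π σ ξ hr hμ
        have h3 : (⌊2 * Bd⌋₊ : ℝ) ≤ 2 * Bd := Nat.floor_le (by positivity)
        refine (Nat.cast_le.mpr h2).trans ?_
        push_cast
        gcongr
      refine (Finset.sum_le_sum fun ξ _ => h1 ξ).trans ?_
      rw [Finset.sum_add_distrib, sum_const, card_univ, nsmul_eq_mul, Finset.sum_comm]
      have h4 := Finset.sum_le_card_nsmul (range q) _ _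
        fun t _ => G.sum_fresh_newHeavy_le A F Δ d hJ π σ t
      rw [card_range, nsmul_eq_mul] at h4
      calc _ ≤ (Fintype.card (W → Guess X J M) : ℝ) * (q * (1 + r + 2 * Bd) + 1)
            + q * (M / J * Fintype.card (W → Guess X J M)) := by
            gcongr
        _ = _ := by ring
  rw [hren]
  refine (Finset.sum_le_sum fun p _ => hterm p).trans ?_
  rw [Finset.sum_add_distrib, sum_const, card_univ, nsmul_eq_mul, ← sum_filter, sum_const,
    nsmul_eq_mul, Fintype.card_prod, Fintype.card_perm]
  generalize (univ.filter Bad).card = bc at *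
  generalize (Fintype.card X).factorial = L at *
  generalize (Fintype.card (W → Guess X J M)) = CW at *
  push_cast
  calc (L * L : ℝ) * ((q * (1 + r + 2 * Bd) + 1 + q * (M / J)) * CW) + bc * (M * CW)
      ≤ (L * L : ℝ) * ((q * (1 + r + 2 * Bd) + 1 + q * (M / J)) * CW)
        + (4 * Fintype.card W * (2 ^ s)⁻¹ * (L : ℝ) ^ 2) * (M * CW) := by
        gcongr
    _ = _ := by
        rw [hBd]
        field_simp
        ring

end LocalAlg

/-- Averaging: some `θ` has a large value `adv θ` and a small value `inv θ`. -/
theorem exists_large_and_small {Θ : Type} [Fintype Θ] [Nonempty Θ] (adv inv : Θ → ℝ) (η : ℝ)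
    (h1 : ∀ θ, adv θ ≤ 1) (h0 : ∀ θ, 0 ≤ inv θ) (hη : 0 ≤ η)
    (hadv : 1 / 4 * (Fintype.card Θ : ℝ) ≤ ∑ θ, adv θ)
    (hinv : ∑ θ, inv θ ≤ η * Fintype.card Θ) : ∃ θ, 1 / 8 ≤ adv θ ∧ inv θ ≤ 8 * η := by
  by_contra hcon
  push Not at hcon
  have hΘ : (0 : ℝ) < Fintype.card Θ := by exact_mod_cast Fintype.card_pos
  have hlt : ∑ θ, adv θ < ∑ _θ : Θ, (1 / 8 : ℝ) + ∑ θ : Θ, (if 1 / 8 ≤ adv θ then (1 : ℝ) else 0) := by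
    rw [← Finset.sum_add_distrib]
    refine Finset.sum_lt_sum_of_nonempty univ_nonempty fun θ _ => ?_
    split_ifs with h
    · linarith [h1 θ]
    · linarith
  rw [sum_boole, sum_const, card_univ, nsmul_eq_mul] at hlt
  set S := univ.filter fun θ => 1 / 8 ≤ adv θ
  have hS : (Fintype.card Θ : ℝ) / 8 < S.card := by linarith
  have hSne : S.Nonempty := by
    rw [← card_pos]
    have : (0 : ℝ) < S.card := lt_trans (by positivity) hS
    exact_mod_cast this
  have h2 : ∑ θ ∈ S, (8 * η) < ∑ θ ∈ S, inv θ :=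
    Finset.sum_lt_sum_of_nonempty hSne fun θ hθ => hcon θ (mem_filter.mp hθ).2
  have h3 : ∑ θ ∈ S, inv θ ≤ ∑ θ, inv θ := Finset.sum_le_univ_sum_of_nonneg h0
  rw [sum_const, nsmul_eq_mul] at h2
  nlinarith

theorem exists_frame {X : Type} [Fintype X] {n d : ℕ} (hX : Fintype.card X = 2 ^ n)
    (hd : 1 ≤ d) (hdn : d ≤ n) : Nonempty (Frame X (2 ^ (n - d)) (2 ^ d)) := by
  have hmul : 2 ^ (n - d) * 2 ^ d = Fintype.card X := by
    rw [hX, ← pow_add, Nat.sub_add_cancel hdn]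
  have hε : Nonempty (X ≃ Fin (2 ^ (n - d)) × Fin (2 ^ d)) := by
    refine ⟨Fintype.equivOfCardEq ?_⟩
    rw [Fintype.card_prod, Fintype.card_fin, Fintype.card_fin, hmul]
  obtain ⟨ε⟩ := hε
  have he : Nonempty (Option (Fin (2 ^ (n - d))) ↪ X) := by
    rw [Function.Embedding.nonempty_iff_card_le, Fintype.card_option, Fintype.card_fin, hX]
    -- Here 1 ≤ d is used: it leaves room for the spare name besides those of the blocks.
    exact Nat.pow_lt_pow_right (by norm_num) (by omega)
  obtain ⟨e⟩ := he
  refine ⟨⟨fun x => (ε x).1, e, e.injective, fun b => ?_, hmul, by positivity, by positivity⟩⟩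
  have : (univ.filter fun x => (ε x).1 = b) = univ.image fun k => ε.symm (b, k) := by
    ext x
    simp only [mem_filter, mem_univ, true_and, mem_image]
    constructor
    · rintro rfl; exact ⟨(ε x).2, by simp⟩
    · rintro ⟨k, rfl⟩; simp
  rw [this, card_image_of_injective _ (fun k k' h => by simpa using h), card_univ,
    Fintype.card_fin]

/-- The bound on the inversion probability. -/
def invBound (n r Δ J s q w : ℕ) : ℝ :=
  (q * (1 + r) + 1) / 2 ^ (n / 2) + 2 * q * ((r * s + 2 : ℝ) ^ (2 * r) * (2 ^ Δ)⁻¹) + q / J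
    + 4 * w * (2 ^ s)⁻¹

/-- The lower bound for one security parameter: a regular function and a breaker with which the
inverters, with random coins from `Ω`, are useless. -/
theorem exists_regular_breaker {V X W Γ Ω : Type} [Fintype V] [Fintype X] [Fintype W] [Fintype Ω]
    [Nonempty Ω] [Nonempty V] (G : LocalAlg V X W) (A : Ω → OracleAlg X W Γ)
    {n r Δ J s q : ℕ} (hX : Fintype.card X = 2 ^ n) (hn : 3 ≤ n) (hJ : 1 ≤ J)
    (hout : ∀ v (ϖ : Equiv.Perm X), ∃ w, G.out v ϖ = some w)
    (hr : ∀ v (ϖ : Equiv.Perm X), (G.Q v ϖ).card ≤ r)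
    (hN : 2 * (r * s + 1) ^ 2 ≤ 2 ^ n) (hs : 1 ≤ s)
    (hVW : 2 * Fintype.card V ≤ Fintype.card W)
    (hr2 : 32 * r ^ 2 ≤ 2 ^ (n / 2)) (hΔ : 32 * Δ ≤ n / 2)
    (hJr : 16 * (16 * J) ^ r ≤ 2 ^ Δ) :
    ∃ (f : X → X) (B : W → Bool),
      (∀ x x', (univ.filter fun z => f z = f x).card = (univ.filter fun z => f z = f x').card) ∧
      1 / 8 ≤ (G.seedCount f B : ℝ) / Fintype.card V
        - ((univ.filter fun w => B w = true).card : ℝ) / Fintype.card W ∧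
      (∑ ω : Ω, ∑ x, if ∃ x', (A ω).out ((A ω).run f B (f x) q) = some x' ∧ f x' = f x then
        (1 : ℝ) else 0) / (Fintype.card Ω * Fintype.card X)
        ≤ 8 * invBound n r Δ J s q (Fintype.card W) := by
  -- With d at most n/2 there are many values to average over, while M = 2^(n-d) stays at least
  -- 2^(n/2).
  have hD : 1 ≤ n / 2 := by omega
  obtain ⟨d, hd, hcrit⟩ := G.exists_few_critical Δ (n / 2) hD
  rw [mem_Icc] at hd
  obtain ⟨F⟩ := exists_frame hX hd.1 (by omega)
  have hVpos : 0 < Fintype.card V := Fintype.card_pos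
  have hM := F.M_pos'
  have hK := F.K_pos'
  have hJ' : (0 : ℝ) < J := by exact_mod_cast hJ
  have hMge : (2 : ℝ) ^ (n / 2) ≤ ((2 ^ (n - d) : ℕ) : ℝ) := by
    push_cast
    exact pow_le_pow_right₀ (by norm_num) (by omega)
  have hr' : ∀ w, ∀ vp ∈ G.paths w, vp.2.card ≤ r := by
    intro w vp hvp
    obtain ⟨ϖ, h1, -⟩ := G.mem_paths.mp hvp
    rw [← h1, G.card_path]
    exact hr vp.1 ϖ
  have hN8 : 8 ≤ Fintype.card X := by
    rw [hX]
    calc 8 = 2 ^ 3 := by norm_num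
      _ ≤ 2 ^ n := Nat.pow_le_pow_right (by norm_num) hn
  have hNr : 2 * r ^ 2 ≤ Fintype.card X := by
    rw [hX]
    refine le_trans ?_ hN
    have : r ≤ r * s + 1 := by nlinarith
    gcongr
  have hr2' : 32 * (r : ℝ) ^ 2 ≤ 2 ^ (n / 2) := by exact_mod_cast hr2
  set MM : ℝ := ((2 ^ (n - d) : ℕ) : ℝ) with hMM
  have hadv := G.sum_advantage_ge F (Δ := Δ) (d := d) (J := J) (r := r) (D := n / 2) rfl hJ hD hout
    hr' hN8 hNr (by nlinarith) hcrit hVpos hVW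
  rw [← hMM] at hadv
  set η : ℝ := invBound n r Δ J s q (Fintype.card W) with hη
  have hη0 : 0 ≤ η := by
    rw [hη]; unfold invBound; positivity
  have hΘne : Nonempty ((Equiv.Perm X × Equiv.Perm X) × (W → Guess X J (2 ^ (n - d)))) :=
    ⟨⟨(1, 1), fun _ => (fun _ => ⟨0, F.M_pos⟩, ⟨0, hJ⟩)⟩⟩
  have hcardΘ : (Fintype.card ((Equiv.Perm X × Equiv.Perm X) × (W → Guess X J (2 ^ (n - d)))) : ℝ)
      = ((Fintype.card X).factorial : ℝ) ^ 2 * Fintype.card (W → Guess X J (2 ^ (n - d))) := by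
    rw [Fintype.card_prod, Fintype.card_prod, Fintype.card_perm]
    generalize (Fintype.card X).factorial = L
    push_cast
    ring
  have hXr : (Fintype.card X : ℝ) = MM * ((2 ^ d : ℕ) : ℝ) := F.card_eq
  have hΩ : (0 : ℝ) < Fintype.card Ω := by exact_mod_cast Fintype.card_pos
  set inv : (Equiv.Perm X × Equiv.Perm X) × (W → Guess X J (2 ^ (n - d))) → ℝ := fun θ =>
    (∑ ω : Ω, ∑ x, if ∃ x', (A ω).out ((A ω).run (F.fn θ.1.1 θ.1.2)
      (G.breaker F Δ d θ.1.1 θ.1.2 θ.2) (F.fn θ.1.1 θ.1.2 x) q) = some x' ∧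
        F.fn θ.1.1 θ.1.2 x' = F.fn θ.1.1 θ.1.2 x then
        (1 : ℝ) else 0) / (Fintype.card Ω * Fintype.card X) with hinvdef
  -- All blocks have size K, so inverting at a uniform point means inverting at the name of a
  -- uniform block.
  have hinv_eq : ∀ θ, inv θ = (∑ ω : Ω,
      ((univ.filter fun a => G.Inverts (A ω) F Δ d q θ.1.1 θ.1.2 θ.2 a).card : ℝ))
        / (Fintype.card Ω * MM) := by
    intro θ
    simp only [hinvdef]
    rw [hXr, ← mul_assoc, ← div_div]
    rw [div_eq_iff hK.ne', div_mul_eq_mul_div]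
    congr 1
    rw [Finset.sum_mul]
    refine Finset.sum_congr rfl fun ω _ => ?_
    rw [card_filter]
    push_cast
    have h1 := F.sum_block θ.1.1 (fun a => if G.Inverts (A ω) F Δ d q θ.1.1 θ.1.2 θ.2 a then
      (1 : ℝ) else 0)
    rw [nsmul_eq_mul] at h1
    push_cast at h1
    rw [mul_comm, ← h1]
    refine Finset.sum_congr rfl fun x _ => ?_
    congr 1
    simp only [F.fn_eq_iff]
    rfl
  have hsuminv : ∑ θ, inv θ ≤ η * Fintype.card
      ((Equiv.Perm X × Equiv.Perm X) × (W → Guess X J (2 ^ (n - d)))) := by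
    simp only [hinv_eq, ← Finset.sum_div]
    rw [div_le_iff₀ (by positivity), Finset.sum_comm]
    have h1 : ∀ ω ∈ (univ : Finset Ω), ∑ θ : (Equiv.Perm X × Equiv.Perm X) ×
        (W → Guess X J (2 ^ (n - d))),
        ((univ.filter fun a => G.Inverts (A ω) F Δ d q θ.1.1 θ.1.2 θ.2 a).card : ℝ)
        ≤ MM * η * Fintype.card
          ((Equiv.Perm X × Equiv.Perm X) × (W → Guess X J (2 ^ (n - d)))) := by
      intro ω _
      rw [Fintype.sum_prod_type, hcardΘ]
      refine (G.sum_inverts_le (A ω) F (Δ := Δ) (s := s) q rfl hJ hr' (by rw [hX]; exact hN)).trans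
        ?_
      rw [← hMM, hη]
      unfold invBound
      refine mul_le_mul_of_nonneg_right ?_ (by positivity)
      refine mul_le_mul_of_nonneg_left ?_ hM.le
      have : ((q : ℝ) * (1 + r) + 1) / MM ≤ (q * (1 + r) + 1) / 2 ^ (n / 2) := by
        gcongr
      linarith
    refine (Finset.sum_le_card_nsmul _ _ _ h1).trans (le_of_eq ?_)
    rw [card_univ, nsmul_eq_mul]
    ring
  have hadv' : 1 / 4 * (Fintype.card
      ((Equiv.Perm X × Equiv.Perm X) × (W → Guess X J (2 ^ (n - d)))) : ℝ)
      ≤ ∑ θ : (Equiv.Perm X × Equiv.Perm X) × (W → Guess X J (2 ^ (n - d))),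
        ((G.seedCount (F.fn θ.1.1 θ.1.2) (G.breaker F Δ d θ.1.1 θ.1.2 θ.2) : ℝ) / Fintype.card V
        - ((univ.filter fun w => G.breaker F Δ d θ.1.1 θ.1.2 θ.2 w = true).card : ℝ)
          / Fintype.card W) := by
    rw [Fintype.sum_prod_type, hcardΘ]
    refine le_trans ?_ hadv
    refine mul_le_mul_of_nonneg_right ?_ (by positivity)
    have hD' : (0 : ℝ) < ((n / 2 : ℕ) : ℝ) := by exact_mod_cast hD
    have h1 : 2 * (r : ℝ) ^ 2 / MM ≤ 1 / 16 := by
      rw [div_le_iff₀ hM]; linarith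
    have h2 : 2 * (Δ : ℝ) / ((n / 2 : ℕ) : ℝ) ≤ 1 / 16 := by
      rw [div_le_iff₀ hD']
      have : (32 * Δ : ℝ) ≤ ((n / 2 : ℕ) : ℝ) := by exact_mod_cast hΔ
      linarith
    have h3 : (16 * J : ℝ) ^ r * (2 ^ Δ)⁻¹ ≤ 1 / 16 := by
      have : 16 * (16 * J : ℝ) ^ r ≤ 2 ^ Δ := by exact_mod_cast hJr
      rw [← div_eq_mul_inv, div_le_iff₀ (by positivity)]
      linarith
    -- The average advantage is at least 225/256 - 1/2 - 1/16, which exceeds 1/4.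
    have h4 : (15 / 16 : ℝ) * (15 / 16) ≤ (1 - 2 * (r : ℝ) ^ 2 / MM)
        * (1 - 2 * (Δ : ℝ) / ((n / 2 : ℕ) : ℝ)) :=
      mul_le_mul (by linarith) (by linarith) (by norm_num) (by linarith)
    linarith
  have hle1 : ∀ θ : (Equiv.Perm X × Equiv.Perm X) × (W → Guess X J (2 ^ (n - d))),
      (G.seedCount (F.fn θ.1.1 θ.1.2) (G.breaker F Δ d θ.1.1 θ.1.2 θ.2) : ℝ) / Fintype.card V
        - ((univ.filter fun w => G.breaker F Δ d θ.1.1 θ.1.2 θ.2 w = true).card : ℝ)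
          / Fintype.card W ≤ 1 := by
    intro θ
    have h3 : (G.seedCount (F.fn θ.1.1 θ.1.2) (G.breaker F Δ d θ.1.1 θ.1.2 θ.2) : ℝ)
        / Fintype.card V ≤ 1 := by
      rw [div_le_one (by exact_mod_cast hVpos)]
      exact_mod_cast card_le_univ _
    have h4 : 0 ≤ ((univ.filter fun w => G.breaker F Δ d θ.1.1 θ.1.2 θ.2 w = true).card : ℝ)
          / Fintype.card W := by positivity
    linarith
  have hinv0 : ∀ θ, 0 ≤ inv θ := by
    intro θ
    simp only [hinvdef]
    refine div_nonneg (Finset.sum_nonneg fun ω _ => Finset.sum_nonneg fun x _ => ?_)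
      (by positivity)
    split_ifs <;> norm_num
  obtain ⟨θ, h1, h2⟩ := exists_large_and_small _ inv η hle1 hinv0 hη0 hadv' hsuminv
  refine ⟨F.fn θ.1.1 θ.1.2, G.breaker F Δ d θ.1.1 θ.1.2 θ.2, fun x x' => ?_, h1, h2⟩
  simp only [F.fn_eq_iff, F.card_block]

/-! ### Runs of oracle machines -/

theorem asks_unique {ι : Type} (M : OracleMachine ι) {c : M.Config} {o o' : ι}
    {s s' : List Bool} (h : M.Asks c o s) (h' : M.Asks c o' s') : o = o' ∧ s = s' := by
  obtain ⟨i, q, h1, rfl⟩ := h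
  obtain ⟨i', q', h1', rfl⟩ := h'
  rw [h1] at h1'
  cases h1'
  exact ⟨rfl, rfl⟩

theorem machine_step_congr {ι : Type} (M : OracleMachine ι) {O O' : ι → List Bool → List Bool}
    (b : Bool) {c : M.Config} (h : ∀ o s, M.Asks c o s → O' o s = O o s) :
    M.step O' b c = M.step O b c := by
  unfold OracleMachine.step
  split <;> try rfl
  rename_i o i q hq
  rw [h o _ ⟨i, q, hq, rfl⟩]

theorem machine_run_congr {ι : Type} (M : OracleMachine ι) {O O' : ι → List Bool → List Bool}
    {ω ω' : ℕ → Bool} {input : List (List Bool)} {T : ℕ}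
    (hO : ∀ t < T, ∀ o s, M.Asks (M.run O ω input t) o s → O' o s = O o s)
    (hω : ∀ t < T, ω' t = ω t) : ∀ t ≤ T, M.run O' ω' input t = M.run O ω input t := by
  intro t
  induction t with
  | zero => intro _; rfl
  | succ t ih =>
    intro ht
    rw [OracleMachine.run, OracleMachine.run, ih (by omega), hω t (by omega)]
    exact machine_step_congr M _ (hO t (by omega))

theorem machine_run_congr' {ι : Type} (M : OracleMachine ι) {O O' : ι → List Bool → List Bool}
    {ω : ℕ → Bool} {input : List (List Bool)}
    (hO : ∀ t, ∀ o s, M.Asks (M.run O ω input t) o s → O' o s = O o s) :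
    M.run O' ω input = M.run O ω input :=
  funext fun t => machine_run_congr M (T := t) (fun t _ => hO t) (fun _ _ => rfl) t le_rfl

theorem run_eq_of_halts {ι : Type} (M : OracleMachine ι) {O : ι → List Bool → List Bool}
    {ω : ℕ → Bool} {input : List (List Bool)} {t t' : ℕ} (h : M.HaltsWithin O ω input t)
    (ht : t ≤ t') : M.run O ω input t' = M.run O ω input t := by
  induction t', ht using Nat.le_induction with
  | base => rfl
  | succ t' ht ih =>
    rw [OracleMachine.run, ih]
    unfold OracleMachine.HaltsWithin at h
    unfold OracleMachine.step
    rw [h]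

theorem haltsWithin_mono {ι : Type} (M : OracleMachine ι) {O : ι → List Bool → List Bool}
    {ω : ℕ → Bool} {input : List (List Bool)} {t t' : ℕ} (h : M.HaltsWithin O ω input t)
    (ht : t ≤ t') : M.HaltsWithin O ω input t' := by
  unfold OracleMachine.HaltsWithin
  rw [run_eq_of_halts M h ht]
  exact h

theorem outputs_iff_of_halts {ι : Type} (M : OracleMachine ι) {O : ι → List Bool → List Bool}
    {ω : ℕ → Bool} {input : List (List Bool)} {t : ℕ} (h : M.HaltsWithin O ω input t)
    (out : List Bool) : M.Outputs O ω input out ↔ (M.run O ω input t).stack 0 = out := by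
  constructor
  · rintro ⟨t', h1, h2⟩
    rcases le_total t t' with h3 | h3
    · rw [← run_eq_of_halts M h h3]; exact h2
    · rw [run_eq_of_halts M h1 h3]; exact h2
  · intro h1
    exact ⟨t, h, h1⟩

theorem outputs_unique {ι : Type} (M : OracleMachine ι) {O : ι → List Bool → List Bool}
    {ω : ℕ → Bool} {input : List (List Bool)} {out out' : List Bool}
    (h : M.Outputs O ω input out) (h' : M.Outputs O ω input out') : out = out' := by
  obtain ⟨t, h1, h2⟩ := h
  rw [outputs_iff_of_halts M h1] at h'
  exact h2.symm.trans h'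

theorem outputs_congr {ι : Type} (M : OracleMachine ι) {O O' : ι → List Bool → List Bool}
    {ω ω' : ℕ → Bool} {input : List (List Bool)}
    (h : M.run O' ω' input = M.run O ω input) (out : List Bool) :
    M.Outputs O' ω' input out ↔ M.Outputs O ω input out := by
  unfold OracleMachine.Outputs OracleMachine.OutputsWithin OracleMachine.HaltsWithin
  rw [h]

/-! ### Families that are trivial outside of one security parameter -/

/-- The family that is `F` for the security parameter `k` and the identity for all others. -/
def single {n : ℕ → ℕ} (k : ℕ) (F : Bits (n k) → Bits (n k)) : Family n :=
  Function.update (fun _ => id) k F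

theorem single_self {n : ℕ → ℕ} (k : ℕ) (F : Bits (n k) → Bits (n k)) : single k F k = F :=
  Function.update_self _ _ _

theorem single_of_ne {n : ℕ → ℕ} {k k' : ℕ} (F : Bits (n k) → Bits (n k)) (h : k' ≠ k) :
    single k F k' = id :=
  Function.update_of_ne h _ _

/-- The breaker that is `B` for the security parameter `k` and rejects for all others. -/
def singleBreaker {m' : ℕ → ℕ} (k : ℕ) (B : Bits (m' k) → Bool) : Breaker m' :=
  Function.update (fun _ _ => false) k B

theorem singleBreaker_self {m' : ℕ → ℕ} (k : ℕ) (B : Bits (m' k) → Bool) :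
    singleBreaker k B k = B :=
  Function.update_self _ _ _

theorem singleBreaker_of_ne {m' : ℕ → ℕ} {k k' : ℕ} (B : Bits (m' k) → Bool) (h : k' ≠ k) :
    singleBreaker k B k' = fun _ => false :=
  Function.update_of_ne h _ _

/-- All fibers over image points have the same size. -/
def RegularFun {X : Type} [Fintype X] (F : X → X) : Prop :=
  ∀ x x', (univ.filter fun z => F z = F x).card = (univ.filter fun z => F z = F x').card

theorem regularFun_iff {X : Type} [Fintype X] (F : X → X) : RegularFun F ↔
    ∀ x x', Nat.card {z // F z = F x} = Nat.card {z // F z = F x'} := by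
  unfold RegularFun
  simp only [Nat.card_eq_fintype_card, Fintype.card_subtype]

theorem regularFun_of_injective {X : Type} [Fintype X] {F : X → X} (h : Function.Injective F) :
    RegularFun F := by
  intro x x'
  simp only [h.eq_iff]
  rw [card_eq_one.mpr ⟨x, by ext; simp⟩, card_eq_one.mpr ⟨x', by ext; simp⟩]

theorem family_regular_iff {n : ℕ → ℕ} (f : Family n) : f.Regular ↔ ∀ k, RegularFun (f k) := by
  simp only [regularFun_iff]
  rfl

theorem single_regular {n : ℕ → ℕ} {k : ℕ} {F : Bits (n k) → Bits (n k)} (h : RegularFun F) :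
    (single k F : Family n).Regular := by
  rw [family_regular_iff]
  intro k'
  by_cases hk : k' = k
  · subst hk; rw [single_self]; exact h
  · rw [single_of_ne F hk]; exact regularFun_of_injective Function.injective_id

theorem owfOracle_congr {n : ℕ → ℕ} {f f' : Family n} {s : List Bool}
    (h : ∀ k x, decodeCall n s = some ⟨k, x⟩ → f' k x = f k x) : owfOracle f' s = owfOracle f s := by
  unfold owfOracle
  split
  · rfl
  · rename_i k x hk
    rw [h k x hk]

theorem breakerOracle_congr {m' : ℕ → ℕ} {B B' : Breaker m'} {s : List Bool}
    (h : ∀ k x, decodeCall m' s = some ⟨k, x⟩ → B' k x = B k x) :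
    breakerOracle B' s = breakerOracle B s := by
  unfold breakerOracle
  split
  · rfl
  · rename_i k x hk
    rw [h k x hk]

theorem decodeCall_inj {n : ℕ → ℕ} {s : List Bool} {k : ℕ} {x x' : Bits (n k)}
    (h : decodeCall n s = some ⟨k, x⟩) (h' : decodeCall n s = some ⟨k, x'⟩) : x = x' := by
  rw [h] at h'
  simpa using h'

/-! ### The generator as a query algorithm -/

/-- An element with the property `P`, if there is one. -/
def pick {α : Type} (P : α → Prop) : Option α := if h : ∃ w, P w then some h.choose else none

theorem pick_eq_some_iff {α : Type} {P : α → Prop} (hP : ∀ w w', P w → P w' → w = w') {w : α} :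
    pick P = some w ↔ P w := by
  unfold pick
  split_ifs with h
  · rw [Option.some_inj]
    constructor
    · rintro rfl; exact h.choose_spec
    · intro hw; exact hP _ _ h.choose_spec hw
  · constructor
    · intro h'; cases h'
    · exact fun hw => absurd ⟨w, hw⟩ h

/-- The construction, for the security parameter `k`, as a query algorithm. -/
def genAlg (C : Construction) (n : ℕ → ℕ) (k : ℕ) :
    LocalAlg (Bits (C.m k)) (Bits (n k)) (Bits (C.m' k)) where
  Q v F := univ.filter fun x => ∃ t o s, C.g.Asks (C.gRun (single k F : Family n) k v t) o s ∧
    decodeCall n s = some ⟨k, x⟩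
  out v F := pick fun w => C.GEval (single k F : Family n) k v w
  congr v F F' h := by
    have hrun : ∀ t, C.gRun (single k F' : Family n) k v t = C.gRun (single k F) k v t := by
      intro t
      unfold Construction.gRun
      rw [machine_run_congr' C.g (O := fun _ => owfOracle (single k F : Family n))]
      intro t o s hs
      refine owfOracle_congr fun k' x hx => ?_
      by_cases hk : k' = k
      · subst hk
        rw [single_self, single_self]
        exact h x (mem_filter.mpr ⟨mem_univ _, t, o, s, hs, hx⟩)
      · rw [single_of_ne F hk, single_of_ne F' hk]
    have hev : (fun w => C.GEval (single k F' : Family n) k v w)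
        = fun w => C.GEval (single k F) k v w :=
      funext fun w => propext (outputs_congr C.g (funext hrun) _)
    simp only [hrun, hev, and_self]

theorem geval_unique (C : Construction) {n : ℕ → ℕ} {f : Family n} {k : ℕ} {v : Bits (C.m k)}
    {w w' : Bits (C.m' k)} (h : C.GEval f k v w) (h' : C.GEval f k v w') : w = w' :=
  List.Vector.toList_injective (outputs_unique C.g h h')

theorem genAlg_out_eq_some_iff (C : Construction) {n : ℕ → ℕ} {k : ℕ} {v : Bits (C.m k)}
    {F : Bits (n k) → Bits (n k)} {w : Bits (C.m' k)} :
    (genAlg C n k).out v F = some w ↔ C.GEval (single k F : Family n) k v w := by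
  exact pick_eq_some_iff fun w w' h h' => geval_unique C h h'

/-- The generator at `k` consults only `f k`, so changing the other members to the identity does not
affect the run. -/
theorem gRun_eq_single (C : Construction) {n : ℕ → ℕ} (hsp : C.SecurityParameterRestricted n)
    {f : Family n} (hf : f.Regular) (k : ℕ) (v : Bits (C.m k)) :
    C.gRun (single k (f k) : Family n) k v = C.gRun f k v := by
  unfold Construction.gRun
  refine machine_run_congr' C.g fun t o s hs => owfOracle_congr fun k' x hx => ?_
  obtain rfl := hsp.construction f hf k v t o s k' x hs hx
  rw [single_self]

theorem geval_iff_single (C : Construction) {n : ℕ → ℕ} (hsp : C.SecurityParameterRestricted n)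
    {f : Family n} (hf : f.Regular) (k : ℕ) (v : Bits (C.m k)) (w : Bits (C.m' k)) :
    C.GEval f k v w ↔ (genAlg C n k).out v (f k) = some w := by
  rw [genAlg_out_eq_some_iff]
  exact (outputs_congr C.g (gRun_eq_single C hsp hf k v) _).symm

theorem genAlg_exists_out (C : Construction) {n : ℕ → ℕ} (hC : C.IsFullyBlackBox n) (k : ℕ)
    (v : Bits (C.m k)) {F : Bits (n k) → Bits (n k)} (hF : RegularFun F) :
    ∃ w, (genAlg C n k).out v F = some w := by
  obtain ⟨c, hc⟩ := hC.construction (single k F) (single_regular hF)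
  obtain ⟨w, hw⟩ := hc k v
  exact ⟨w, (genAlg_out_eq_some_iff C).mpr ⟨_, hw⟩⟩

/-- One configuration asks at most one string, so distinct queried points belong to distinct steps.
-/
theorem genAlg_card_le (C : Construction) {n r : ℕ → ℕ} (hcalls : C.CallsAtMost n r) (k : ℕ)
    (v : Bits (C.m k)) {F : Bits (n k) → Bits (n k)} (hF : RegularFun F) :
    ((genAlg C n k).Q v F).card ≤ r k := by
  have h := hcalls (single k F) (single_regular hF) k v
  set T : Set ℕ := {t : ℕ | ∃ o s x, C.g.Asks (C.gRun (single k F : Family n) k v t) o s ∧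
      decodeCall n s = some ⟨k, x⟩} with hT
  have hx : ∀ x ∈ (genAlg C n k).Q v F, ∃ t o s,
      C.g.Asks (C.gRun (single k F : Family n) k v t) o s ∧ decodeCall n s = some ⟨k, x⟩ :=
    fun x hx => (mem_filter.mp hx).2
  choose! t o s h1 h2 using hx
  have hinj : Set.InjOn t ((genAlg C n k).Q v F : Set (Bits (n k))) := by
    intro x hx x' hx' heq
    have h3 := h1 x hx
    have h3' := h1 x' hx'
    rw [heq] at h3
    obtain ⟨-, h4⟩ := asks_unique C.g h3 h3'
    have h5 := h2 x hx
    rw [h4] at h5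
    exact decodeCall_inj h5 (h2 x' hx')
  have h3 : ((genAlg C n k).Q v F : Set (Bits (n k))).encard ≤ T.encard := by
    rw [← hinj.encard_image]
    refine Set.encard_le_encard ?_
    rintro _ ⟨x, hx, rfl⟩
    exact ⟨o x, s x, x, h1 x hx, h2 x hx⟩
  rw [Set.encard_coe_eq_coe_finsetCard] at h3
  exact_mod_cast h3.trans h

theorem uniformProb_eq {α : Type} [Fintype α] (P : α → Prop) :
    uniformProb P = ((univ.filter P).card : ℝ) / Fintype.card α := by
  unfold uniformProb
  rw [Nat.card_eq_fintype_card, Fintype.card_subtype]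

theorem advantage_eq (C : Construction) {n : ℕ → ℕ} (hsp : C.SecurityParameterRestricted n)
    {f : Family n} (hf : f.Regular) (B : Breaker C.m') (k : ℕ) :
    C.advantage f B k = ((genAlg C n k).seedCount (f k) (B k) : ℝ) / Fintype.card (Bits (C.m k))
      - ((univ.filter fun w => B k w = true).card : ℝ) / Fintype.card (Bits (C.m' k)) := by
  unfold Construction.advantage LocalAlg.seedCount
  simp only [uniformProb_eq, geval_iff_single C hsp hf]
  congr!

/-- The output length of the generator is bounded by its running time. -/
theorem output_length_le (C : Construction) {n : ℕ → ℕ} (hC : C.IsFullyBlackBox n)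
    (hsp : C.SecurityParameterRestricted n) :
    ∃ c : ℕ, ∀ k, C.m' k ≤ k + n k + (k ^ c + c) := by
  have hreg : Family.Regular (fun _ => id : Family n) :=
    (family_regular_iff _).mpr fun k => regularFun_of_injective Function.injective_id
  obtain ⟨c, hc⟩ := hC.construction _ hreg
  refine ⟨c, fun k => ?_⟩
  have v : Bits (C.m k) := List.Vector.replicate _ false
  obtain ⟨w, -, hw⟩ := hc k v
  -- A push adds one bit, and a query replaces the stack by an answer. The security parameter
  -- restriction ensures that nonempty answers have length `n k`, not `n k'` for some large `k'`.
  have hlen : ∀ t, ((C.gRun (fun _ => id : Family n) k v t).stack 0).length ≤ k + n k + t := by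
    intro t
    induction t with
    | zero => simp [Construction.gRun, OracleMachine.run, OracleMachine.init, unary]
    | succ t ih =>
      have hask := hsp.construction _ hreg k v t
      unfold Construction.gRun at *
      rw [OracleMachine.run]
      generalize C.g.run (fun _ => owfOracle (fun _ => id : Family n)) noCoins
        [unary k, v.toList] t = cf at *
      unfold OracleMachine.step
      split
      · omega
      · rename_i i b q _
        by_cases hi : i = 0
        · subst hi; simp; omega
        · simp [Function.update_of_ne (Ne.symm hi)]; omega
      · rename_i i q _
        by_cases hi : i = 0
        · subst hi; simp; omega
        · simp [Function.update_of_ne (Ne.symm hi)]; omega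
      · simp; omega
      · rename_i o i q hq
        by_cases hi : i = 0
        · subst hi
          simp only [Function.update_self]
          unfold owfOracle
          split
          · simp
          · rename_i k' x hx
            obtain rfl := hask o _ k' x ⟨0, q, hq, rfl⟩ hx
            simp; omega
        · simp [Function.update_of_ne (Ne.symm hi)]; omega
  have h1 := hlen (k ^ c + c)
  unfold Construction.gRun at h1
  rw [hw] at h1
  simpa using h1

/-! ### The reduction as an oracle algorithm -/

/-- The reduction, for the security parameter `k` and the coins `ω`. -/
def redAlg (C : Construction) (n : ℕ → ℕ) (k e : ℕ) (ω : ℕ → Bool) :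
    OracleAlg (Bits (n k)) (Bits (C.m' k)) C.A.Config where
  start y := C.A.init (Construction.AInput k e y)
  step t F B γ := C.A.step (bothOracles (single k F : Family n) (singleBreaker k B)) (ω t) γ
  askF γ := pick fun x => ∃ s, C.A.Asks γ .owf s ∧ decodeCall n s = some ⟨k, x⟩
  askB γ := pick fun w => ∃ s, C.A.Asks γ .breaker s ∧ decodeCall C.m' s = some ⟨k, w⟩
  out γ := pick fun x' : Bits (n k) => C.A.code γ.state = Instr.halt ∧ γ.stack 0 = x'.toList
  congr t F F' B B' γ hF hB := by
    refine machine_step_congr C.A _ fun o s hs => ?_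
    cases o with
    | owf =>
      refine owfOracle_congr fun k' x hx => ?_
      by_cases hk : k' = k
      · subst hk
        rw [single_self, single_self]
        refine hF x ((pick_eq_some_iff ?_).mpr ⟨s, hs, hx⟩)
        rintro x x' ⟨s, h1, h2⟩ ⟨s', h1', h2'⟩
        obtain ⟨-, rfl⟩ := asks_unique C.A h1 h1'
        exact decodeCall_inj h2 h2'
      · rw [single_of_ne F hk, single_of_ne F' hk]
    | breaker =>
      refine breakerOracle_congr fun k' x hx => ?_
      by_cases hk : k' = k
      · subst hk
        rw [singleBreaker_self, singleBreaker_self]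
        refine hB x ((pick_eq_some_iff ?_).mpr ⟨s, hs, hx⟩)
        rintro x x' ⟨s, h1, h2⟩ ⟨s', h1', h2'⟩
        obtain ⟨-, rfl⟩ := asks_unique C.A h1 h1'
        exact decodeCall_inj h2 h2'
      · rw [singleBreaker_of_ne B hk, singleBreaker_of_ne B' hk]

theorem redAlg_run (C : Construction) (n : ℕ → ℕ) (k e : ℕ) (ω : ℕ → Bool)
    (F : Bits (n k) → Bits (n k)) (B : Bits (C.m' k) → Bool) (y : Bits (n k)) (t : ℕ) :
    (redAlg C n k e ω).run F B y t
      = C.A.run (bothOracles (single k F : Family n) (singleBreaker k B)) ω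
          (Construction.AInput k e y) t := by
  induction t with
  | zero => rfl
  | succ t ih => rw [OracleAlg.run, ih]; rfl

theorem redAlg_out_eq_some_iff (C : Construction) {n : ℕ → ℕ} {k e : ℕ} {ω : ℕ → Bool}
    {γ : C.A.Config} {x' : Bits (n k)} : (redAlg C n k e ω).out γ = some x' ↔
      C.A.code γ.state = Instr.halt ∧ γ.stack 0 = x'.toList :=
  pick_eq_some_iff fun _ _ h h' => List.Vector.toList_injective (h.2.symm.trans h'.2)

theorem aRun_eq_single (C : Construction) {n : ℕ → ℕ} (hsp : C.SecurityParameterRestricted n)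
    {f : Family n} (hf : f.Regular) (B : Breaker C.m') (k : ℕ) {e : ℕ} (he : 0 < e)
    (ω : ℕ → Bool) (y : Bits (n k)) :
    C.A.run (bothOracles (single k (f k) : Family n) (singleBreaker k (B k))) ω
        (Construction.AInput k e y)
      = C.A.run (bothOracles f B) ω (Construction.AInput k e y) := by
  refine machine_run_congr' C.A fun t o s hs => ?_
  cases o with
  | owf =>
    refine owfOracle_congr fun k' x hx => ?_
    obtain rfl := hsp.reduction_owf f hf B k e y ω t s k' x he hs hx
    rw [single_self]
  | breaker =>
    refine breakerOracle_congr fun k' x hx => ?_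
    obtain rfl := hsp.reduction_breaker f hf B k e y ω t s k' x he hs hx
    rw [singleBreaker_self]

/-- The running time of the reduction is bounded by one polynomial for all oracles: otherwise the
worst oracles for the single security parameters could be combined. -/
theorem exists_uniform_time (C : Construction) {n : ℕ → ℕ} (hC : C.IsFullyBlackBox n)
    (hsp : C.SecurityParameterRestricted n) {e : ℕ} (he : 0 < e) :
    ∃ c : ℕ, ∀ f : Family n, f.Regular → ∀ (B : Breaker C.m') k (y : Bits (n k)) (ω : ℕ → Bool),
      C.A.HaltsWithin (bothOracles f B) ω (Construction.AInput k e y) ((k + e) ^ c + c) := by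
  set H : ∀ k, (Bits (n k) → Bits (n k)) → (Bits (C.m' k) → Bool) → ℕ → Prop :=
    fun k F B t => ∀ (y : Bits (n k)) (ω : ℕ → Bool),
      C.A.HaltsWithin (bothOracles (single k F : Family n) (singleBreaker k B)) ω
        (Construction.AInput k e y) t with hH
  have hmono : ∀ k F B t t', H k F B t → t ≤ t' → H k F B t' := fun k F B t t' h htt y ω =>
    haltsWithin_mono C.A (h y ω) htt
  have hex : ∀ k F B, RegularFun F → ∃ t, H k F B t := by
    intro k F B hF
    obtain ⟨c, hc⟩ := hC.reduction_time _ (single_regular hF) (singleBreaker k B)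
    exact ⟨_, fun y ω => hc k e y ω he⟩
  have hworst : ∀ k, ∃ z : {F : Bits (n k) → Bits (n k) // RegularFun F} × (Bits (C.m' k) → Bool),
      ∀ F B t, RegularFun F → H k z.1.1 z.2 t → H k F B t := by
    intro k
    have hne : Nonempty ({F : Bits (n k) → Bits (n k) // RegularFun F} ×
        (Bits (C.m' k) → Bool)) :=
      ⟨⟨⟨id, regularFun_of_injective Function.injective_id⟩, fun _ => false⟩⟩
    obtain ⟨z, hz⟩ := Finite.exists_max
      (fun z : {F : Bits (n k) → Bits (n k) // RegularFun F} × (Bits (C.m' k) → Bool) =>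
        Nat.find (hex k z.1.1 z.2 z.1.2))
    refine ⟨z, fun F B t hF ht => ?_⟩
    have h1 : Nat.find (hex k F B hF) ≤ Nat.find (hex k z.1.1 z.2 z.1.2) := hz ⟨⟨F, hF⟩, B⟩
    have h2 : Nat.find (hex k z.1.1 z.2 z.1.2) ≤ t := Nat.find_min' _ ht
    exact hmono k F B _ t (Nat.find_spec (hex k F B hF)) (h1.trans h2)
  choose z hz using hworst
  have hreg : Family.Regular (fun k => (z k).1.1 : Family n) :=
    (family_regular_iff _).mpr fun k => (z k).1.2
  obtain ⟨c, hc⟩ := hC.reduction_time _ hreg (fun k => (z k).2)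
  refine ⟨c, fun f hf B k y ω => ?_⟩
  have h1 : H k (z k).1.1 (z k).2 ((k + e) ^ c + c) := by
    intro y ω
    have h2 := hc k e y ω he
    unfold OracleMachine.HaltsWithin at h2 ⊢
    rw [← aRun_eq_single C hsp hreg _ k he] at h2
    exact h2
  have h3 := hz k (f k) (B k) _ ((family_regular_iff f).mp hf k) h1 y ω
  unfold OracleMachine.HaltsWithin at h3 ⊢
  rw [aRun_eq_single C hsp hf B k he] at h3
  exact h3

/-! ### Finitely many coins -/

/-- The coins `b`, followed by zeros. -/
def extendCoins {q : ℕ} (b : Fin q → Bool) (t : ℕ) : Bool :=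
  if h : t < q then b ⟨t, h⟩ else false

/-- The event is a disjoint union of cylinders, one for each prefix in `S`, of measure 2^(-q) each.
-/
theorem coinMeasure_prefix (q : ℕ) (S : Finset (Fin q → Bool)) :
    coinMeasure.real {ω | (fun i : Fin q => ω i) ∈ S} = (S.card : ℝ) / 2 ^ q := by
  have h1 : {ω : ℕ → Bool | (fun i : Fin q => ω i) ∈ S}
      = ⋃ b ∈ S, Set.pi (range q : Finset ℕ) fun i => {extendCoins b i} := by
    ext ω
    simp only [Set.mem_ofPred_eq, Set.mem_iUnion, Set.mem_pi, mem_coe, mem_range,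
      Set.mem_singleton_iff, exists_prop]
    constructor
    · intro h
      exact ⟨_, h, fun i hi => by simp [extendCoins, hi]⟩
    · rintro ⟨b, hb, h⟩
      have : (fun i : Fin q => ω i) = b := by
        funext i
        rw [h i i.2, extendCoins, dif_pos i.2]
      rwa [this]
  have hsing : ∀ c : Bool, (PMF.uniformOfFintype Bool).toMeasure {c} = 2⁻¹ := by
    intro c
    rw [PMF.toMeasure_apply_singleton _ _ (MeasurableSet.singleton c),
      PMF.uniformOfFintype_apply, Fintype.card_bool]
    norm_num
  have h2 : ∀ b : Fin q → Bool,
      coinMeasure.real (Set.pi (range q : Finset ℕ) fun i => {extendCoins b i})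
        = (2 ^ q)⁻¹ := by
    intro b
    unfold coinMeasure Measure.real
    rw [Measure.infinitePi_pi _ fun i _ => MeasurableSet.singleton _]
    simp [hsing]
  have : IsProbabilityMeasure coinMeasure := by unfold coinMeasure; infer_instance
  rw [h1, measureReal_biUnion_finset]
  · simp only [h2, sum_const, nsmul_eq_mul, div_eq_mul_inv]
  · intro b _ b' _ hne
    rw [Function.onFun, Set.disjoint_left]
    intro ω hω hω'
    apply hne
    funext i
    have e1 := hω i (mem_coe.mpr (mem_range.mpr i.2))
    have e2 := hω' i (mem_coe.mpr (mem_range.mpr i.2))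
    simp only [Set.mem_singleton_iff, extendCoins, i.2, dif_pos] at e1 e2
    exact e1.symm.trans e2
  · intro b _
    exact MeasurableSet.pi (Set.to_countable _) fun i _ => MeasurableSet.singleton _

/-- A run that halts within q steps reads at most the first q coins, so the measure on infinite
sequences becomes a count over `Fin q → Bool`. -/
theorem inversionProb_eq (C : Construction) {n : ℕ → ℕ} (hsp : C.SecurityParameterRestricted n)
    {f : Family n} (hf : f.Regular) (B : Breaker C.m') (k : ℕ) {e : ℕ} (he : 0 < e) {q : ℕ}
    (hq : ∀ (y : Bits (n k)) (ω : ℕ → Bool),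
      C.A.HaltsWithin (bothOracles f B) ω (Construction.AInput k e y) q) :
    C.inversionProb f B k e = (∑ b : Fin q → Bool, ∑ x, if ∃ x',
        (redAlg C n k e (extendCoins b)).out
          ((redAlg C n k e (extendCoins b)).run (f k) (B k) (f k x) q) = some x' ∧
            f k x' = f k x then (1 : ℝ) else 0)
      / (Fintype.card (Fin q → Bool) * Fintype.card (Bits (n k))) := by
  unfold Construction.inversionProb
  rw [← div_div]
  refine congrArg (· / (Fintype.card (Bits (n k)) : ℝ)) ?_
  rw [Finset.sum_comm, Finset.sum_div]
  refine Finset.sum_congr rfl fun x _ => ?_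
  rw [sum_boole, Fintype.card_fun, Fintype.card_fin, Fintype.card_bool]
  push_cast
  rw [← coinMeasure_prefix]
  congr 1
  ext ω
  simp only [Set.mem_ofPred_eq, mem_filter, mem_univ, true_and]
  refine exists_congr fun x' => and_congr_left fun _ => ?_
  have hrun : C.A.run (bothOracles f B) (extendCoins fun i : Fin q => ω i)
      (Construction.AInput k e (f k x)) q
        = C.A.run (bothOracles f B) ω (Construction.AInput k e (f k x)) q :=
    machine_run_congr C.A (fun _ _ _ _ _ => rfl)
      (fun t ht => by rw [extendCoins, dif_pos ht]) q le_rfl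
  rw [redAlg_out_eq_some_iff, redAlg_run, aRun_eq_single C hsp hf B k he, hrun,
    outputs_iff_of_halts C.A (hq (f k x) ω)]
  exact ⟨fun h => ⟨hq (f k x) ω, h⟩, fun h => h.2⟩

/-! ### Choice of the parameters -/

/-- Each summand becomes a multiple of 2^(-a). In Δ = r(2L + a + 4) + a + 10 the part 2rL absorbs
(rs + 2)^(2r), and a further a remains. J = 2^a handles new heavy paths, and s = m' + a pays for the
union bound over 2^m' outputs. -/
theorem invBound_le {n r L a m' q : ℕ} (ha : a ≤ n / 2) (hL : r * (m' + a) + 2 ≤ 2 ^ L) :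
    invBound n r (r * (2 * L + a + 4) + a + 10) (2 ^ a) (m' + a) q (2 ^ m')
      ≤ (q * (4 + r) + 5) * (2 ^ a)⁻¹ := by
  unfold invBound
  have h1 : ((q : ℝ) * (1 + r) + 1) / 2 ^ (n / 2) ≤ (q * (1 + r) + 1) * (2 ^ a)⁻¹ := by
    rw [div_eq_mul_inv]
    gcongr
    · norm_num
  have h2 : ((r : ℝ) * ((m' + a : ℕ) : ℝ) + 2) ^ (2 * r)
      * (2 ^ (r * (2 * L + a + 4) + a + 10))⁻¹ ≤ (2 ^ a)⁻¹ := by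
    have h3 : ((r : ℝ) * ((m' + a : ℕ) : ℝ) + 2) ≤ 2 ^ L := by exact_mod_cast hL
    rw [← div_eq_mul_inv, div_le_iff₀ (by positivity), inv_mul_eq_div, le_div_iff₀ (by positivity)]
    calc ((r : ℝ) * ((m' + a : ℕ) : ℝ) + 2) ^ (2 * r) * 2 ^ a
        ≤ (2 ^ L) ^ (2 * r) * 2 ^ a := by gcongr
      _ = 2 ^ (L * (2 * r) + a) := by rw [← pow_mul, ← pow_add]
      _ ≤ _ := by
        refine pow_le_pow_right₀ (by norm_num) ?_
        nlinarith
  have h4 : (4 : ℝ) * ((2 ^ m' : ℕ) : ℝ) * (2 ^ (m' + a))⁻¹ = 4 * (2 ^ a)⁻¹ := by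
    push_cast
    rw [pow_add]
    field_simp
  have h5 : (q : ℝ) / ((2 ^ a : ℕ) : ℝ) = q * (2 ^ a)⁻¹ := by
    push_cast
    rw [div_eq_mul_inv]
  rw [h4, h5]
  have h6 : 2 * (q : ℝ) * (((r : ℝ) * ((m' + a : ℕ) : ℝ) + 2) ^ (2 * r)
      * (2 ^ (r * (2 * L + a + 4) + a + 10))⁻¹) ≤ 2 * q * (2 ^ a)⁻¹ := by
    gcongr
  calc _ ≤ ((q : ℝ) * (1 + r) + 1) * (2 ^ a)⁻¹ + 2 * q * (2 ^ a)⁻¹ + q * (2 ^ a)⁻¹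
        + 4 * (2 ^ a)⁻¹ := by
        gcongr
    _ = _ := by ring

theorem exists_hard_oracles (C : Construction) {n r : ℕ → ℕ} (hC : C.IsFullyBlackBox n)
    (hcalls : C.CallsAtMost n r) (k : ℕ) {q a L : ℕ}
    (ha : 1000 * ((r k + 1) * a) ≤ n k) (hL : 1000 * ((r k + 1) * (2 * L + 14)) ≤ n k)
    (hLs : r k * (C.m' k + a) + 2 ≤ 2 ^ L) :
    ∃ (F : Bits (n k) → Bits (n k)) (B : Bits (C.m' k) → Bool), RegularFun F ∧
      1 / 8 ≤ ((genAlg C n k).seedCount F B : ℝ) / Fintype.card (Bits (C.m k))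
        - ((univ.filter fun w => B w = true).card : ℝ) / Fintype.card (Bits (C.m' k)) ∧
      (∑ b : Fin q → Bool, ∑ x, if ∃ x', (redAlg C n k 8 (extendCoins b)).out
          ((redAlg C n k 8 (extendCoins b)).run F B (F x) q) = some x' ∧
            F x' = F x then (1 : ℝ) else 0)
      / (Fintype.card (Fin q → Bool) * Fintype.card (Bits (n k)))
        ≤ 8 * ((q * (4 + r k) + 5) * (2 ^ a)⁻¹) := by
  have hexp := hC.expanding k
  have hcard : ∀ l, Fintype.card (Bits l) = 2 ^ l := fun l => by
    rw [card_vector, Fintype.card_bool]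
  have hV : Nonempty (Bits (C.m k)) := ⟨List.Vector.replicate _ false⟩
  have ha' : a ≤ n k / 2 := by
    rw [Nat.le_div_iff_mul_le (by norm_num)]
    nlinarith
  have hL14 : 1000 * (2 * L + 14) ≤ n k := by nlinarith
  have hN : 2 * (r k * (C.m' k + a) + 1) ^ 2 ≤ 2 ^ n k :=
    calc 2 * (r k * (C.m' k + a) + 1) ^ 2 ≤ 2 * (2 ^ L) ^ 2 := by gcongr; omega
      _ = 2 ^ (L * 2 + 1) := by rw [← pow_mul, pow_succ, mul_comm]
      _ ≤ 2 ^ n k := Nat.pow_le_pow_right (by norm_num) (by omega)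
  have hVW : 2 * Fintype.card (Bits (C.m k)) ≤ Fintype.card (Bits (C.m' k)) := by
    rw [hcard, hcard, ← pow_succ']
    exact Nat.pow_le_pow_right (by norm_num) hexp
  have hr2 : 32 * r k ^ 2 ≤ 2 ^ (n k / 2) := by
    have hrL : r k ≤ 2 ^ L := by
      have : r k * 1 ≤ r k * (C.m' k + a) := Nat.mul_le_mul_left _ (by omega)
      omega
    calc 32 * r k ^ 2 ≤ 32 * (2 ^ L) ^ 2 := by gcongr
      _ = 2 ^ (L * 2 + 5) := by rw [← pow_mul, pow_add, mul_comm]; norm_num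
      _ ≤ 2 ^ (n k / 2) := Nat.pow_le_pow_right (by norm_num) (by omega)
  -- Δ is at most (r + 1)(2L + 14) + (r + 1)a, and each of these terms is at most n/1000.
  have hΔ : 32 * (r k * (2 * L + a + 4) + a + 10) ≤ n k / 2 := by
    rw [Nat.le_div_iff_mul_le (by norm_num)]
    nlinarith
  have hJr : 16 * (16 * 2 ^ a) ^ r k ≤ 2 ^ (r k * (2 * L + a + 4) + a + 10) :=
    calc 16 * (16 * 2 ^ a) ^ r k = 2 ^ (4 + (4 + a) * r k) := by
          rw [pow_add, pow_mul, pow_add]; norm_num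
      _ ≤ _ := Nat.pow_le_pow_right (by norm_num) (by nlinarith)
  obtain ⟨F, B, h1, h2, h3⟩ := exists_regular_breaker (genAlg C n k)
    (fun b : Fin q → Bool => redAlg C n k 8 (extendCoins b)) (n := n k) (r := r k)
    (Δ := r k * (2 * L + a + 4) + a + 10) (J := 2 ^ a) (s := C.m' k + a) (q := q)
    (hcard _) (by omega) Nat.one_le_two_pow
    (fun v ϖ => genAlg_exists_out C hC k v (regularFun_of_injective ϖ.injective))
    (fun v ϖ => genAlg_card_le C hcalls k v (regularFun_of_injective ϖ.injective))
    hN (by omega) hVW hr2 hΔ hJr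
  rw [hcard (C.m' k)] at h3
  have h4 := h3.trans (mul_le_mul_of_nonneg_left (invBound_le (q := q) ha' hLs) (by norm_num))
  refine ⟨F, B, h1, h2, le_trans (le_of_eq ?_) h4⟩
  congr!

/-! ### Asymptotics -/

/-- An upper bound for the logarithm of the security parameter. -/
def lg (k : ℕ) : ℕ := Nat.clog 2 (k + 2)

theorem add_two_le_pow_lg (k : ℕ) : k + 2 ≤ 2 ^ lg k := Nat.le_pow_clog (by norm_num) _

theorem one_le_lg (k : ℕ) : 1 ≤ lg k := Nat.clog_pos (by norm_num) (by omega)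

/-- The ceiling adds at most 1 to the binary logarithm, and 1 ≤ log(k + 2) / log 2; the constant
works because 2 / log 2 < 3. -/
theorem lg_le_log (k : ℕ) : (lg k : ℝ) ≤ 3 * Real.log (k + 2) := by
  have h1 : 2 ^ (lg k).pred < k + 2 := Nat.pow_pred_clog_lt_self (by norm_num) (by omega)
  have h2 : (2 : ℝ) ^ (lg k - 1) < k + 2 := by exact_mod_cast h1
  have h3 := Real.log_lt_log (by positivity) h2
  rw [Real.log_pow, Nat.cast_sub (one_le_lg k)] at h3
  have h4 : Real.log 2 ≤ Real.log (k + 2) :=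
    Real.log_le_log (by norm_num) (by linarith [Nat.cast_nonneg (α := ℝ) k])
  have h5 := Real.log_two_gt_d9
  push_cast at h3
  nlinarith

/-- `h k` is at most `2 ^ (c * lg k)` for some constant `c`. -/
def LgBounded (h : ℕ → ℕ) : Prop := ∃ c : ℕ, ∀ k, h k ≤ 2 ^ (c * lg k)

theorem LgBounded.add {h h' : ℕ → ℕ} (H : LgBounded h) (H' : LgBounded h') :
    LgBounded fun k => h k + h' k := by
  obtain ⟨c, hc⟩ := H
  obtain ⟨c', hc'⟩ := H'
  refine ⟨c + c' + 1, fun k => ?_⟩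
  have h1 := one_le_lg k
  calc h k + h' k ≤ 2 ^ ((c + c') * lg k) + 2 ^ ((c + c') * lg k) := by
        refine Nat.add_le_add ((hc k).trans ?_) ((hc' k).trans ?_) <;>
        exact Nat.pow_le_pow_right (by norm_num) (Nat.mul_le_mul_right _ (by omega))
    _ = 2 ^ ((c + c') * lg k + 1) := by rw [pow_succ]; ring
    _ ≤ _ := Nat.pow_le_pow_right (by norm_num) (by nlinarith)

theorem LgBounded.mul {h h' : ℕ → ℕ} (H : LgBounded h) (H' : LgBounded h') :
    LgBounded fun k => h k * h' k := by
  obtain ⟨c, hc⟩ := H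
  obtain ⟨c', hc'⟩ := H'
  refine ⟨c + c', fun k => ?_⟩
  rw [add_mul, pow_add]
  exact Nat.mul_le_mul (hc k) (hc' k)

theorem LgBounded.pow {h : ℕ → ℕ} (H : LgBounded h) (d : ℕ) : LgBounded fun k => h k ^ d := by
  obtain ⟨c, hc⟩ := H
  refine ⟨c * d, fun k => ?_⟩
  refine (Nat.pow_le_pow_left (hc k) d).trans (le_of_eq ?_)
  rw [← pow_mul]
  congr 1
  ring

theorem LgBounded.mono {h h' : ℕ → ℕ} (H : LgBounded h') (hle : ∀ k, h k ≤ h' k) :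
    LgBounded h := by
  obtain ⟨c, hc⟩ := H
  exact ⟨c, fun k => (hle k).trans (hc k)⟩

theorem lgBounded_const (c : ℕ) : LgBounded fun _ => c := by
  refine ⟨c, fun k => (Nat.lt_two_pow_self).le.trans ?_⟩
  exact Nat.pow_le_pow_right (by norm_num) (Nat.le_mul_of_pos_right _ (one_le_lg k))

theorem lgBounded_id : LgBounded fun k => k :=
  ⟨1, fun k => by rw [one_mul]; exact (Nat.le_add_right k 2).trans (add_two_le_pow_lg k)⟩

theorem LgBounded.of_polyBounded {h : ℕ → ℕ} (H : PolyBounded h) : LgBounded h := by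
  obtain ⟨c, hc⟩ := H
  exact ((lgBounded_id.pow c).add (lgBounded_const c)).mono hc

theorem tendsto_of_related {n : ℕ → ℕ} (hlow : ∃ c : ℕ, ∀ k : ℕ, k ≤ n k ^ c + c) :
    Tendsto n atTop atTop := by
  obtain ⟨c, hc⟩ := hlow
  rw [tendsto_atTop]
  intro b
  filter_upwards [eventually_gt_atTop (b ^ c + c)] with k hk
  by_contra hlt
  have h1 : n k ^ c ≤ b ^ c := Nat.pow_le_pow_left (by omega) c
  have h2 := hc k
  omega

/-- As k is polynomially bounded in n, lg k = O(log n). So r lg k is o(n) by `hro`, and lg k alone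
is o(n). -/
theorem eventually_mul_lg_le {n r : ℕ → ℕ} (hlow : ∃ c : ℕ, ∀ k : ℕ, k ≤ n k ^ c + c)
    (hro : (fun k : ℕ => (r k : ℝ)) =o[atTop] fun k : ℕ => (n k : ℝ) / Real.log (n k)) (b : ℕ) :
    ∀ᶠ k in atTop, b * ((r k + 1) * lg k) ≤ n k := by
  have htend := tendsto_of_related hlow
  obtain ⟨c, hc⟩ := hlow
  have htr : Tendsto (fun k => (n k : ℝ)) atTop atTop := tendsto_natCast_atTop_atTop.comp htend
  have hlogo := Real.isLittleO_log_id_atTop.comp_tendsto htr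
  -- The factor 3(c + 2) converts log n into a bound for lg k; the 2 leaves half of n for r log n
  -- and half for log n.
  have hε : (0 : ℝ) < 1 / (2 * (b + 1) * (3 * (c + 2))) := by positivity
  have h1 := hro.bound hε
  have h2 := hlogo.bound hε
  filter_upwards [h1, h2, htend.eventually_ge_atTop (c + 4)] with k h1 h2 h3
  have hn1 : (1 : ℝ) < n k := by exact_mod_cast (by omega : 1 < n k)
  have hlog : 0 < Real.log (n k) := Real.log_pos hn1
  rw [Real.norm_of_nonneg (by positivity), Real.norm_of_nonneg (by positivity)] at h1
  simp only [Function.comp_apply, id] at h2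
  rw [Real.norm_of_nonneg hlog.le, Real.norm_of_nonneg (by positivity)] at h2
  have hk : k + 2 ≤ n k ^ (c + 2) := by
    have e1 : c + 4 ≤ n k := h3
    have e2 : 1 ≤ n k ^ c := Nat.one_le_pow _ _ (by omega)
    have e3 := hc k
    have e4 : n k + 1 ≤ n k ^ 2 := by nlinarith
    calc k + 2 ≤ n k ^ c + 1 * n k := by omega
      _ ≤ n k ^ c + n k ^ c * n k := by gcongr
      _ = n k ^ c * (n k + 1) := by ring
      _ ≤ n k ^ c * n k ^ 2 := Nat.mul_le_mul_left _ e4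
      _ = n k ^ (c + 2) := (pow_add _ _ _).symm
  have hlk : Real.log (k + 2) ≤ (c + 2) * Real.log (n k) := by
    have e1 : ((k : ℝ) + 2) ≤ (n k : ℝ) ^ (c + 2) := by exact_mod_cast hk
    have e2 := Real.log_le_log (by positivity) e1
    rw [Real.log_pow] at e2
    push_cast at e2
    exact e2
  have hlg : (lg k : ℝ) ≤ 3 * (c + 2) * Real.log (n k) := by
    have := lg_le_log k
    nlinarith
  have hreal : (b : ℝ) * ((r k + 1) * lg k) ≤ n k := by
    have hb : (b : ℝ) ≤ b + 1 := by linarith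
    have e1 : (r k : ℝ) * Real.log (n k) ≤ 1 / (2 * (b + 1) * (3 * (c + 2))) * n k := by
      calc (r k : ℝ) * Real.log (n k)
          ≤ (1 / (2 * (b + 1) * (3 * (c + 2))) * (n k / Real.log (n k))) * Real.log (n k) := by
            gcongr
        _ = _ := by field_simp
    calc (b : ℝ) * ((r k + 1) * lg k)
        ≤ (b + 1) * ((r k + 1) * (3 * (c + 2) * Real.log (n k))) := by gcongr
      _ = (b + 1) * (3 * (c + 2)) * (r k * Real.log (n k) + Real.log (n k)) := by ring
      _ ≤ (b + 1) * (3 * (c + 2)) * (1 / (2 * (b + 1) * (3 * (c + 2))) * n k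
          + 1 / (2 * (b + 1) * (3 * (c + 2))) * n k) := by gcongr
      _ = n k := by field_simp; norm_num
  exact_mod_cast hreal

/-- An exponent of (d + c + 1) lg k beats k^d and P, with 2^(-lg k) ≤ 1/(k + 1) to spare. -/
theorem superpolynomialDecay_of_le {g : ℕ → ℝ} {P a : ℕ → ℕ} (hg : ∀ k, 0 ≤ g k)
    (hP : LgBounded P) (ha : ∀ b : ℕ, ∀ᶠ k in atTop, b * lg k ≤ a k)
    (hle : ∀ᶠ k in atTop, g k ≤ P k * (2 ^ a k)⁻¹) :
    SuperpolynomialDecay atTop (fun k : ℕ => (k : ℝ)) g := by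
  obtain ⟨c, hc⟩ := hP
  intro d
  have hlim : Tendsto (fun k : ℕ => 1 / ((k : ℝ) + 1)) atTop (nhds 0) :=
    tendsto_one_div_add_atTop_nhds_zero_nat
  refine squeeze_zero' (Eventually.of_forall fun k => ?_) ?_ hlim
  · exact mul_nonneg (by positivity) (hg k)
  · filter_upwards [hle, ha (d + c + 1)] with k h1 h2
    have e1 : (k : ℝ) ≤ 2 ^ lg k := by
      exact_mod_cast (Nat.le_add_right k 2).trans (add_two_le_pow_lg k)
    have e2 : (P k : ℝ) ≤ 2 ^ (c * lg k) := by exact_mod_cast hc k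
    have e3 : (k : ℝ) + 1 ≤ 2 ^ lg k := by
      exact_mod_cast (by omega : k + 1 ≤ k + 2).trans (add_two_le_pow_lg k)
    have e4 : (2 : ℝ) ^ ((d + c + 1) * lg k) ≤ 2 ^ a k := pow_le_pow_right₀ (by norm_num) h2
    calc (k : ℝ) ^ d * g k ≤ (2 ^ lg k) ^ d * (2 ^ (c * lg k) * (2 ^ ((d + c + 1) * lg k))⁻¹) := by
          refine mul_le_mul (by gcongr) (h1.trans ?_) (hg k) (by positivity)
          gcongr
      _ = 1 / 2 ^ lg k := by
          rw [show (d + c + 1) * lg k = lg k * d + c * lg k + lg k by ring, pow_add, pow_add,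
            ← pow_mul]
          field_simp
      _ ≤ 1 / ((k : ℝ) + 1) := by gcongr

/-! ### The contradiction -/

theorem inversionProb_nonneg (C : Construction) {n : ℕ → ℕ} (f : Family n) (B : Breaker C.m')
    (k e : ℕ) : 0 ≤ C.inversionProb f B k e :=
  div_nonneg (Finset.sum_nonneg fun _ _ => measureReal_nonneg) (by positivity)

theorem no_construction (n r : ℕ → ℕ) (hn : PolyBounded n) (hr : PolyBounded r)
    (hlow : ∃ c : ℕ, ∀ k : ℕ, k ≤ n k ^ c + c)
    (hro : (fun k : ℕ => (r k : ℝ)) =o[atTop] fun k : ℕ => (n k : ℝ) / Real.log (n k))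
    (C : Construction) (hC : C.IsFullyBlackBox n) (hsp : C.SecurityParameterRestricted n)
    (hcalls : C.CallsAtMost n r) : False := by
  obtain ⟨c₁, hc₁⟩ := output_length_le C hC hsp
  obtain ⟨c₂, hc₂⟩ := exists_uniform_time C hC hsp (e := 8) (by norm_num)
  set q : ℕ → ℕ := fun k => (k + 8) ^ c₂ + c₂ with hq
  -- The largest a with 1000(r + 1)a ≤ n. It exceeds every multiple of lg k eventually, so 2^(-a) is
  -- negligible.
  set a : ℕ → ℕ := fun k => n k / (1000 * (r k + 1)) with ha
  have hnb := LgBounded.of_polyBounded hn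
  have hrb := LgBounded.of_polyBounded hr
  have hm'b : LgBounded C.m' :=
    ((lgBounded_id.add hnb).add ((lgBounded_id.pow c₁).add (lgBounded_const c₁))).mono hc₁
  have hqb : LgBounded q := ((lgBounded_id.add (lgBounded_const 8)).pow c₂).add (lgBounded_const c₂)
  have hab : LgBounded a := hnb.mono fun k => Nat.div_le_self _ _
  -- This gives L = c₃ lg k with r(m' + a) + 2 ≤ 2^L.
  obtain ⟨c₃, hc₃⟩ := (hrb.mul (hm'b.add hab)).add (lgBounded_const 2)
  have hgrow := eventually_mul_lg_le hlow hro
  -- The time bound `q` holds for all oracles at once, so it can be fixed before the oracles are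
  -- chosen. The finitely many `k` where the parameters do not fit get the identity and a breaker
  -- that rejects everything.
  have hex : ∀ k, ∃ (F : Bits (n k) → Bits (n k)) (B : Bits (C.m' k) → Bool), RegularFun F ∧
      (1000 * ((r k + 1) * (2 * (c₃ * lg k) + 14)) ≤ n k →
      1 / 8 ≤ ((genAlg C n k).seedCount F B : ℝ) / Fintype.card (Bits (C.m k))
        - ((univ.filter fun w => B w = true).card : ℝ) / Fintype.card (Bits (C.m' k)) ∧
      (∑ b : Fin (q k) → Bool, ∑ x, if ∃ x', (redAlg C n k 8 (extendCoins b)).out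
          ((redAlg C n k 8 (extendCoins b)).run F B (F x) (q k)) = some x' ∧
            F x' = F x then (1 : ℝ) else 0)
      / (Fintype.card (Fin (q k) → Bool) * Fintype.card (Bits (n k)))
        ≤ 8 * ((q k * (4 + r k) + 5) * (2 ^ a k)⁻¹)) := by
    intro k
    by_cases hk : 1000 * ((r k + 1) * (2 * (c₃ * lg k) + 14)) ≤ n k
    · have ha' : 1000 * ((r k + 1) * a k) ≤ n k := by
        rw [← mul_assoc]
        exact Nat.mul_div_le _ _
      obtain ⟨F, B, h1, h2⟩ := exists_hard_oracles C hC hcalls k (q := q k) ha' hk (hc₃ k)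
      exact ⟨F, B, h1, fun _ => h2⟩
    · exact ⟨id, fun _ => false, regularFun_of_injective Function.injective_id,
        fun h => absurd h hk⟩
  choose f B hreg hgood using hex
  have hf : Family.Regular (f : Family n) := (family_regular_iff _).mpr hreg
  have hev : ∀ᶠ k in atTop, 1000 * ((r k + 1) * (2 * (c₃ * lg k) + 14)) ≤ n k := by
    filter_upwards [hgrow (1000 * (2 * c₃ + 14))] with k hk
    refine le_trans ?_ hk
    have h1 := one_le_lg k
    rw [mul_assoc]
    refine Nat.mul_le_mul_left _ ?_
    have : 2 * (c₃ * lg k) + 14 ≤ (2 * c₃ + 14) * lg k := by nlinarith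
    calc (r k + 1) * (2 * (c₃ * lg k) + 14) ≤ (r k + 1) * ((2 * c₃ + 14) * lg k) :=
          Nat.mul_le_mul_left _ this
      _ = _ := by ring
  -- The advantage is at least 1/8 for all large `k`, so the constant polynomial 8 serves as 1/ε.
  refine hC.reduction f hf (Polynomial.C 8) (fun ℓ => by simp) B (Eventually.frequently ?_) ?_
  · filter_upwards [hev] with k hk
    rw [advantage_eq C hsp hf]
    simpa using (hgood k hk).1
  · have hP : LgBounded fun k => 8 * (q k * (4 + r k) + 5) :=
      (lgBounded_const 8).mul ((hqb.mul ((lgBounded_const 4).add hrb)).add (lgBounded_const 5))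
    refine superpolynomialDecay_of_le (a := a) (fun k => inversionProb_nonneg C f B k _) hP ?_ ?_
    · intro b
      filter_upwards [hgrow (1000 * b)] with k hk
      rw [ha, Nat.le_div_iff_mul_le (by positivity)]
      refine le_trans (le_of_eq ?_) hk
      ring
    · filter_upwards [hev] with k hk
      rw [Polynomial.eval_C, inversionProb_eq C hsp hf B k (by norm_num)
        (fun y ω => hc₂ f hf B k y ω)]
      refine (hgood k hk).2.trans (le_of_eq ?_)
      push_cast
      ring

end

end BlackBox

theorem theorem1 (n r : ℕ → ℕ)
    (hn : PolyBounded n) (hr : PolyBounded r)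
    (hnc : PolyTimeComputable n) (hrc : PolyTimeComputable r)
    (hlow : ∃ c : ℕ, ∀ k : ℕ, k ≤ n k ^ c + c)
    (hro : (fun k : ℕ => (r k : ℝ)) =o[atTop] fun k : ℕ => (n k : ℝ) / Real.log (n k)) :
    ¬ ∃ C : Construction,
      C.IsFullyBlackBox n ∧ C.SecurityParameterRestricted n ∧ C.CallsAtMost n r := by
  rintro ⟨C, hC, hsp, hcalls⟩
  exact BlackBox.no_construction n r hn hr hlow hro C hC hsp hcalls
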